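/- **Conventions.** Languages are countable. $\forall_0=\exists_0$ is the set of quantifier-free formulas; a $\forall_{n+1}$-formula is a (possibly empty) block of universal quantifiers followed by an $\exists_n$-formula, and an $\exists_{n+1}$-formula is a (possibly empty) block of existential quantifiers followed by a $\forall_n$-formula. A theory is $\forall_n$-axiomatizable if it has the same consequences as some set of $\forall_n$-sentences, and bounded if it is $\forall_n$-axiomatizable for some finite $n$. A complete type $p(x_1,\dots,x_m)$ is bounded if the theory $p(a_1,\dots,a_m)$, with new constants $a_1,\dots,a_m$, is bounded; a theory has unbounded types if some complete type over it is unbounded. A theory is $\kappa$-stable if there are at most $\kappa$ complete $1$-types over every set of at most $\kappa$ parameters in every model, superstable if it is $\kappa$-stable for all sufficiently large $\kappa$, and strictly superstable if it is superstable but not $\omega$-stable. Two theories are bi-interpretable if there are parameter-free (possibly many-dimensional) interpretations of each in the other, uniform over all models, such that both composites are isomorphic to the identity by isomorphisms that are uniformly defined by formulas. **The theory $T$.** Let $T_0$ be the theory in unary predicates $P_i$ and binary relations $<_i$ $(i\in\omega)$ which says that $P_i\cap P_j=\emptyset$ for $i\neq j$, that $<_i\subseteq P_i\times P_{i+1}$,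 and that every $x\in P_{i+1}$ has exactly one $y$ with $y<_i x$. Let $(\mathcal M_i)_i$ list the finite models of $T_0$, one of each isomorphism type. For each $i$ and each $j\in\omega$ let $C_i^j$ be a set of new constants in a fixed bijection with the domain of $\mathcal M_i$, all these sets being disjoint, and let $C=\bigcup_{i,j}C_i^j$. Let $T$ be the theory, in the language of $T_0$ together with the constants $C$, which consists of $T_0$ and the axioms saying that the constants are pairwise distinct, that for all $i,j$ the fixed bijection is an isomorphism between the induced structure on $C_i^j$ and $\mathcal M_i$, and that for all $i,j,k$ and all $x,y$, if $x\in C_i^j$ and ($x<_k y$ or $y<_k x$), then $y\in C_i^j$. **The variants.** Let $T'$ be the reformulation of $T$ in the language with the predicates $P_k$, the constants $C$ and unary function symbols $\operatorname{Pred}_k$ in place of the $<_k$: its axioms say that the $P_k$ are pairwise disjoint and that $\operatorname{Pred}_k$ maps $P_{k+1}$ into $P_k$ and fixes every element outside $P_{k+1}$, and include the axioms of $T$ about the constants, with $x<_k y$ read as $P_{k+1}(y)\wedge\operatorname{Pred}_k(y)=x$. Let $T''$ be the reformulation of $T$ in the relational language with the $P_k$, the $<_k$ and a unary predicate $U_c$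 for each $c\in C$: its axioms are $T_0$, that each $U_c$ holds of exactly one element, and the axioms of $T$ about the constants, with $c$ read as the unique element of $U_c$. **Statement.** The theory $T$ is complete, $\forall_2$-axiomatizable (hence bounded), has unbounded types, and is strictly superstable. Moreover: 1. $T'$ is complete, $\forall_1$-axiomatizable (hence bounded), has unbounded types, is strictly superstable, and is bi-interpretable with $T$. 2. $T''$ is a theory in a relational language which is complete, $\forall_2$-axiomatizable (hence bounded), has unbounded types, is strictly superstable, and is bi-interpretable with $T$. The languages of $T$, $T'$ and $T''$ are all countable. -/

import Mathlib

open FirstOrder FirstOrder.Language FirstOrder.Language.Theory Cardinal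
open scoped FirstOrder

/-! ## Complexity of formulas, theories and types -/

namespace FOComplexity

/-- Formulas of the form `∀ x₁ … ∀ xₖ ψ` (with `k ≥ 0`) where `ψ` satisfies `P`. -/
inductive AllBlock {L : FirstOrder.Language.{0, 0}} {α : Type}
    (P : ∀ m : ℕ, L.BoundedFormula α m → Prop) : ∀ m : ℕ, L.BoundedFormula α m → Prop
  | base {m : ℕ} {φ : L.BoundedFormula α m} (h : P m φ) : AllBlock P m φ
  | all {m : ℕ} {φ : L.BoundedFormula α (m + 1)} (h : AllBlock P (m + 1) φ) : AllBlock P m φ.all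

/-- Formulas of the form `∃ x₁ … ∃ xₖ ψ` (with `k ≥ 0`) where `ψ` satisfies `P`. -/
inductive ExBlock {L : FirstOrder.Language.{0, 0}} {α : Type}
    (P : ∀ m : ℕ, L.BoundedFormula α m → Prop) : ∀ m : ℕ, L.BoundedFormula α m → Prop
  | base {m : ℕ} {φ : L.BoundedFormula α m} (h : P m φ) : ExBlock P m φ
  | ex {m : ℕ} {φ : L.BoundedFormula α (m + 1)} (h : ExBlock P (m + 1) φ) : ExBlock P m φ.ex

mutual
/-- `∀ₙ`-formulas: `∀₀` means quantifier-free, and a `∀ₙ₊₁`-formula is a block of universal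
quantifiers in front of an `∃ₙ`-formula. -/
def IsForall {L : FirstOrder.Language.{0, 0}} {α : Type} : ℕ → ∀ m : ℕ, L.BoundedFormula α m → Prop
  | 0 => fun _ φ => φ.IsQF
  | n + 1 => AllBlock (IsExists n)
/-- `∃ₙ`-formulas. -/
def IsExists {L : FirstOrder.Language.{0, 0}} {α : Type} : ℕ → ∀ m : ℕ, L.BoundedFormula α m → Prop
  | 0 => fun _ φ => φ.IsQF
  | n + 1 => ExBlock (IsForall n)
end

/-- `T` is `∀ₙ`-axiomatizable: some set of `∀ₙ`-sentences has the same consequences as `T`. -/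
def ForallAxiomatizable {L : FirstOrder.Language.{0, 0}} (n : ℕ) (T : L.Theory) : Prop :=
  ∃ S : L.Theory, (∀ φ ∈ S, IsForall n 0 φ) ∧ ∀ φ : L.Sentence, S ⊨ᵇ φ ↔ T ⊨ᵇ φ

/-- Boundedly axiomatizable theories. -/
def Bounded {L : FirstOrder.Language.{0, 0}} (T : L.Theory) : Prop :=
  ∃ n : ℕ, ForallAxiomatizable n T

/-- Some complete type `p(x₁, …, xₘ)` over `T` is unbounded, where `p` is regarded as the theory
`p(a₁, …, aₘ)` in the language with new constants `a₁, …, aₘ`. -/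
def HasUnboundedTypes {L : FirstOrder.Language.{0, 0}} (T : L.Theory) : Prop :=
  ∃ (m : ℕ) (p : T.CompleteType (Fin m)), ¬ Bounded p.toTheory

/-! ## Stability -/

/-- `T` is `κ`-stable: there are at most `κ` complete `1`-types over any set of at most `κ`
parameters in any model of `T`. -/
def StableIn {L : FirstOrder.Language.{0, 0}} (T : L.Theory) (κ : Cardinal.{0}) : Prop :=
  ∀ (M : ModelType.{0, 0, 0} T) (A : Set M), #A ≤ κ →
    #((L[[A]].completeTheory M).CompleteType (Fin 1)) ≤ κ

/-- `T` is superstable: it is `κ`-stable for all sufficiently large `κ`. -/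
def Superstable {L : FirstOrder.Language.{0, 0}} (T : L.Theory) : Prop :=
  ∃ κ₀ : Cardinal.{0}, ∀ κ : Cardinal.{0}, κ₀ ≤ κ → StableIn T κ

/-- Superstable, but not `ω`-stable. -/
def StrictlySuperstable {L : FirstOrder.Language.{0, 0}} (T : L.Theory) : Prop :=
  Superstable T ∧ ¬ StableIn T ℵ₀

/-! ## Interpretations -/

/-- The formulas of an `n`-dimensional interpretation (without parameters) of `L'`-structures in
`L`-structures: a domain, equality, and one formula for each symbol of `L'`. In `func`, the
variables `Sum.inl (i, _)` stand for the `i`-th argument and `Sum.inr _` for the value. -/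
structure Interp (L L' : FirstOrder.Language.{0, 0}) where
  dim : ℕ
  dom : L.Formula (Fin dim)
  eq : L.Formula (Fin dim ⊕ Fin dim)
  rel : ∀ k : ℕ, L'.Relations k → L.Formula (Fin k × Fin dim)
  func : ∀ k : ℕ, L'.Functions k → L.Formula ((Fin k × Fin dim) ⊕ Fin dim)

/-- `Γ` interprets the `L'`-structure `N` in the `L`-structure `M` with coordinate map `f`
(only the values of `f` on the tuples that satisfy the domain formula matter). -/
structure Interp.Interprets {L L' : FirstOrder.Language.{0, 0}} (Γ : Interp L L') (M N : Type)
    [L.Structure M] [L'.Structure N] (f : (Fin Γ.dim → M) → N) : Prop where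
  surj : ∀ b : N, ∃ a : Fin Γ.dim → M, Γ.dom.Realize a ∧ f a = b
  eq_iff : ∀ a a' : Fin Γ.dim → M, Γ.dom.Realize a → Γ.dom.Realize a' →
    (f a = f a' ↔ Γ.eq.Realize (Sum.elim a a'))
  rel_iff : ∀ (k : ℕ) (R : L'.Relations k) (a : Fin k → Fin Γ.dim → M),
    (∀ i, Γ.dom.Realize (a i)) →
    (Structure.RelMap R (fun i => f (a i)) ↔ (Γ.rel k R).Realize (fun q => a q.1 q.2))
  func_iff : ∀ (k : ℕ) (F : L'.Functions k) (a : Fin k → Fin Γ.dim → M) (b : Fin Γ.dim → M),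
    (∀ i, Γ.dom.Realize (a i)) → Γ.dom.Realize b →
    (Structure.funMap F (fun i => f (a i)) = f b ↔
      (Γ.func k F).Realize (Sum.elim (fun q => a q.1 q.2) b))

/-- `Γ` is an interpretation of the theory `T'` in the theory `T`: in every model of `T` it
interprets a model of `T'`. -/
def Interp.IsInterpretation {L L' : FirstOrder.Language.{0, 0}} (Γ : Interp L L')
    (T : L.Theory) (T' : L'.Theory) : Prop :=
  ∀ M : ModelType.{0, 0, 0} T, ∃ (N : ModelType.{0, 0, 0} T') (f : (Fin Γ.dim → M) → N), Γ.Interprets M N f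

/-- The formula `χ` defines, in each model `M` of `T`, an isomorphism onto `M` from the structure
obtained by interpreting a model `N` of `T'` in `M` through `Γ` and then a model of `T` in `N`
through `Δ`. -/
def DefinesReturnIso {L L' : FirstOrder.Language.{0, 0}} (T : L.Theory) (T' : L'.Theory)
    (Γ : Interp L L') (Δ : Interp L' L)
    (χ : L.Formula ((Fin Δ.dim × Fin Γ.dim) ⊕ Fin 1)) : Prop :=
  ∀ (M : ModelType.{0, 0, 0} T) (N : ModelType.{0, 0, 0} T') (f : (Fin Γ.dim → M) → N)
    (M' : ModelType.{0, 0, 0} T) (g : (Fin Δ.dim → N) → M'),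
    Γ.Interprets M N f → Δ.Interprets N M' g →
    ∃ e : M' ≃[L] M, ∀ (a : Fin Δ.dim → Fin Γ.dim → M) (b : M),
      (∀ i, Γ.dom.Realize (a i)) → Δ.dom.Realize (fun i => f (a i)) →
      (e (g (fun i => f (a i))) = b ↔
        χ.Realize (Sum.elim (fun q => a q.1 q.2) (fun _ => b)))

/-- Bi-interpretability of theories: interpretations in both directions whose two composites are
definably isomorphic to the identity, uniformly in all models. -/
def BiInterpretable {L L' : FirstOrder.Language.{0, 0}} (T : L.Theory) (T' : L'.Theory) : Prop :=
  ∃ (Γ : Interp L L') (Δ : Interp L' L),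
    Γ.IsInterpretation T T' ∧ Δ.IsInterpretation T' T ∧
    (∃ χ, DefinesReturnIso T T' Γ Δ χ) ∧ (∃ χ', DefinesReturnIso T' T Δ Γ χ')

end FOComplexity

namespace TreeTheory

/-! ## The base theory of forests with named levels -/

/-- Unary predicates `Pᵢ` (level `i`) and binary relations `<ᵢ`. -/
inductive TreeRel : ℕ → Type
  | level (i : ℕ) : TreeRel 1
  | below (i : ℕ) : TreeRel 2

/-- The language `{Pᵢ} ∪ {<ᵢ}`. -/
def treeLang : FirstOrder.Language.{0, 0} := ⟨fun _ => Empty, TreeRel⟩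

/-- The symbol `Pᵢ`. -/
def levelSym (i : ℕ) : treeLang.Relations 1 := TreeRel.level i

/-- The symbol `<ᵢ`. -/
def belowSym (i : ℕ) : treeLang.Relations 2 := TreeRel.below i

/-- `Pᵢ(t)`. -/
def inLevel {α : Type} {n : ℕ} (i : ℕ) (t : treeLang.Term (α ⊕ Fin n)) :
    treeLang.BoundedFormula α n :=
  (levelSym i).boundedFormula₁ t

/-- `s <ᵢ t`. -/
def isBelow {α : Type} {n : ℕ} (i : ℕ) (s t : treeLang.Term (α ⊕ Fin n)) :
    treeLang.BoundedFormula α n :=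
  (belowSym i).boundedFormula₂ s t

/-- The base theory: the levels are disjoint, `<ᵢ` relates elements of level `i` to elements of
level `i + 1`, and every element of level `i + 1` has exactly one predecessor. -/
def baseTheory : treeLang.Theory :=
  {φ | ∃ i j : ℕ, i ≠ j ∧ φ = ∀' ∼(inLevel i (&0) ⊓ inLevel j (&0))} ∪
  {φ | ∃ i : ℕ, φ = ∀' ∀' (isBelow i (&0) (&1) ⟹ (inLevel i (&0) ⊓ inLevel (i + 1) (&1)))} ∪
  {φ | ∃ i : ℕ, φ = ∀' (inLevel (i + 1) (&0) ⟹ ∃' (inLevel i (&1) ⊓ isBelow i (&1) (&0)))} ∪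
  {φ | ∃ i : ℕ, φ =
    ∀' ∀' ∀' ((isBelow i (&0) (&2) ⊓ isBelow i (&1) (&2)) ⟹ ((&0) =' (&1)))}

/-! ## The constants: infinitely many copies of every finite model -/

/-- A finite model of the base theory, with underlying set `{0, …, card - 1}`. -/
structure FinModel where
  card : ℕ
  struc : treeLang.Structure (Fin card)
  isModel : (Fin card) ⊨ baseTheory

attribute [instance] FinModel.struc FinModel.isModel

/-- Isomorphism of finite models. -/
instance FinModel.setoid : Setoid FinModel where
  r A B := Nonempty (Fin A.card ≃[treeLang] Fin B.card)
  iseqv :=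
    { refl := fun A => ⟨FirstOrder.Language.Equiv.refl treeLang (Fin A.card)⟩
      symm := fun ⟨e⟩ => ⟨e.symm⟩
      trans := fun ⟨e⟩ ⟨e'⟩ => ⟨e'.comp e⟩ }

/-- The isomorphism types of finite models of the base theory. -/
def FinIndex : Type := Quotient FinModel.setoid

/-- The finite models `𝓜ᵢ`, one of each isomorphism type. -/
noncomputable def finModel (i : FinIndex) : FinModel := Quotient.out i

/-- The set of all constants. For fixed `i` and `j`, the constants `⟨i, j, a⟩` form the set `Cᵢʲ`,
the `j`-th copy of `𝓜ᵢ`. -/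
structure Const where
  i : FinIndex
  j : ℕ
  a : Fin (finModel i).card

/-- The element `a` of `𝓜ᵢ` lies on level `k`. -/
def ModelLevel (k : ℕ) (i : FinIndex) (a : Fin (finModel i).card) : Prop :=
  Structure.RelMap (levelSym k) ![a]

/-- `a <ₖ b` holds in `𝓜ᵢ`. -/
def ModelBelow (k : ℕ) (i : FinIndex) (a b : Fin (finModel i).card) : Prop :=
  Structure.RelMap (belowSym k) ![a, b]

/-! ## The theory `T` -/

/-- The language of forests with the constants added. -/
abbrev constLang : FirstOrder.Language.{0, 0} := treeLang[[Const]]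

/-- The constant `c` as a term. -/
def cst {α : Type} {n : ℕ} (c : Const) : constLang.Term (α ⊕ Fin n) :=
  Constants.term (treeLang.con c)

/-- `Pₖ(t)` in the language with constants. -/
def inLevelC {α : Type} {n : ℕ} (k : ℕ) (t : constLang.Term (α ⊕ Fin n)) :
    constLang.BoundedFormula α n :=
  ((treeLang.lhomWithConstants Const).onRelation (levelSym k)).boundedFormula₁ t

/-- `s <ₖ t` in the language with constants. -/
def isBelowC {α : Type} {n : ℕ} (k : ℕ) (s t : constLang.Term (α ⊕ Fin n)) :
    constLang.BoundedFormula α n :=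
  ((treeLang.lhomWithConstants Const).onRelation (belowSym k)).boundedFormula₂ s t

/-- The theory `T`: the base theory; the constants are pairwise distinct; `Cᵢʲ` is a copy of `𝓜ᵢ`
(through the fixed bijection `⟨i, j, a⟩ ↦ a`); and `Cᵢʲ` is closed under `<ₖ`-neighbours. -/
noncomputable def constTheory : constLang.Theory :=
  (treeLang.lhomWithConstants Const).onTheory baseTheory ∪
  {φ | ∃ c d : Const, c ≠ d ∧ φ = ∼((cst c) =' (cst d))} ∪
  {φ | ∃ (k : ℕ) (i : FinIndex) (j : ℕ) (a : Fin (finModel i).card),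
    ModelLevel k i a ∧ φ = inLevelC k (cst ⟨i, j, a⟩)} ∪
  {φ | ∃ (k : ℕ) (i : FinIndex) (j : ℕ) (a : Fin (finModel i).card),
    ¬ ModelLevel k i a ∧ φ = ∼(inLevelC k (cst ⟨i, j, a⟩))} ∪
  {φ | ∃ (k : ℕ) (i : FinIndex) (j : ℕ) (a b : Fin (finModel i).card),
    ModelBelow k i a b ∧ φ = isBelowC k (cst ⟨i, j, a⟩) (cst ⟨i, j, b⟩)} ∪
  {φ | ∃ (k : ℕ) (i : FinIndex) (j : ℕ) (a b : Fin (finModel i).card),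
    ¬ ModelBelow k i a b ∧ φ = ∼(isBelowC k (cst ⟨i, j, a⟩) (cst ⟨i, j, b⟩))} ∪
  {φ | ∃ (k : ℕ) (i : FinIndex) (j : ℕ) (a : Fin (finModel i).card),
    φ = ∀' ((isBelowC k (cst ⟨i, j, a⟩) (&0) ⊔ isBelowC k (&0) (cst ⟨i, j, a⟩)) ⟹
      BoundedFormula.iSup (fun b : Fin (finModel i).card => (&0) =' (cst ⟨i, j, b⟩)))}

/-! ## The version with predecessor functions -/

/-- The unary function symbols `Predₖ`. -/
inductive PredFunc : ℕ → Type
  | pred (k : ℕ) : PredFunc 1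

/-- The unary predicates `Pₖ`. -/
inductive LevelRel : ℕ → Type
  | level (k : ℕ) : LevelRel 1

/-- The language `{Pₖ} ∪ {Predₖ}`. -/
def predBase : FirstOrder.Language.{0, 0} := ⟨PredFunc, LevelRel⟩

/-- The symbol `Predₖ`. -/
def predSym (k : ℕ) : predBase.Functions 1 := PredFunc.pred k

/-- The symbol `Pₖ`. -/
def levelSymF (k : ℕ) : predBase.Relations 1 := LevelRel.level k

/-- The language `{Pₖ} ∪ {Predₖ}` with the constants added. -/
abbrev predLang : FirstOrder.Language.{0, 0} := predBase[[Const]]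

/-- The constant `c` as a term. -/
def cstF {α : Type} {n : ℕ} (c : Const) : predLang.Term (α ⊕ Fin n) :=
  Constants.term (predBase.con c)

/-- `Pₖ(t)`. -/
def inLevelF {α : Type} {n : ℕ} (k : ℕ) (t : predLang.Term (α ⊕ Fin n)) :
    predLang.BoundedFormula α n :=
  ((predBase.lhomWithConstants Const).onRelation (levelSymF k)).boundedFormula₁ t

/-- The term `Predₖ(t)`. -/
def predF {α : Type} {n : ℕ} (k : ℕ) (t : predLang.Term (α ⊕ Fin n)) :
    predLang.Term (α ⊕ Fin n) :=
  ((predBase.lhomWithConstants Const).onFunction (predSym k)).apply₁ t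

/-- `s <ₖ t`, expressed as `Pₖ₊₁(t) ∧ Predₖ(t) = s`. -/
def isBelowF {α : Type} {n : ℕ} (k : ℕ) (s t : predLang.Term (α ⊕ Fin n)) :
    predLang.BoundedFormula α n :=
  inLevelF (k + 1) t ⊓ ((predF k t) =' s)

/-- The reformulation of `T` with predecessor functions: the levels are disjoint; `Predₖ` maps
level `k + 1` to level `k` and fixes all other elements; the remaining axioms are those of `T`. -/
noncomputable def predTheory : predLang.Theory :=
  {φ | ∃ i j : ℕ, i ≠ j ∧ φ = ∀' ∼(inLevelF i (&0) ⊓ inLevelF j (&0))} ∪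
  {φ | ∃ k : ℕ, φ = ∀' (inLevelF (k + 1) (&0) ⟹ inLevelF k (predF k (&0)))} ∪
  {φ | ∃ k : ℕ, φ = ∀' (∼(inLevelF (k + 1) (&0)) ⟹ ((predF k (&0)) =' (&0)))} ∪
  {φ | ∃ c d : Const, c ≠ d ∧ φ = ∼((cstF c) =' (cstF d))} ∪
  {φ | ∃ (k : ℕ) (i : FinIndex) (j : ℕ) (a : Fin (finModel i).card),
    ModelLevel k i a ∧ φ = inLevelF k (cstF ⟨i, j, a⟩)} ∪
  {φ | ∃ (k : ℕ) (i : FinIndex) (j : ℕ) (a : Fin (finModel i).card),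
    ¬ ModelLevel k i a ∧ φ = ∼(inLevelF k (cstF ⟨i, j, a⟩))} ∪
  {φ | ∃ (k : ℕ) (i : FinIndex) (j : ℕ) (a b : Fin (finModel i).card),
    ModelBelow k i a b ∧ φ = isBelowF k (cstF ⟨i, j, a⟩) (cstF ⟨i, j, b⟩)} ∪
  {φ | ∃ (k : ℕ) (i : FinIndex) (j : ℕ) (a b : Fin (finModel i).card),
    ¬ ModelBelow k i a b ∧ φ = ∼(isBelowF k (cstF ⟨i, j, a⟩) (cstF ⟨i, j, b⟩))} ∪
  {φ | ∃ (k : ℕ) (i : FinIndex) (j : ℕ) (a : Fin (finModel i).card),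
    φ = ∀' ((isBelowF k (cstF ⟨i, j, a⟩) (&0) ⊔ isBelowF k (&0) (cstF ⟨i, j, a⟩)) ⟹
      BoundedFormula.iSup (fun b : Fin (finModel i).card => (&0) =' (cstF ⟨i, j, b⟩)))}

/-! ## The relational version -/

/-- Unary predicates `U_c`, one for each constant `c`. -/
inductive MarkRel : ℕ → Type
  | mark (c : Const) : MarkRel 1

/-- The language `{U_c}`. -/
def markBase : FirstOrder.Language.{0, 0} := ⟨fun _ => Empty, MarkRel⟩

/-- The symbol `U_c`. -/
def markSym (c : Const) : markBase.Relations 1 := MarkRel.mark c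

/-- The relational language `{Pₖ} ∪ {<ₖ} ∪ {U_c}`. -/
abbrev markLang : FirstOrder.Language.{0, 0} := treeLang.sum markBase

/-- `Pₖ(t)`. -/
def inLevelR {α : Type} {n : ℕ} (k : ℕ) (t : markLang.Term (α ⊕ Fin n)) :
    markLang.BoundedFormula α n :=
  ((LHom.sumInl : treeLang →ᴸ markLang).onRelation (levelSym k)).boundedFormula₁ t

/-- `s <ₖ t`. -/
def isBelowR {α : Type} {n : ℕ} (k : ℕ) (s t : markLang.Term (α ⊕ Fin n)) :
    markLang.BoundedFormula α n :=
  ((LHom.sumInl : treeLang →ᴸ markLang).onRelation (belowSym k)).boundedFormula₂ s t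

/-- `U_c(t)`. -/
def isMark {α : Type} {n : ℕ} (c : Const) (t : markLang.Term (α ⊕ Fin n)) :
    markLang.BoundedFormula α n :=
  ((LHom.sumInr : markBase →ᴸ markLang).onRelation (markSym c)).boundedFormula₁ t

/-- The reformulation of `T` with unary predicates in place of constants: each `U_c` holds of
exactly one element, and the remaining axioms are those of `T`, with this element as `c`. -/
noncomputable def markTheory : markLang.Theory :=
  (LHom.sumInl : treeLang →ᴸ markLang).onTheory baseTheory ∪
  {φ | ∃ c : Const, φ = ∃' isMark c (&0)} ∪
  {φ | ∃ c : Const, φ = ∀' ∀' ((isMark c (&0) ⊓ isMark c (&1)) ⟹ ((&0) =' (&1)))} ∪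
  {φ | ∃ c d : Const, c ≠ d ∧ φ = ∀' ∼(isMark c (&0) ⊓ isMark d (&0))} ∪
  {φ | ∃ (k : ℕ) (i : FinIndex) (j : ℕ) (a : Fin (finModel i).card),
    ModelLevel k i a ∧ φ = ∀' (isMark ⟨i, j, a⟩ (&0) ⟹ inLevelR k (&0))} ∪
  {φ | ∃ (k : ℕ) (i : FinIndex) (j : ℕ) (a : Fin (finModel i).card),
    ¬ ModelLevel k i a ∧ φ = ∀' (isMark ⟨i, j, a⟩ (&0) ⟹ ∼(inLevelR k (&0)))} ∪
  {φ | ∃ (k : ℕ) (i : FinIndex) (j : ℕ) (a b : Fin (finModel i).card),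
    ModelBelow k i a b ∧
    φ = ∀' ∀' ((isMark ⟨i, j, a⟩ (&0) ⊓ isMark ⟨i, j, b⟩ (&1)) ⟹ isBelowR k (&0) (&1))} ∪
  {φ | ∃ (k : ℕ) (i : FinIndex) (j : ℕ) (a b : Fin (finModel i).card),
    ¬ ModelBelow k i a b ∧
    φ = ∀' ∀' ((isMark ⟨i, j, a⟩ (&0) ⊓ isMark ⟨i, j, b⟩ (&1)) ⟹ ∼(isBelowR k (&0) (&1)))} ∪
  {φ | ∃ (k : ℕ) (i : FinIndex) (j : ℕ) (a : Fin (finModel i).card),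
    φ = ∀' ∀' ((isMark ⟨i, j, a⟩ (&0) ⊓ (isBelowR k (&0) (&1) ⊔ isBelowR k (&1) (&0))) ⟹
      BoundedFormula.iSup (fun b : Fin (finModel i).card => isMark ⟨i, j, b⟩ (&1)))}

end TreeTheory

/-! ## Truncated tree types -/

namespace TreeTheory

-- The models of the three theories are the same objects: forests given by a partial level function
-- and a parent function, containing closed disjoint copies of all finite forests (`Forest`). A
-- `Presentation` of a theory records this, together with the fact that each symbol depends on
-- finitely many levels and constants only. Completeness, superstability, failure of ω-stability and
-- unboundedness of types are then proved once, for any presentation.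
--
-- Completeness is a back-and-forth argument. A formula sees only the levels below some `d` and, of
-- the tree above a node, only the numbers of children of each truncated type, counted up to some
-- `m`. If two forests have the same truncated numbers of roots of each type, and of elements of no
-- visible level, then small type-preserving partial isomorphisms can be extended (`Position.forth`,
-- `Position.back`), and so they preserve formulas (`Presentation.realize_iff`). Every truncated
-- type is realized by the root of a finite tree, and the constants provide infinitely many copies
-- of that tree in every model. So all these numbers are infinite in all models, and matching the
-- constants is a legal start between any two models.
--
-- The same game over a set `A` of parameters shows that the type of `b` is determined by the level
-- of `b`, the node types of its iterated predecessors, and the first of these that is also an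
-- iterated predecessor of a parameter or constant. This leaves at most `κ` types for `#A ≤ κ` as
-- soon as `κ ≥ 𝔠`.
--
-- For the negative results, one large model contains for every `f : ℕ → Bool` a tree whose root
-- has, for each `i`, infinitely many children of kind `mixed i` if `f i` is true and of kind `pure
-- i` otherwise. A first-order formula tells `mixed i` from `pure i`, so `f` can be read off from
-- the type of the root, and there are `𝔠` types over the empty set. On the other hand the
-- difference between the two kinds is buried under alternating quantifiers: every `∀ₙ`-formula true
-- of the root for the constant function `true` stays true when the value at `n` is changed to
-- `false` (`NodeKind.Le`, `ForallSystem.realize_imp`). So no set of `∀ₙ`-sentences axiomatizes the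
-- type of that root.
--
-- The axiomatizations are read off from the axioms. For bi-interpretability, the symbols of each
-- language are definable from those of the other on the same carrier, so both interpretations are
-- the identity on elements.

/-- The number of elements of a set, truncated at `m`. -/
noncomputable def truncCard (m : ℕ) {M : Type} (s : Set M) : Fin (m + 1) :=
  ⟨(min s.encard m).toNat, by
    have h : min s.encard (m : ℕ∞) ≤ m := min_le_right _ _
    have := ENat.toNat_le_toNat h (ENat.natCast_ne_top m)
    simpa [Nat.lt_succ_iff] using this⟩

theorem truncCard_eq_iff {m : ℕ} {M N : Type} {s : Set M} {t : Set N} :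
    truncCard m s = truncCard m t ↔ min s.encard (m : ℕ∞) = min t.encard (m : ℕ∞) := by
  have h (X : ℕ∞) : min X (m : ℕ∞) ≠ ⊤ :=
    ne_top_of_le_ne_top (ENat.natCast_ne_top m) (min_le_right _ _)
  rw [truncCard, truncCard, Fin.mk.injEq]
  refine ⟨fun e => ?_, fun e => by rw [e]⟩
  rw [← ENat.natCast_toNat (h s.encard), ← ENat.natCast_toNat (h t.encard), e]

theorem truncCard_congr {m : ℕ} {M N : Type} {s : Set M} {t : Set N} (h : s.encard = t.encard) :
    truncCard m s = truncCard m t := by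
  rw [truncCard_eq_iff, h]

theorem truncCard_of_infinite {m : ℕ} {M N : Type} {s : Set M} {t : Set N} (hs : s.Infinite)
    (ht : t.Infinite) : truncCard m s = truncCard m t :=
  truncCard_congr (by rw [hs.encard_eq, ht.encard_eq])

/-- If two sets have the same truncated cardinality, a small finite matching between them can be
extended by a fresh element on the other side. -/
theorem exists_fresh {m : ℕ} {M N : Type} {s : Set M} {t : Set N}
    (h : truncCard m s = truncCard m t) (E : Finset (M × N))
    (inj : ∀ p ∈ E, ∀ q ∈ E, p.1 = q.1 ↔ p.2 = q.2)
    (mem : ∀ p ∈ E, p.1 ∈ s ↔ p.2 ∈ t) (size : E.card + 1 ≤ m)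
    {x : M} (hx : x ∈ s) (hxE : ∀ p ∈ E, p.1 ≠ x) : ∃ y ∈ t, ∀ p ∈ E, p.2 ≠ y := by
  classical
  by_contra! hcon
  rw [truncCard_eq_iff] at h
  -- If every element of `t` were already matched, then `t` would have at most `G.card` elements,
  -- while `x` and the matched elements of `s` are `G.card + 1 ≤ m` many. The truncated
  -- cardinalities still distinguish these numbers.
  set G := E.filter (fun p => p.1 ∈ s) with hG
  have h1 : G.image Prod.fst ⊆ E.image Prod.fst := Finset.image_subset_image (Finset.filter_subset _ _)
  have hx' : x ∉ G.image Prod.fst := by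
    intro hx'
    obtain ⟨p, hp, rfl⟩ := Finset.mem_image.1 hx'
    exact hxE p (Finset.mem_filter.1 hp).1 rfl
  have hs : ((insert x (G.image Prod.fst) : Finset M) : Set M) ⊆ s := by
    intro z hz
    rcases Finset.mem_insert.1 (Finset.mem_coe.1 hz) with rfl | hz
    · exact hx
    · obtain ⟨p, hp, rfl⟩ := Finset.mem_image.1 hz
      exact (Finset.mem_filter.1 hp).2
  have ht : t ⊆ ((G.image Prod.snd : Finset N) : Set N) := by
    intro y hy
    obtain ⟨p, hp, rfl⟩ := hcon y hy
    exact Finset.mem_coe.2 (Finset.mem_image.2 ⟨p, Finset.mem_filter.2 ⟨hp, (mem p hp).2 hy⟩, rfl⟩)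
  have cs := Set.encard_le_encard hs
  have ct := Set.encard_le_encard ht
  rw [Set.encard_coe_eq_coe_finsetCard] at cs ct
  rw [Finset.card_insert_of_notMem hx', Finset.card_image_of_injOn] at cs
  · have ct' : (G.image Prod.snd).card ≤ G.card := Finset.card_image_le
    have hle : G.card ≤ E.card := Finset.card_filter_le _ _
    have ct2 : t.encard ≤ (G.card : ℕ∞) := ct.trans (by exact_mod_cast ct')
    have : ((G.card + 1 : ℕ) : ℕ∞) ≤ min s.encard m := le_min cs (by exact_mod_cast by omega)
    rw [h] at this
    have := this.trans ((min_le_left _ _).trans ct2)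
    have := (Nat.cast_le (α := ℕ∞)).1 this
    omega
  · intro p hp q hq e
    have hp' := (Finset.mem_filter.1 hp).1
    have hq' := (Finset.mem_filter.1 hq).1
    exact Prod.ext e ((inj p hp' q hq').1 e)

/-- The possible truncated types of nodes of trees of height `r`. -/
def NodeType (m : ℕ) : ℕ → Type
  | 0 => Unit
  | r + 1 => NodeType m r → Fin (m + 1)

instance NodeType.finite (m : ℕ) : ∀ r, Finite (NodeType m r)
  | 0 => inferInstanceAs (Finite Unit)
  | r + 1 => by
    have := NodeType.finite m r
    exact inferInstanceAs (Finite (NodeType m r → Fin (m + 1)))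

/-- The truncated type of a node with respect to a child relation, up to height `r`. -/
noncomputable def nodeType (m : ℕ) {M : Type} (ch : M → M → Prop) : ∀ r : ℕ, M → NodeType m r
  | 0 => fun _ => ()
  | r + 1 => fun x τ => truncCard m {y | ch x y ∧ nodeType m ch r y = τ}

/-- Node types are preserved by maps that restrict to bijections between sets of children. -/
theorem nodeType_map (m : ℕ) {M N : Type} {ch : M → M → Prop} {ch' : N → N → Prop} (g : M → N)
    (hg : ∀ x y, ch x y → ch' (g x) (g y)) (inj : ∀ x y z, ch x y → ch x z → g y = g z → y = z)
    (surj : ∀ x y, ch' (g x) y → ∃ z, ch x z ∧ g z = y) :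
    ∀ (r : ℕ) (x : M), nodeType m ch' r (g x) = nodeType m ch r x
  | 0, _ => rfl
  | r + 1, x => by
    funext τ
    refine truncCard_congr ?_
    have : {y | ch' (g x) y ∧ nodeType m ch' r y = τ} =
        g '' {y | ch x y ∧ nodeType m ch r y = τ} := by
      ext y
      constructor
      · rintro ⟨h1, h2⟩
        obtain ⟨z, hz, rfl⟩ := surj x y h1
        exact ⟨z, ⟨hz, by rw [← h2, nodeType_map m g hg inj surj r z]⟩, rfl⟩
      · rintro ⟨z, ⟨h1, h2⟩, rfl⟩
        exact ⟨hg x z h1, by rw [nodeType_map m g hg inj surj r z, h2]⟩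
    rw [this]
    refine Set.InjOn.encard_image ?_
    intro y hy z hz e
    exact inj x y z hy.1 hz.1 e

/-! ## Forests with marked points -/

/-- The abstract content of a model of each of the three theories. -/
structure Forest (M : Type) where
  lev : M → Option ℕ
  par : M → M
  pt : Const → M
  lev_par : ∀ {k x}, lev x = some (k + 1) → lev (par x) = some k
  par_of_ne : ∀ {x}, (∀ k, lev x ≠ some (k + 1)) → par x = x
  pt_inj : Function.Injective pt
  lev_pt : ∀ c k, lev (pt c) = some k ↔ ModelLevel k c.i c.a
  below_pt : ∀ k i j a b, (lev (pt ⟨i, j, b⟩) = some (k + 1) ∧ par (pt ⟨i, j, b⟩) = pt ⟨i, j, a⟩) ↔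
    ModelBelow k i a b
  closed : ∀ i j a k x, lev x = some (k + 1) → par x = pt ⟨i, j, a⟩ → ∃ b, x = pt ⟨i, j, b⟩

/-- `y` is a child of `x`. -/
def Forest.ch {M : Type} (D : Forest M) (x y : M) : Prop := (∃ k, D.lev y = some (k + 1)) ∧ D.par y = x

theorem Forest.ch_lev {M : Type} (D : Forest M) {x y : M} {k : ℕ} (h : D.ch x y)
    (hx : D.lev x = some k) : D.lev y = some (k + 1) := by
  obtain ⟨⟨l, hl⟩, rfl⟩ := h
  have := D.lev_par hl
  rw [hx] at this
  rw [hl, Option.some.inj this]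

/-- An injective numbering of the copies `Cᵢʲ` is fixed by `code`. A relation is a partial
isomorphism up to `d` if it respects the levels and predecessors below `d` and the constants with
code below `d`. -/
structure PartialIso (code : FinIndex × ℕ → ℕ) (d : ℕ) {M N : Type} (D : Forest M) (D' : Forest N)
    (E : M → N → Prop) : Prop where
  inj : ∀ {x y x' y'}, E x y → E x' y' → (x = x' ↔ y = y')
  lev : ∀ {x y}, E x y → ∀ k < d, D.lev x = some k ↔ D'.lev y = some k
  par : ∀ {x y}, E x y → ∀ k, k + 1 < d → D.lev x = some (k + 1) → E (D.par x) (D'.par y)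
  pt : ∀ c : Const, code (c.i, c.j) < d → E (D.pt c) (D'.pt c)

theorem PartialIso.symm {code : FinIndex × ℕ → ℕ} {d : ℕ} {M N : Type} {D : Forest M} {D' : Forest N}
    {E : M → N → Prop} (h : PartialIso code d D D' E) :
    PartialIso code d D' D (fun y x => E x y) where
  inj h1 h2 := (h.inj h1 h2).symm
  lev h1 k hk := (h.lev h1 k hk).symm
  par h1 k hk h2 := h.par h1 k hk ((h.lev h1 _ hk).2 h2)
  pt c hc := h.pt c hc

/-- The elements of level `0` of a given type. -/
def Forest.roots {M : Type} (D : Forest M) {m r : ℕ} (τ : NodeType m r) : Set M :=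
  {x | D.lev x = some 0 ∧ nodeType m D.ch r x = τ}

/-- The elements of level at least `d` or of no level. -/
def Forest.junk {M : Type} (D : Forest M) (d : ℕ) : Set M := {x | ∀ k < d, D.lev x ≠ some k}

/-- Positions from which the second player survives: finite partial isomorphisms that preserve
types of nodes, between forests with the same truncated numbers of roots of each type. -/
structure Position (code : FinIndex × ℕ → ℕ) (d m : ℕ) {M N : Type} (D : Forest M) (D' : Forest N)
    (E : Finset (M × N)) : Prop extends PartialIso code d D D' (fun x y => (x, y) ∈ E) where
  typ : ∀ {x y}, (x, y) ∈ E → ∀ k r, k + r + 1 = d → D.lev x = some k →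
    nodeType m D.ch r x = nodeType m D'.ch r y
  root : ∀ r, r + 1 = d → ∀ τ : NodeType m r, truncCard m (D.roots τ) = truncCard m (D'.roots τ)
  junk : truncCard m (D.junk d) = truncCard m (D'.junk d)

/-- The converse of a finite relation. -/
def Converse {M N : Type} (E : Finset (M × N)) : Finset (N × M) :=
  E.map (Equiv.prodComm M N).toEmbedding

theorem mem_converse {M N : Type} {E : Finset (M × N)} {x : M} {y : N} :
    (y, x) ∈ Converse E ↔ (x, y) ∈ E := by
  simp [Converse]

theorem card_converse {M N : Type} (E : Finset (M × N)) : (Converse E).card = E.card := by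
  simp [Converse]

theorem Position.symm {code : FinIndex × ℕ → ℕ} {d m : ℕ} {M N : Type} {D : Forest M} {D' : Forest N}
    {E : Finset (M × N)} (h : Position code d m D D' E) : Position code d m D' D (Converse E) where
  toPartialIso := by
    have := h.toPartialIso.symm
    simpa only [mem_converse] using this
  typ {x y} hxy k r hd hx := by
    rw [mem_converse] at hxy
    exact (h.typ hxy k r hd ((h.lev hxy k (by omega)).2 hx)).symm
  root r hr τ := (h.root r hr τ).symm
  junk := h.junk.symm

-- The moves of the back-and-forth game

section Extension

variable {code : FinIndex × ℕ → ℕ} {d m : ℕ} {M N : Type} {D : Forest M} {D' : Forest N}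
  {E : Finset (M × N)}

/-- Adding a pair of fresh elements to a position. -/
theorem Position.insert_pair [DecidableEq (M × N)] (h : Position code d m D D' E) {x : M} {y : N}
    (hx : ∀ p ∈ E, p.1 ≠ x) (hy : ∀ p ∈ E, p.2 ≠ y)
    (lev : ∀ k < d, D.lev x = some k ↔ D'.lev y = some k)
    (par : ∀ k, k + 1 < d → D.lev x = some (k + 1) → (D.par x, D'.par y) ∈ E)
    (typ : ∀ k r, k + r + 1 = d → D.lev x = some k →
      nodeType m D.ch r x = nodeType m D'.ch r y) :
    Position code d m D D' (insert (x, y) E) where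
  inj := by
    intro a b a' b' h1 h2
    rcases Finset.mem_insert.1 h1 with e1 | h1' <;> rcases Finset.mem_insert.1 h2 with e2 | h2'
    · obtain ⟨rfl, rfl⟩ := Prod.mk.inj e1
      obtain ⟨rfl, rfl⟩ := Prod.mk.inj e2
      simp
    · obtain ⟨rfl, rfl⟩ := Prod.mk.inj e1
      exact iff_of_false (fun e => hx _ h2' e.symm) (fun e => hy _ h2' e.symm)
    · obtain ⟨rfl, rfl⟩ := Prod.mk.inj e2
      exact iff_of_false (fun e => hx _ h1' e) (fun e => hy _ h1' e)
    · exact h.inj h1' h2'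
  lev := by
    intro a b h1
    rcases Finset.mem_insert.1 h1 with e1 | h1'
    · obtain ⟨rfl, rfl⟩ := Prod.mk.inj e1
      exact lev
    · exact h.lev h1'
  par := by
    intro a b h1 k hk ha
    rcases Finset.mem_insert.1 h1 with e1 | h1'
    · obtain ⟨rfl, rfl⟩ := Prod.mk.inj e1
      exact Finset.mem_insert_of_mem (par k hk ha)
    · exact Finset.mem_insert_of_mem (h.par h1' k hk ha)
  pt c hc := Finset.mem_insert_of_mem (h.pt c hc)
  typ := by
    intro a b h1
    rcases Finset.mem_insert.1 h1 with e1 | h1'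
    · obtain ⟨rfl, rfl⟩ := Prod.mk.inj e1
      exact typ
    · exact h.typ h1'
  root := h.root
  junk := h.junk

/-- The predecessor of `x` is matched first, by induction on the level. Its match has the same type,
hence the same truncated number of children of the type of `x`, and `exists_fresh` finds an unused
one. At most one pair is added for each node of the branch, which is the cost `k + 1`. -/
theorem Position.extend_node [DecidableEq (M × N)] : ∀ (k : ℕ) (x : M) (E : Finset (M × N)),
    Position code d m D D' E → D.lev x = some k → k < d → E.card + (k + 1) ≤ m →
    ∃ E' : Finset (M × N), E ⊆ E' ∧ E'.card ≤ E.card + (k + 1) ∧ (∃ y, (x, y) ∈ E') ∧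
      Position code d m D D' E' := by
  intro k
  induction k with
  | zero =>
    intro x E h hx hk hm
    by_cases hxE : ∃ y, (x, y) ∈ E
    · exact ⟨E, subset_rfl, by omega, hxE, h⟩
    push Not at hxE
    have hx' : ∀ p ∈ E, p.1 ≠ x := by rintro ⟨a, b⟩ hp rfl; exact hxE b hp
    -- A node of level `k` is compared through its type of height `r` with `k + r + 1 = d`: the type
    -- looks exactly as far up as the levels below `d` reach.
    obtain ⟨r, rfl⟩ : ∃ r, d = r + 1 := ⟨d - 1, by omega⟩
    obtain ⟨y, hy, hyE⟩ := exists_fresh (h.root r rfl (nodeType m D.ch r x)) E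
      (fun p hp q hq => h.inj hp hq)
      (fun p hp => by
        refine ⟨fun hp' => ⟨(h.lev hp 0 hk).1 hp'.1, ?_⟩, fun hp' => ?_⟩
        · rw [← h.typ hp 0 r (by omega) hp'.1]; exact hp'.2
        · have := (h.lev hp 0 hk).2 hp'.1
          exact ⟨this, by rw [h.typ hp 0 r (by omega) this]; exact hp'.2⟩)
      (by omega) (x := x) ⟨hx, rfl⟩ hx'
    refine ⟨insert (x, y) E, Finset.subset_insert _ _, Finset.card_insert_le _ _,
      ⟨y, Finset.mem_insert_self _ _⟩, h.insert_pair hx' hyE ?_ ?_ ?_⟩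
    · intro l _
      rw [hx, hy.1]
    · intro l _ hl
      rw [hx] at hl
      simp at hl
    · intro l r' hl hl'
      rw [hx] at hl'
      obtain rfl : 0 = l := Option.some.inj hl'
      obtain rfl : r' = r := by omega
      exact hy.2.symm
  | succ k ih =>
    intro x E h hx hk hm
    by_cases hxE : ∃ y, (x, y) ∈ E
    · exact ⟨E, subset_rfl, by omega, hxE, h⟩
    obtain ⟨E₁, hE₁, hc₁, ⟨y₀, hy₀⟩, h₁⟩ := ih (D.par x) E h (D.lev_par hx) (by omega) (by omega)
    by_cases hxE₁ : ∃ y, (x, y) ∈ E₁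
    · exact ⟨E₁, hE₁, by omega, hxE₁, h₁⟩
    push Not at hxE₁
    have hx' : ∀ p ∈ E₁, p.1 ≠ x := by rintro ⟨a, b⟩ hp rfl; exact hxE₁ b hp
    obtain ⟨r, hr⟩ : ∃ r, k + (r + 1) + 1 = d := ⟨d - (k + 2), by omega⟩
    have hty := h₁.typ hy₀ k (r + 1) hr (D.lev_par hx)
    have hlev₀ := (h₁.lev hy₀ k (by omega)).1 (D.lev_par hx)
    -- The predecessor's type of height `r + 1` is by definition the function counting children by
    -- their type of height `r`, so its value at the type of `x` is the equality of counts that is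
    -- needed.
    obtain ⟨y, hy, hyE⟩ := exists_fresh (congrFun hty (nodeType m D.ch r x)) E₁
      (fun p hp q hq => h₁.inj hp hq)
      (fun p hp => by
        constructor
        · rintro ⟨hp1, hp2⟩
          have hl := D.ch_lev hp1 (D.lev_par hx)
          have hl' := (h₁.lev hp _ hk).1 hl
          have hpp := h₁.par hp k hk hl
          refine ⟨⟨⟨k, hl'⟩, (h₁.inj hpp hy₀).1 hp1.2⟩, ?_⟩
          rw [← h₁.typ hp (k + 1) r (by omega) hl]
          exact hp2
        · rintro ⟨hp1, hp2⟩
          have hl' := D'.ch_lev hp1 hlev₀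
          have hl := (h₁.lev hp _ hk).2 hl'
          have hpp := h₁.par hp k hk hl
          refine ⟨⟨⟨k, hl⟩, (h₁.inj hpp hy₀).2 hp1.2⟩, ?_⟩
          rw [h₁.typ hp (k + 1) r (by omega) hl]
          exact hp2)
      (by omega) (x := x) ⟨⟨⟨k, hx⟩, rfl⟩, rfl⟩ hx'
    have hyl := D'.ch_lev hy.1 hlev₀
    refine ⟨insert (x, y) E₁, hE₁.trans (Finset.subset_insert _ _),
      (Finset.card_insert_le _ _).trans (by omega), ⟨y, Finset.mem_insert_self _ _⟩,
      h₁.insert_pair hx' hyE ?_ ?_ ?_⟩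
    · intro l _
      rw [hx, hyl]
    · intro l _ hl
      rw [hy.1.2]
      exact hy₀
    · intro l r' hl hl'
      rw [hx] at hl'
      obtain rfl : k + 1 = l := Option.some.inj hl'
      obtain rfl : r' = r := by omega
      exact hy.2.symm

/-- An element that has no level below `d` has no visible predecessor or type either, so any fresh
element of the same sort answers it. All other elements are covered by `Position.extend_node`. -/
theorem Position.forth [DecidableEq (M × N)] (h : Position code d m D D' E)
    (hm : E.card + (d + 1) ≤ m) (x : M) :
    ∃ E' : Finset (M × N), E ⊆ E' ∧ E'.card ≤ E.card + (d + 1) ∧ (∃ y, (x, y) ∈ E') ∧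
      Position code d m D D' E' := by
  by_cases hx : ∃ k < d, D.lev x = some k
  · obtain ⟨k, hk, hx⟩ := hx
    obtain ⟨E', h1, h2, h3⟩ := h.extend_node k x E hx hk (by omega)
    exact ⟨E', h1, by omega, h3⟩
  push Not at hx
  by_cases hxE : ∃ y, (x, y) ∈ E
  · exact ⟨E, subset_rfl, by omega, hxE, h⟩
  push Not at hxE
  have hx' : ∀ p ∈ E, p.1 ≠ x := by rintro ⟨a, b⟩ hp rfl; exact hxE b hp
  obtain ⟨y, hy, hyE⟩ := exists_fresh h.junk E (fun p hp q hq => h.inj hp hq)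
    (fun p hp => forall₂_congr fun k hk => not_congr (h.lev hp k hk)) (by omega) (x := x) hx hx'
  refine ⟨insert (x, y) E, Finset.subset_insert _ _,
      (Finset.card_insert_le _ _).trans (by omega), ⟨y, Finset.mem_insert_self _ _⟩,
      h.insert_pair hx' hyE ?_ ?_ ?_⟩
  · intro k hk
    exact iff_of_false (hx k hk) (hy k hk)
  · intro k hk hk'
    exact absurd hk' (hx _ hk)
  · intro k r hk hk'
    exact absurd hk' (hx k (by omega))

theorem Position.back [DecidableEq (M × N)] (h : Position code d m D D' E)
    (hm : E.card + (d + 1) ≤ m) (y : N) :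
    ∃ E' : Finset (M × N), E ⊆ E' ∧ E'.card ≤ E.card + (d + 1) ∧ (∃ x, (x, y) ∈ E') ∧
      Position code d m D D' E' := by
  classical
  obtain ⟨E', h1, h2, ⟨x, hx⟩, h4⟩ := h.symm.forth (by rwa [card_converse]) y
  refine ⟨Converse E', ?_, ?_, ⟨x, mem_converse.2 hx⟩, h4.symm⟩
  · rintro ⟨a, b⟩ hab
    exact mem_converse.2 (h1 (mem_converse.2 hab))
  · rwa [card_converse, ← card_converse E]

end Extension

end TreeTheory

/-! ## Preservation of formulas -/

namespace FOComplexity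

variable {L : FirstOrder.Language.{0, 0}}

/-- A relation between two structures that preserves and reflects everything atomic. -/
structure PreservesAtomic (L : FirstOrder.Language.{0, 0}) {M N : Type} [L.Structure M]
    [L.Structure N] (E : M → N → Prop) : Prop where
  inj : ∀ {x y x' y'}, E x y → E x' y' → (x = x' ↔ y = y')
  func : ∀ {n} (f : L.Functions n) (xs : Fin n → M) (ys : Fin n → N), (∀ i, E (xs i) (ys i)) →
    E (Structure.funMap f xs) (Structure.funMap f ys)
  rel : ∀ {n} (R : L.Relations n) (xs : Fin n → M) (ys : Fin n → N), (∀ i, E (xs i) (ys i)) →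
    (Structure.RelMap R xs ↔ Structure.RelMap R ys)

theorem PreservesAtomic.term {M N : Type} [L.Structure M] [L.Structure N] {E : M → N → Prop}
    (h : PreservesAtomic L E) {β : Type} (t : L.Term β) {v : β → M} {w : β → N}
    (hvw : ∀ b, E (v b) (w b)) : E (t.realize v) (t.realize w) := by
  induction t with
  | var b => exact hvw b
  | func f ts ih => exact h.func f _ _ ih

theorem PreservesAtomic.qf {M N : Type} [L.Structure M] [L.Structure N] {E : M → N → Prop}
    (h : PreservesAtomic L E) {α : Type} {n : ℕ} {φ : L.BoundedFormula α n} (hφ : φ.IsQF)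
    {v : α → M} {w : α → N} {xs : Fin n → M} {ys : Fin n → N}
    (hvw : ∀ a, E (v a) (w a)) (hxs : ∀ i, E (xs i) (ys i)) : φ.Realize v xs ↔ φ.Realize w ys := by
  have hs : ∀ b : α ⊕ Fin n, E (Sum.elim v xs b) (Sum.elim w ys b) := by
    rintro (a | i)
    exacts [hvw a, hxs i]
  induction hφ with
  | falsum => rfl
  | of_isAtomic h' =>
    cases h' with
    | equal t₁ t₂ => exact h.inj (h.term t₁ hs) (h.term t₂ hs)
    | rel R ts => exact h.rel R _ _ fun i => h.term (ts i) hs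
  | imp _ _ ih₁ ih₂ => exact imp_congr ih₁ ih₂

/-- One half of a system of back-and-forth relations for formulas with `n` alternations. -/
structure ForallSystem (L : FirstOrder.Language.{0, 0}) {M N : Type} [L.Structure M]
    [L.Structure N] (K : ℕ → (M → N → Prop) → Prop) (K' : ℕ → (N → M → Prop) → Prop) : Prop where
  atomic : ∀ {E}, K 0 E → PreservesAtomic L E
  flip : ∀ {n E}, K (n + 1) E → K' n (fun y x => E x y)
  back : ∀ {n E}, K (n + 1) E → ∀ y, ∃ E', K (n + 1) E' ∧ (∀ a b, E a b → E' a b) ∧ ∃ x, E' x y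

/-- The two halves are proved together by induction on `n`. Quantifiers of one block are answered by
`back`, which does not lower the index; only the passage to the kernel of the next lower complexity
uses `flip`, which exchanges the structures and lowers the index by one. -/
theorem ForallSystem.realize_imp (n : ℕ) : ∀ {M N : Type} [L.Structure M] [L.Structure N]
    {K : ℕ → (M → N → Prop) → Prop} {K' : ℕ → (N → M → Prop) → Prop},
    ForallSystem L K K' → ForallSystem L K' K → ∀ {α : Type} (m : ℕ) (φ : L.BoundedFormula α m)
    {E : M → N → Prop}, K n E → ∀ {v : α → M} {w : α → N} {xs : Fin m → M} {ys : Fin m → N},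
    (∀ a, E (v a) (w a)) → (∀ i, E (xs i) (ys i)) →
    (IsForall n m φ → φ.Realize v xs → φ.Realize w ys) ∧
      (IsExists n m φ → φ.Realize w ys → φ.Realize v xs) := by
  induction n with
  | zero =>
    intro M N _ _ K K' h h' α m φ E hE v w xs ys hv hx
    constructor
    · intro hφ
      rw [IsForall] at hφ
      exact ((h.atomic hE).qf hφ hv hx).1
    · intro hφ
      rw [IsExists] at hφ
      exact ((h.atomic hE).qf hφ hv hx).2
  | succ n ih =>
    intro M N _ _ K K' h h' α m φ E hE v w xs ys hv hx
    constructor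
    · intro hφ
      rw [IsForall] at hφ
      induction hφ generalizing E with
      | base hφ => exact (ih h' h _ _ (h.flip hE) hv hx).2 hφ
      | all _ ihφ =>
        intro hr y
        obtain ⟨E', hE', hsub, x, hxy⟩ := h.back hE y
        refine ihφ hE' (fun a => hsub _ _ (hv a)) ?_ (hr x)
        refine Fin.lastCases ?_ ?_
        · simpa using hxy
        · intro i
          simpa using hsub _ _ (hx i)
    · intro hφ
      rw [IsExists] at hφ
      induction hφ generalizing E with
      | base hφ => exact (ih h' h _ _ (h.flip hE) hv hx).1 hφ
      | ex _ ihφ =>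
        rw [BoundedFormula.realize_ex, BoundedFormula.realize_ex]
        rintro ⟨y, hy⟩
        obtain ⟨E', hE', hsub, x, hxy⟩ := h.back hE y
        refine ⟨x, ihφ hE' (fun a => hsub _ _ (hv a)) ?_ hy⟩
        refine Fin.lastCases ?_ ?_
        · simpa using hxy
        · intro i
          simpa using hsub _ _ (hx i)

end FOComplexity

-- Presentations of theories by forests, and invariance of formulas under the game

namespace TreeTheory

open Filter

/-- A presentation of a theory: its models are the structures that represent forests with marked
points, and each of its symbols is preserved by all partial isomorphisms up to some `d`. -/
structure Presentation (code : FinIndex × ℕ → ℕ) (L : FirstOrder.Language.{0, 0})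
    (T : L.Theory) where
  Rep : ∀ {M : Type}, L.Structure M → Forest M → Prop
  exists_forest : ∀ (M : Type) [s : L.Structure M], M ⊨ T → ∃ D : Forest M, Rep s D
  exists_structure : ∀ {M : Type} (D : Forest M), ∃ s : L.Structure M, Rep s D
  models : ∀ {M : Type} {s : L.Structure M} {D : Forest M}, Rep s D → M ⊨ T
  func : ∀ {n} (f : L.Functions n), ∀ᶠ d in atTop, ∀ {M N : Type} {s : L.Structure M}
    {s' : L.Structure N} {D : Forest M} {D' : Forest N}, Rep s D → Rep s' D' →
    ∀ {E : M → N → Prop}, PartialIso code d D D' E → ∀ xs ys, (∀ i, E (xs i) (ys i)) →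
    E (Structure.funMap f xs) (Structure.funMap f ys)
  rel : ∀ {n} (R : L.Relations n), ∀ᶠ d in atTop, ∀ {M N : Type} {s : L.Structure M}
    {s' : L.Structure N} {D : Forest M} {D' : Forest N}, Rep s D → Rep s' D' →
    ∀ {E : M → N → Prop}, PartialIso code d D D' E → ∀ xs ys, (∀ i, E (xs i) (ys i)) →
    (Structure.RelMap R xs ↔ Structure.RelMap R ys)
  child : ∀ k, ∃ β : L.Formula (Fin 2), ∀ {M : Type} {s : L.Structure M} {D : Forest M}, Rep s D →
    ∀ v : Fin 2 → M, β.Realize v ↔ D.lev (v 1) = some (k + 1) ∧ D.par (v 1) = v 0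

variable {code : FinIndex × ℕ → ℕ} {L : FirstOrder.Language.{0, 0}} {T : L.Theory}

theorem Presentation.preservesAtomic (P : Presentation code L T) {M N : Type} {s : L.Structure M}
    {s' : L.Structure N} {D : Forest M} {D' : Forest N} (h : P.Rep s D) (h' : P.Rep s' D')
    {E : M → N → Prop} (hE : ∀ d, PartialIso code d D D' E) : FOComplexity.PreservesAtomic L E where
  inj h1 h2 := (hE 0).inj h1 h2
  func f xs ys hxy := by
    obtain ⟨d, hd⟩ := (P.func f).exists
    exact hd h h' (hE d) xs ys hxy
  rel R xs ys hxy := by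
    obtain ⟨d, hd⟩ := (P.rel R).exists
    exact hd h h' (hE d) xs ys hxy

theorem Presentation.term (P : Presentation code L T) {β : Type} (t : L.Term β) :
    ∀ᶠ d in atTop, ∀ {M N : Type} {s : L.Structure M}
    {s' : L.Structure N} {D : Forest M} {D' : Forest N}, P.Rep s D → P.Rep s' D' →
    ∀ {E : M → N → Prop}, PartialIso code d D D' E → ∀ (v : β → M) (w : β → N),
    (∀ b, E (v b) (w b)) → E (t.realize v) (t.realize w) := by
  induction t with
  | var b => exact .of_forall fun d M N s s' D D' _ _ E _ v w h => h b
  | func f ts ih =>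
    filter_upwards [P.func f, eventually_all.2 ih] with d h1 h2
    intro M N s s' D D' h h' E hE v w hvw
    exact h1 h h' hE _ _ fun i => h2 i h h' hE v w hvw

/-- A quantifier costs one move, hence at most `d + 1` new pairs, and `q` bounds the number of
moves. The budget `E.card + q * (d + 1) ≤ m` keeps the matching small enough for the truncation at
`m` never to be noticed. Only the symbols of `φ` restrict `d`, so all large `d` work. -/
theorem Presentation.realize_iff (P : Presentation code L T) {α : Type} {n : ℕ}
    (φ : L.BoundedFormula α n) :
    ∃ q : ℕ, ∀ᶠ d in atTop, ∀ {M N : Type} {s : L.Structure M}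
    {s' : L.Structure N} {D : Forest M} {D' : Forest N}, P.Rep s D → P.Rep s' D' →
    ∀ {m : ℕ} {E : Finset (M × N)}, Position code d m D D' E → E.card + q * (d + 1) ≤ m →
    ∀ (v : α → M) (w : α → N) (xs : Fin n → M) (ys : Fin n → N),
    (∀ a, (v a, w a) ∈ E) → (∀ i, (xs i, ys i) ∈ E) → (φ.Realize v xs ↔ φ.Realize w ys) := by
  have sum_mem {α : Type} {n : ℕ} {M N : Type} {E : Finset (M × N)} {v : α → M} {w : α → N}
    {xs : Fin n → M} {ys : Fin n → N} (hv : ∀ a, (v a, w a) ∈ E) (hx : ∀ i, (xs i, ys i) ∈ E) :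
      ∀ b : α ⊕ Fin n, (Sum.elim v xs b, Sum.elim w ys b) ∈ E := by
    rintro (a | i)
    exacts [hv a, hx i]
  induction φ with
  | falsum => exact ⟨0, .of_forall fun _ => by intros; rfl⟩
  | equal t₁ t₂ =>
    refine ⟨0, ?_⟩
    filter_upwards [P.term t₁, P.term t₂] with d h1 h2
    intro M N s s' D D' h h' m E hE _ v w xs ys hv hx
    have hs := sum_mem hv hx
    exact hE.inj (h1 h h' hE.toPartialIso _ _ hs) (h2 h h' hE.toPartialIso _ _ hs)
  | rel R ts =>
    refine ⟨0, ?_⟩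
    filter_upwards [P.rel R, eventually_all.2 fun i => P.term (ts i)] with d h1 h2
    intro M N s s' D D' h h' m E hE _ v w xs ys hv hx
    have hs := sum_mem hv hx
    exact h1 h h' hE.toPartialIso _ _ fun i => h2 i h h' hE.toPartialIso _ _ hs
  | imp φ ψ ih₁ ih₂ =>
    obtain ⟨q₁, h₁⟩ := ih₁
    obtain ⟨q₂, h₂⟩ := ih₂
    refine ⟨q₁ + q₂, ?_⟩
    filter_upwards [h₁, h₂] with d h₁ h₂
    intro M N s s' D D' h h' m E hE hm v w xs ys hv hx
    rw [add_mul] at hm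
    exact imp_congr (h₁ h h' hE (by omega) v w xs ys hv hx) (h₂ h h' hE (by omega) v w xs ys hv hx)
  | all φ ih =>
    classical
    obtain ⟨q, hq⟩ := ih
    refine ⟨q + 1, ?_⟩
    filter_upwards [hq] with d hd
    intro M N s s' D D' h h' m E hE hm v w xs ys hv hx
    rw [add_mul, one_mul] at hm
    have snoc_mem {E' : Finset (M × N)} (hsub : E ⊆ E') {x y} (hxy : (x, y) ∈ E') :
        ∀ i, ((Fin.snoc xs x : Fin _ → M) i, (Fin.snoc ys y : Fin _ → N) i) ∈ E' := by
      refine Fin.lastCases ?_ ?_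
      · simpa using hxy
      · intro i
        simpa using hsub (hx i)
    constructor
    · intro hr y
      obtain ⟨E', hsub, hc, ⟨x, hxy⟩, hE'⟩ := hE.back (by omega) y
      exact (hd h h' hE' (by omega) v w _ _ (fun a => hsub (hv a)) (snoc_mem hsub hxy)).1 (hr x)
    · intro hr x
      obtain ⟨E', hsub, hc, ⟨y, hxy⟩, hE'⟩ := hE.forth (by omega) x
      exact (hd h h' hE' (by omega) v w _ _ (fun a => hsub (hv a)) (snoc_mem hsub hxy)).2 (hr y)

end TreeTheory

/-! ## Finite models and completeness -/

namespace TreeTheory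

theorem model_baseTheory_iff {W : Type} [treeLang.Structure W] : W ⊨ baseTheory ↔
    (∀ i j, i ≠ j → ∀ x : W, ¬ (Structure.RelMap (levelSym i) ![x] ∧
      Structure.RelMap (levelSym j) ![x])) ∧
    (∀ i, ∀ x y : W, Structure.RelMap (belowSym i) ![x, y] →
      Structure.RelMap (levelSym i) ![x] ∧ Structure.RelMap (levelSym (i + 1)) ![y]) ∧
    (∀ i, ∀ x : W, Structure.RelMap (levelSym (i + 1)) ![x] →
      ∃ y, Structure.RelMap (levelSym i) ![y] ∧ Structure.RelMap (belowSym i) ![y, x]) ∧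
    (∀ i, ∀ x y z : W, Structure.RelMap (belowSym i) ![x, z] →
      Structure.RelMap (belowSym i) ![y, z] → x = y) := by
  simp only [baseTheory, Theory.model_iff, Set.mem_union, Set.mem_ofPred_eq]
  constructor
  · intro h
    refine ⟨fun i j hij => ?_, fun i => ?_, fun i => ?_, fun i => ?_⟩
    · have := h _ (Or.inl (Or.inl (Or.inl ⟨i, j, hij, rfl⟩)))
      simpa [Sentence.Realize, Formula.Realize, inLevel, BoundedFormula.realize_rel₁, Fin.snoc]
        using this
    · have := h _ (Or.inl (Or.inl (Or.inr ⟨i, rfl⟩)))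
      simpa [Sentence.Realize, Formula.Realize, inLevel, isBelow, BoundedFormula.realize_rel₁,
        BoundedFormula.realize_rel₂, Fin.snoc] using this
    · have := h _ (Or.inl (Or.inr ⟨i, rfl⟩))
      simpa [Sentence.Realize, Formula.Realize, inLevel, isBelow, BoundedFormula.realize_rel₁,
        BoundedFormula.realize_rel₂, Fin.snoc] using this
    · have := h _ (Or.inr ⟨i, rfl⟩)
      simpa [Sentence.Realize, Formula.Realize, inLevel, isBelow, BoundedFormula.realize_rel₁,
        BoundedFormula.realize_rel₂, Fin.snoc] using this
  · rintro ⟨h1, h2, h3, h4⟩ φ (((⟨i, j, hij, rfl⟩ | ⟨i, rfl⟩) | ⟨i, rfl⟩) | ⟨i, rfl⟩)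
    · simpa [Sentence.Realize, Formula.Realize, inLevel, BoundedFormula.realize_rel₁, Fin.snoc]
        using h1 i j hij
    · simpa [Sentence.Realize, Formula.Realize, inLevel, isBelow, BoundedFormula.realize_rel₁,
        BoundedFormula.realize_rel₂, Fin.snoc] using h2 i
    · simpa [Sentence.Realize, Formula.Realize, inLevel, isBelow, BoundedFormula.realize_rel₁,
        BoundedFormula.realize_rel₂, Fin.snoc] using h3 i
    · simpa [Sentence.Realize, Formula.Realize, inLevel, isBelow, BoundedFormula.realize_rel₁,
        BoundedFormula.realize_rel₂, Fin.snoc] using h4 i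

/-- The structure given by a level function and a parent function. -/
@[reducible] def treeStructure {W : Type} (lev : W → Option ℕ) (par : W → W) : treeLang.Structure W where
  funMap f := f.elim
  RelMap R v := match R with
    | TreeRel.level k => lev (v 0) = some k
    | TreeRel.below k => lev (v 1) = some (k + 1) ∧ par (v 1) = v 0

theorem treeStructure_model {W : Type} {lev : W → Option ℕ} {par : W → W}
    (h : ∀ k x, lev x = some (k + 1) → lev (par x) = some k) :
    @Theory.Model treeLang W (treeStructure lev par) baseTheory := by
  let _ := treeStructure lev par
  refine model_baseTheory_iff.2 ⟨?_, ?_, ?_, ?_⟩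
  · rintro i j hij x ⟨h1, h2⟩
    change lev x = some i at h1
    change lev x = some j at h2
    rw [h1] at h2
    exact hij (Option.some.inj h2)
  · rintro i x y ⟨h1, h2⟩
    change lev y = _ at h1
    change par y = x at h2
    exact ⟨by rw [← h2]; exact h i y h1, h1⟩
  · intro i x hx
    exact ⟨par x, h i x hx, hx, rfl⟩
  · rintro i x y z ⟨_, h1⟩ ⟨_, h2⟩
    exact h1.symm.trans h2

theorem FinModel.exists_equiv (A : FinModel) :
    ∃ (i : FinIndex) (e : Fin A.card ≃ Fin (finModel i).card),
      (∀ k a, ModelLevel k i (e a) ↔ Structure.RelMap (levelSym k) ![a]) ∧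
      (∀ k a b, ModelBelow k i (e a) (e b) ↔ Structure.RelMap (belowSym k) ![a, b]) := by
  obtain ⟨f⟩ : Nonempty (Fin A.card ≃[treeLang] Fin (finModel (Quotient.mk _ A)).card) :=
    (Quotient.exact (Quotient.out_eq (Quotient.mk FinModel.setoid A))).elim fun g => ⟨g.symm⟩
  refine ⟨_, f.toEquiv, fun k a => ?_, fun k a b => ?_⟩
  · have h2 : f ∘ ![a] = ![f.toEquiv a] := by
      funext j; fin_cases j; rfl
    change Structure.RelMap (levelSym k) ![f.toEquiv a] ↔ _
    rw [← h2]
    exact f.map_rel (levelSym k) ![a]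
  · have h2 : f ∘ ![a, b] = ![f.toEquiv a, f.toEquiv b] := by
      funext j; fin_cases j <;> rfl
    change Structure.RelMap (belowSym k) ![f.toEquiv a, f.toEquiv b] ↔ _
    rw [← h2]
    exact f.map_rel (belowSym k) ![a, b]

/-- Every finite forest is one of the `𝓜ᵢ`. -/
theorem exists_finIndex {W : Type} [Finite W] {lev : W → Option ℕ} {par : W → W}
    (h : ∀ k x, lev x = some (k + 1) → lev (par x) = some k) :
    ∃ (i : FinIndex) (e : W ≃ Fin (finModel i).card),
      (∀ k a, ModelLevel k i (e a) ↔ lev a = some k) ∧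
      (∀ k a b, ModelBelow k i (e a) (e b) ↔ lev b = some (k + 1) ∧ par b = a) := by
  obtain ⟨n, ⟨e₀⟩⟩ := Finite.exists_equiv_fin W
  let lev' : Fin n → Option ℕ := fun x => lev (e₀.symm x)
  let par' : Fin n → Fin n := fun x => e₀ (par (e₀.symm x))
  have h' : ∀ k x, lev' x = some (k + 1) → lev' (par' x) = some k := by
    intro k x hx
    simpa [lev', par'] using h k _ hx
  obtain ⟨i, e, h1, h2⟩ :=
    FinModel.exists_equiv ⟨n, treeStructure lev' par', treeStructure_model h'⟩
  refine ⟨i, e₀.trans e, fun k a => (h1 k (e₀ a)).trans ?_,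
    fun k a b => (h2 k (e₀ a) (e₀ b)).trans ?_⟩
  · change lev (e₀.symm (e₀ a)) = some k ↔ _
    rw [e₀.symm_apply_apply]
  · change lev (e₀.symm (e₀ b)) = some (k + 1) ∧ e₀ (par (e₀.symm (e₀ b))) = e₀ a ↔ _
    rw [e₀.symm_apply_apply, e₀.apply_eq_iff_eq]

/-- The child relation of the finite model `𝓜ᵢ`. -/
def modelCh (i : FinIndex) (a b : Fin (finModel i).card) : Prop := ∃ k, ModelBelow k i a b

theorem Forest.ch_pt {M : Type} (D : Forest M) {i : FinIndex} {j : ℕ}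
    {a b : Fin (finModel i).card} : D.ch (D.pt ⟨i, j, a⟩) (D.pt ⟨i, j, b⟩) ↔ modelCh i a b := by
  simp only [Forest.ch, modelCh, ← D.below_pt _ i j, exists_and_right]

/-- Since the copies are closed, the children of a constant are constants of the same copy. So its
type is computed inside `𝓜ᵢ` and does not depend on the ambient forest. -/
theorem Forest.nodeType_pt {M : Type} (D : Forest M) (m r : ℕ) (i : FinIndex) (j : ℕ)
    (a : Fin (finModel i).card) :
    nodeType m D.ch r (D.pt ⟨i, j, a⟩) = nodeType m (modelCh i) r a := by
  refine nodeType_map m (fun a => D.pt ⟨i, j, a⟩) (fun x y h => D.ch_pt.2 h) ?_ ?_ r a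
  · intro x y z _ _ h
    simpa using D.pt_inj h
  · rintro x y ⟨⟨k, hk⟩, h⟩
    obtain ⟨b, rfl⟩ := D.closed i j x k y hk h
    exact ⟨b, D.ch_pt.1 ⟨⟨k, hk⟩, h⟩, rfl⟩

theorem exists_modelBelow {i : FinIndex} {k : ℕ} {a : Fin (finModel i).card}
    (h : ModelLevel (k + 1) i a) : ∃ b, ModelBelow k i b a := by
  obtain ⟨b, _, hb⟩ := (model_baseTheory_iff.1 (finModel i).isModel).2.2.1 k a h
  exact ⟨b, hb⟩

/-- Every type is the type of the root of a finite tree. -/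
theorem exists_finite_tree (m : ℕ) : ∀ (r : ℕ) (τ : NodeType m r) (l : ℕ),
    ∃ (W : Type) (_ : Finite W) (lev : W → ℕ) (par : W → Option W) (w : W),
      lev w = l ∧ (∀ x, par x = none ↔ x = w) ∧ (∀ x y, par y = some x → lev y = lev x + 1) ∧
      nodeType m (fun x y => par y = some x) r w = τ := by
  intro r
  induction r with
  | zero =>
    intro τ l
    exact ⟨Unit, inferInstance, fun _ => l, fun _ => none, (), rfl, by simp, by simp, rfl⟩
  | succ r ih =>
    intro τ l
    choose W hfin lev par w h1 h2 h3 h4 using fun σ => ih σ (l + 1)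
    -- The tree of type `τ` consists of a new root, namely `none` in `Option V`, with `τ σ` disjoint
    -- copies of a tree of type `σ` attached for each of the finitely many `σ`.
    let V := Σ σ : NodeType m r, Fin (τ σ) × W σ
    have : Finite V := inferInstance
    let parV : Option V → Option (Option V) := fun o => match o with
      | none => none
      | some ⟨σ, i, x⟩ => some ((par σ x).map fun y => ⟨σ, i, y⟩)
    refine ⟨Option V, inferInstance, fun o => o.elim l (fun v => lev v.1 v.2.2), parV,
      none, rfl, ?_, ?_, ?_⟩
    · rintro (_ | ⟨σ, i, x⟩) <;> simp [parV]
    · rintro (_ | ⟨σ', i', x'⟩) (_ | ⟨σ, i, x⟩) h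
      · simp [parV] at h
      · have hx : par σ x = none := by simpa [parV] using h
        rw [h2] at hx
        simp [hx, h1]
      · simp [parV] at h
      · have hx : (par σ x).map (fun y => (⟨σ, i, y⟩ : V)) = some ⟨σ', i', x'⟩ :=
          Option.some.inj h
        obtain ⟨y, hy, e⟩ := Option.map_eq_some_iff.1 hx
        cases e
        exact h3 _ _ _ hy
    -- Attaching a tree to the new root does not change the types of its nodes, as these only look
    -- away from the root.
    · have key : ∀ σ (i : Fin (τ σ)) (x : W σ),
          nodeType m (fun x y => parV y = some x) r (some ⟨σ, i, x⟩) =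
            nodeType m (fun x y => par σ y = some x) r x := by
        intro σ i x
        refine nodeType_map m (fun x => some (⟨σ, i, x⟩ : V)) ?_ ?_ ?_ r x
        · intro x y h
          simp [parV, h]
        · intro x y z _ _ h
          simpa using h
        · rintro x (_ | ⟨σ', i', y⟩) h
          · simp [parV] at h
          · have hx : (par σ' y).map (fun z => (⟨σ', i', z⟩ : V)) = some ⟨σ, i, x⟩ :=
              Option.some.inj h
            obtain ⟨z, hz, e⟩ := Option.map_eq_some_iff.1 hx
            cases e
            exact ⟨y, hz, rfl⟩
      funext σ
      have hset : {y : Option V | parV y = some none ∧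
          nodeType m (fun x y => parV y = some x) r y = σ} =
          Set.range (fun i : Fin (τ σ) => some (⟨σ, i, w σ⟩ : V)) := by
        ext y
        constructor
        · rintro ⟨hy1, hy2⟩
          rcases y with _ | ⟨σ', i, x⟩
          · simp [parV] at hy1
          · have hx : par σ' x = none := by simpa [parV] using hy1
            rw [h2] at hx
            subst hx
            rw [key, h4] at hy2
            subst hy2
            exact ⟨i, rfl⟩
        · rintro ⟨i, rfl⟩
          refine ⟨?_, by rw [key, h4]⟩
          simp [parV, (h2 σ (w σ)).2 rfl]
      change truncCard m {y : Option V | parV y = some none ∧ _ = σ} = τ σ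
      rw [hset]
      refine Fin.ext ?_
      have hinj : Function.Injective (fun i : Fin (τ σ) => some (⟨σ, i, w σ⟩ : V)) := by
        intro i j h
        simpa using h
      have hlt := (τ σ).is_lt
      rw [truncCard]
      simp only
      -- There are exactly `τ σ ≤ m` children of type `σ`, so truncation at `m` changes nothing.
      rw [← Set.image_univ, hinj.encard_image, Set.encard_univ, ENat.card_eq_coe_natCard, Nat.card_fin,
        min_eq_left (by exact_mod_cast (by omega)), ENat.toNat_natCast]

/-- In every forest with marked points there are infinitely many roots of each type. -/
theorem Forest.infinite_roots {M : Type} (D : Forest M) {m r : ℕ} (τ : NodeType m r) :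
    (D.roots τ).Infinite := by
  obtain ⟨W, _, lev, par, w, h1, h2, h3, h4⟩ := exists_finite_tree m r τ 0
  have hne : ∀ x, par x = none → lev x = 0 := fun x hx => by rw [(h2 x).1 hx, h1]
  -- The root is made its own parent. This creates no edge, because its level is `0` and edges only
  -- start from levels of the form `k + 1`.
  obtain ⟨i, e, hl, hb⟩ := exists_finIndex (W := W) (lev := fun x => some (lev x))
    (par := fun x => (par x).getD x) (by
      intro k x hx
      cases hp : par x with
      | none => simp [hne x hp] at hx
      | some y =>
        have := h3 _ _ hp
        simp only [Option.getD_some, Option.some.injEq] at hx ⊢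
        omega)
  -- The copies `Cᵢʲ`, for `j ∈ ℕ`, supply infinitely many roots of the given type.
  refine Set.infinite_of_injective_forall_mem (f := fun j : ℕ => D.pt ⟨i, j, e w⟩) ?_ ?_
  · intro j j' h
    simpa using D.pt_inj h
  · intro j
    refine ⟨(D.lev_pt _ _).2 ((hl 0 w).2 (by rw [h1])), ?_⟩
    rw [D.nodeType_pt, ← h4]
    refine nodeType_map m e ?_ ?_ ?_ r w
    · intro x y h
      exact ⟨lev x, (hb _ _ _).2 ⟨by rw [h3 _ _ h], by simp [h]⟩⟩
    · intro x y z _ _ h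
      exact e.injective h
    · rintro x y ⟨k, hk⟩
      obtain ⟨y, rfl⟩ := e.surjective y
      obtain ⟨hk1, hk2⟩ := (hb _ _ _).1 hk
      refine ⟨y, ?_, rfl⟩
      cases hp : par y with
      | none => simp [hne y hp] at hk1
      | some z => simpa [hp] using hk2

/-- The one-element forest without levels is among the `𝓜ᵢ`; each of its infinitely many copies
contributes an element of no level. -/
theorem Forest.infinite_junk {M : Type} (D : Forest M) (d : ℕ) : (D.junk d).Infinite := by
  obtain ⟨i, e, hl, -⟩ := exists_finIndex (W := Unit) (lev := fun _ => none) (par := id) (by simp)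
  refine Set.infinite_of_injective_forall_mem (f := fun j : ℕ => D.pt ⟨i, j, e ()⟩) ?_ ?_
  · intro j j' h
    simpa using D.pt_inj h
  · intro j k _ h
    have := (hl k ()).1 ((D.lev_pt _ _).1 h)
    simp at this

theorem finite_const {code : FinIndex × ℕ → ℕ} (hcode : code.Injective) (d : ℕ) :
    {c : Const | code (c.i, c.j) < d}.Finite := by
  have h1 : {p : FinIndex × ℕ | code p < d}.Finite :=
    Set.Finite.preimage (hcode.injOn) (Set.finite_lt_nat d)
  refine (h1.biUnion (t := fun p => Set.range fun a => (⟨p.1, p.2, a⟩ : Const))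
    fun p _ => Set.finite_range _).subset ?_
  rintro ⟨i, j, a⟩ h
  exact Set.mem_biUnion (x := (i, j)) h ⟨a, rfl⟩

variable {code : FinIndex × ℕ → ℕ}

theorem Forest.par_pt {M : Type} (D : Forest M) {i : FinIndex} {j k : ℕ}
    {a : Fin (finModel i).card} (h : D.lev (D.pt ⟨i, j, a⟩) = some (k + 1)) :
    ∃ b, ModelBelow k i b a ∧ D.par (D.pt ⟨i, j, a⟩) = D.pt ⟨i, j, b⟩ := by
  obtain ⟨b, hb⟩ := exists_modelBelow ((D.lev_pt _ _).1 h)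
  exact ⟨b, hb, ((D.below_pt k i j b a).2 hb).2⟩

/-- The finitely many constants with code below `d` are matched with each other. Their types agree
by `Forest.nodeType_pt`, and the numbers of roots and of junk elements agree because they are
infinite on both sides. That `E` does not depend on `m` allows `m` to be chosen afterwards, in terms
of the size of `E`. -/
theorem exists_initial_position (hcode : code.Injective) (d : ℕ) {M N : Type} (D : Forest M)
    (D' : Forest N) : ∃ E : Finset (M × N), ∀ m, Position code d m D D' E := by
  classical
  refine ⟨(finite_const hcode d).toFinset.image fun c => (D.pt c, D'.pt c), fun m => ?_⟩
  have mem {x : M} {y : N} : (x, y) ∈ (finite_const hcode d).toFinset.image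
      (fun c => (D.pt c, D'.pt c)) ↔ ∃ c : Const, code (c.i, c.j) < d ∧ D.pt c = x ∧ D'.pt c = y := by
    simp
  refine ⟨⟨?_, ?_, ?_, ?_⟩, ?_, ?_, ?_⟩
  · intro x y x' y' h h'
    obtain ⟨c, _, rfl, rfl⟩ := mem.1 h
    obtain ⟨c', _, rfl, rfl⟩ := mem.1 h'
    rw [D.pt_inj.eq_iff, D'.pt_inj.eq_iff]
  · intro x y h k _
    obtain ⟨c, _, rfl, rfl⟩ := mem.1 h
    rw [D.lev_pt, D'.lev_pt]
  · intro x y h k _ hx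
    obtain ⟨⟨i, j, a⟩, hc, rfl, rfl⟩ := mem.1 h
    obtain ⟨b, hb, e⟩ := D.par_pt hx
    exact mem.2 ⟨⟨i, j, b⟩, hc, e.symm, (((D'.below_pt k i j b a).2 hb).2).symm⟩
  · intro c hc
    exact mem.2 ⟨c, hc, rfl, rfl⟩
  · intro x y h k r _ _
    obtain ⟨⟨i, j, a⟩, _, rfl, rfl⟩ := mem.1 h
    rw [D.nodeType_pt, D'.nodeType_pt]
  · intro r _ τ
    exact truncCard_of_infinite (D.infinite_roots τ) (D'.infinite_roots τ)
  · exact truncCard_of_infinite (D.infinite_junk d) (D'.infinite_junk d)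

variable {L : FirstOrder.Language.{0, 0}} {T : L.Theory}

theorem Presentation.sentence_iff (hcode : code.Injective) (P : Presentation code L T) {M N : Type}
    {s : L.Structure M} {s' : L.Structure N} {D : Forest M} {D' : Forest N} (h : P.Rep s D)
    (h' : P.Rep s' D') (φ : L.Sentence) : M ⊨ φ ↔ N ⊨ φ := by
  obtain ⟨q, hq⟩ := P.realize_iff φ
  obtain ⟨d, hd⟩ := hq.exists
  obtain ⟨E, hE⟩ := exists_initial_position hcode d D D'
  exact hd h h' (hE (E.card + q * (d + 1))) le_rfl _ _ _ _ (fun a => a.elim) (fun i => i.elim0)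

theorem Presentation.isComplete (hcode : code.Injective) (P : Presentation code L T) {M : Type}
    [Nonempty M] (D : Forest M) : T.IsComplete := by
  obtain ⟨s, hs⟩ := P.exists_structure D
  have hM : M ⊨ T := P.models hs
  refine ⟨⟨ModelType.of T M⟩, fun φ => ?_⟩
  simp only [models_sentence_iff]
  have key (N : ModelType.{0, 0, 0} T) : N ⊨ φ ↔ M ⊨ φ := by
    obtain ⟨D', hD'⟩ := P.exists_forest N N.is_model
    exact P.sentence_iff hcode hD' hs φ
  by_cases hφ : M ⊨ φ
  · exact Or.inl fun N => (key N).2 hφ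
  · exact Or.inr fun N => (Sentence.realize_not N).2 fun hN => hφ ((key N).1 hN)

end TreeTheory

/-! ## Counting types -/

namespace FOComplexity

/-- A finite part of a complete type over a complete theory is realized in every model. -/
theorem exists_realize_of_finset {L : FirstOrder.Language.{0, 0}} {T : L.Theory} (hT : T.IsComplete)
    (M : ModelType.{0, 0, 0} T) (p : T.CompleteType (Fin 1)) (t : Finset L[[Fin 1]].Sentence)
    (ht : ∀ φ ∈ t, φ ∈ p) :
    ∃ v : Fin 1 → M, ∀ φ ∈ t, (Formula.equivSentence.symm φ).Realize v := by
  obtain ⟨N, v, rfl⟩ := exists_modelType_is_realized_in (T := T) p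
  -- The conjunction of `t` is realized in some model `N`. Its existential closure is a sentence, so
  -- completeness of `T` transfers it to `M`.
  have h1 : t.toList.foldr (· ⊓ ·) ⊤ ∈ T.typeOf v := CompleteType.toList_foldr_inf_mem.2 ht
  set ψ : L[[Fin 1]].Sentence := t.toList.foldr (· ⊓ ·) ⊤ with hψ
  have h2 : (Formula.equivSentence.symm ψ).exClosure.Realize N := by
    rw [← Formula.exists_realize_equivSentence_iff_realize_exClosure]
    refine ⟨v, ?_⟩
    let _ := constantsOn.structure v
    exact (Formula.realize_equivSentence N _).2 (CompleteType.mem_typeOf.1 h1)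
  have h3 : (Formula.equivSentence.symm ψ).exClosure.Realize M :=
    (hT.realize_sentence_iff _ M).2 ((hT.realize_sentence_iff _ N).1 h2)
  rw [← Formula.exists_realize_equivSentence_iff_realize_exClosure] at h3
  obtain ⟨w, hw⟩ := h3
  refine ⟨w, fun φ hφ => ?_⟩
  have h4 : ψ ∈ T.typeOf w := by
    let _ := constantsOn.structure w
    exact CompleteType.mem_typeOf.2 ((Formula.realize_equivSentence M _).1 hw)
  exact CompleteType.mem_typeOf.1 (CompleteType.toList_foldr_inf_mem.1 h4 hφ)

/-- A complete theory has a model that realizes all complete types in one variable. -/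
theorem exists_model_realizing_all {L : FirstOrder.Language.{0, 0}} {T : L.Theory}
    (hT : T.IsComplete) : ∃ N : ModelType.{0, 0, 0} T, ∀ p : T.CompleteType (Fin 1),
      ∃ v : Fin 1 → N, T.typeOf v = p := by
  classical
  let P := T.CompleteType (Fin 1)
  -- One new constant is introduced for every type `p`, and `F` says that this constant satisfies
  -- the formulas of `p`. By compactness it suffices to realize finitely many of these sentences,
  -- which can be done for each constant separately in any fixed model.
  let F : (Σ p : P, {φ : L[[Fin 1]].Sentence // φ ∈ p}) → L[[P]].Sentence := fun x =>
    Formula.equivSentence ((Formula.equivSentence.symm x.2.1).relabel (fun _ : Fin 1 => x.1))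
  have hF (M : ModelType.{0, 0, 0} T) (v : P → M) (x) :
      (Formula.equivSentence.symm (F x)).Realize v ↔
        (Formula.equivSentence.symm x.2.1).Realize (fun _ : Fin 1 => v x.1) := by
    rw [Equiv.symm_apply_apply, Formula.realize_relabel]
    rfl
  have hsat : ((L.lhomWithConstants P).onTheory T ∪ Set.range F).IsSatisfiable := by
    rw [isSatisfiable_iff_isFinitelySatisfiable]
    intro U hU
    obtain ⟨M⟩ := hT.1
    have hU' : ((U.filter (· ∈ Set.range F) : Finset _) : Set _) ⊆ F '' Set.univ := by
      intro φ hφ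
      rw [Set.image_univ]
      exact (Finset.mem_filter.1 (Finset.mem_coe.1 hφ)).2
    obtain ⟨G, -, hG⟩ := Finset.subset_set_image_iff.1 hU'
    have hv : ∀ p : P, ∃ x : M, ∀ y ∈ G, y.1 = p →
        (Formula.equivSentence.symm y.2.1).Realize (fun _ : Fin 1 => x) := by
      intro p
      obtain ⟨v, hv⟩ := exists_realize_of_finset hT M p
        ((G.filter (fun y => y.1 = p)).image fun y => y.2.1) (by
          intro φ hφ
          obtain ⟨y, hy, rfl⟩ := Finset.mem_image.1 hφ
          rw [← (Finset.mem_filter.1 hy).2]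
          exact y.2.2)
      refine ⟨v 0, fun y hy hp => ?_⟩
      have := hv y.2.1 (Finset.mem_image.2 ⟨y, Finset.mem_filter.2 ⟨hy, hp⟩, rfl⟩)
      rwa [show (fun _ : Fin 1 => v 0) = v from funext fun i => by rw [Subsingleton.elim i 0] ]
    choose v hv using hv
    let _ : (constantsOn P).Structure M := constantsOn.structure v
    have : M ⊨ (U : L[[P]].Theory) := by
      refine Theory.model_iff _ |>.2 fun φ hφ => ?_
      rcases hU hφ with h | h
      · exact ((LHom.onTheory_model _ T).2 M.is_model).realize_of_mem φ h
      · have : φ ∈ G.image F := by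
          rw [hG]
          exact Finset.mem_filter.2 ⟨hφ, h⟩
        obtain ⟨y, hy, rfl⟩ := Finset.mem_image.1 this
        exact (Formula.realize_equivSentence_symm M (F y) v).1 ((hF M v y).2 (hv y.1 y hy rfl))
    exact ⟨ModelType.of _ M⟩
  obtain ⟨Q, hQ⟩ : ({q : T.CompleteType P | Set.range F ⊆ q} : Set _).Nonempty := by
    rw [Set.nonempty_iff_ne_empty, Ne, CompleteType.setOfPred_subset_eq_empty_iff, not_not]
    exact hsat
  obtain ⟨N, v, rfl⟩ := exists_modelType_is_realized_in (T := T) Q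
  refine ⟨N, fun p => ⟨fun _ => v p, ?_⟩⟩
  have hsub : ∀ φ ∈ p, φ ∈ T.typeOf (fun _ : Fin 1 => v p) := by
    intro φ hφ
    rw [CompleteType.mem_typeOf]
    exact (hF N v ⟨p, φ, hφ⟩).1 (CompleteType.mem_typeOf.1 (hQ ⟨⟨p, φ, hφ⟩, rfl⟩))
  refine SetLike.ext fun φ => ⟨fun h => ?_, hsub φ⟩
  by_contra hφ
  have := hsub _ ((p.not_mem_iff φ).2 hφ)
  exact ((CompleteType.not_mem_iff _ φ).1 this) h

/-- Types over `A` can be counted through an invariant of the elements of models. -/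
theorem card_completeType_le {L : FirstOrder.Language.{0, 0}} {T : L.Theory}
    (M : ModelType.{0, 0, 0} T) (A : Set M) {κ : Cardinal.{0}}
    (h : ∀ (N : Type) [L.Structure N], N ⊨ T → ∀ ι : A → N, ∃ (X : Type) (inv : N → X), #X ≤ κ ∧
      ∀ b b', inv b = inv b' → ∀ φ : L.Formula (A ⊕ Fin 1),
        φ.Realize (Sum.elim ι fun _ => b) → φ.Realize (Sum.elim ι fun _ => b')) :
    #((L[[A]].completeTheory M).CompleteType (Fin 1)) ≤ κ := by
  -- In a model realizing all the types, two types whose chosen realizations have the same invariant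
  -- contain the same formulas. Hence the invariant of a realization is injective on types.
  obtain ⟨N, hN⟩ := exists_model_realizing_all (completeTheory.isComplete L[[A]] M)
  let _ : L.Structure N := (L.lhomWithConstants A).reduct N
  have hexp : (L.lhomWithConstants A).IsExpansionOn N := LHom.isExpansionOn_reduct _ _
  have hNT : N ⊨ T := by
    rw [← LHom.onTheory_model (L.lhomWithConstants A)]
    have h1 : M ⊨ (L.lhomWithConstants A).onTheory T := (LHom.onTheory_model _ T).2 M.is_model
    exact N.is_model.mono (model_iff_subset_completeTheory.1 h1)
  obtain ⟨X, inv, hX, hinv⟩ := h N hNT (fun a => (L.con a : N))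
  choose v hv using hN
  refine le_trans (mk_le_of_injective (f := fun p => inv (v p 0)) ?_) hX
  intro p p' hpp
  have key : ∀ q q', inv (v q 0) = inv (v q' 0) → ∀ φ ∈ q, φ ∈ q' := by
    intro q q' hqq φ hφ
    have e (q) : (fun _ : Fin 1 => v q 0) = v q := funext fun i => by rw [Subsingleton.elim i 0]
    rw [← hv q, CompleteType.mem_typeOf] at hφ
    rw [← hv q', CompleteType.mem_typeOf]
    have hφ' := BoundedFormula.realize_constantsVarsEquiv.2 hφ
    refine BoundedFormula.realize_constantsVarsEquiv.1 ?_
    have := hinv _ _ hqq (BoundedFormula.constantsVarsEquiv (Formula.equivSentence.symm φ))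
    rw [e q, e q'] at this
    exact this hφ'
  exact SetLike.ext fun φ => ⟨key p p' hpp φ, key p' p hpp.symm φ⟩

end FOComplexity

-- Types over parameters and superstability

namespace TreeTheory

theorem Forest.par_of_lev_zero {M : Type} (D : Forest M) {x : M} (h : D.lev x = some 0) :
    D.par x = x := D.par_of_ne (by simp [h])

/-- The truncated subtraction is right because a root is its own parent. -/
theorem Forest.lev_iterate {M : Type} (D : Forest M) {x : M} {n : ℕ} (h : D.lev x = some n)
    (i : ℕ) : D.lev (D.par^[i] x) = some (n - i) := by
  induction i with
  | zero => exact h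
  | succ i ih =>
    rw [Function.iterate_succ_apply']
    rcases Nat.eq_zero_or_pos (n - i) with h0 | h0
    · rw [h0] at ih
      rw [D.par_of_lev_zero ih, ih]
      congr 1
      omega
    · exact D.lev_par (by rw [ih]; congr 1; omega)

theorem Forest.iterate_eq {M : Type} (D : Forest M) {x : M} {n : ℕ} (h : D.lev x = some n)
    {i j : ℕ} (hij : n - i = n - j) : D.par^[i] x = D.par^[j] x := by
  have key : ∀ l, D.par^[n + l] x = D.par^[n] x := by
    intro l
    rw [Nat.add_comm, Function.iterate_add_apply]
    exact Function.iterate_fixed (D.par_of_lev_zero (by simpa using D.lev_iterate h n)) l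
  rcases eq_or_ne i j with rfl | hne
  · rfl
  · obtain ⟨l, rfl⟩ := Nat.exists_eq_add_of_le (show n ≤ i by omega)
    obtain ⟨l', rfl⟩ := Nat.exists_eq_add_of_le (show n ≤ j by omega)
    rw [key, key]

theorem Forest.iterate_eq_of_lev_none {M : Type} (D : Forest M) {x : M} (h : D.lev x = none)
    (i : ℕ) : D.par^[i] x = x :=
  Function.iterate_fixed (D.par_of_ne (by simp [h])) i

/-- Coincidences among the iterated predecessors of an element depend only on its level: nothing
moves if there is no level, and otherwise iterates agree exactly when their levels do. -/
theorem Forest.iterate_eq_iff {M : Type} (D : Forest M) {x y : M} (h : D.lev x = D.lev y) (i j : ℕ)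
    (hx : D.par^[i] x = D.par^[j] x) : D.par^[i] y = D.par^[j] y := by
  cases hl : D.lev x with
  | none => rw [D.iterate_eq_of_lev_none (h ▸ hl), D.iterate_eq_of_lev_none (h ▸ hl)]
  | some n =>
    refine D.iterate_eq (h ▸ hl) ?_
    have := congrArg D.lev hx
    rw [D.lev_iterate hl, D.lev_iterate hl] at this
    exact Option.some.inj this

theorem Forest.lev_iterate_congr {M : Type} (D : Forest M) {x y : M} (h : D.lev x = D.lev y)
    (i : ℕ) : D.lev (D.par^[i] x) = D.lev (D.par^[i] y) := by
  cases hl : D.lev x with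
  | none => rw [D.iterate_eq_of_lev_none hl, D.iterate_eq_of_lev_none (h ▸ hl), h]
  | some n => rw [D.lev_iterate hl, D.lev_iterate (h ▸ hl)]

theorem Forest.finite_range_iterate {M : Type} (D : Forest M) (x : M) :
    (Set.range fun i : ℕ => D.par^[i] x).Finite := by
  cases hl : D.lev x with
  | none =>
    refine (Set.finite_singleton x).subset ?_
    rintro _ ⟨i, rfl⟩
    exact D.iterate_eq_of_lev_none hl i
  | some n =>
    refine ((Set.finite_Iic n).image fun i : ℕ => D.par^[i] x).subset ?_
    rintro _ ⟨i, rfl⟩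
    exact ⟨min i n, by simp, D.iterate_eq hl (by omega)⟩

/-- `x` is an iterated predecessor of a parameter. -/
def Forest.Named {M S : Type} (D : Forest M) (g : S → M) (x : M) : Prop :=
  ∃ s n, x = D.par^[n] (g s)

/-- `b` and `b'` cannot be distinguished over the parameters `g`. -/
structure Forest.Similar {M S : Type} (D : Forest M) (g : S → M) (b b' : M) : Prop where
  lev : D.lev b = D.lev b'
  typ : ∀ i m r, nodeType m D.ch r (D.par^[i] b) = nodeType m D.ch r (D.par^[i] b')
  named : ∀ i, D.Named g (D.par^[i] b) → D.par^[i] b = D.par^[i] b'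
  named' : ∀ i, D.Named g (D.par^[i] b') → D.par^[i] b = D.par^[i] b'

/-- Similarity is the equality of an invariant with few values. -/
theorem Forest.exists_invariant {M S : Type} (D : Forest M) (g : S → M) :
    ∃ inv : M → Option ℕ × Option (ℕ × S × ℕ) × (ℕ → ℕ → ℕ → ℕ),
      ∀ b b', inv b = inv b' → D.Similar g b b' := by
  have henc : ∀ m r, ∃ e : NodeType m r → ℕ, Function.Injective e := fun m r =>
    have := NodeType.finite m r
    (Countable.exists_injective_nat _)
  choose e he using henc
  -- The code records the first iterate of `b` that is named, together with a name `s, n` for it.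
  -- All earlier iterates are unnamed and all later ones are determined by this one, so equal codes
  -- give equal named iterates.
  have hfirst : ∀ b, ∃ o : Option (ℕ × S × ℕ), (o = none → ∀ i, ¬ D.Named g (D.par^[i] b)) ∧
      ∀ t s n, o = some (t, s, n) → D.par^[t] b = D.par^[n] (g s) ∧
        ∀ i < t, ¬ D.Named g (D.par^[i] b) := by
    classical
    intro b
    by_cases h : ∃ i, D.Named g (D.par^[i] b)
    · obtain ⟨s, n, hsn⟩ := Nat.find_spec h
      refine ⟨some (Nat.find h, s, n), by simp, ?_⟩
      intro t s' n' h'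
      simp only [Option.some.injEq, Prod.mk.injEq] at h'
      obtain ⟨rfl, rfl, rfl⟩ := h'
      exact ⟨hsn, fun i hi => Nat.find_min h hi⟩
    · exact ⟨none, fun _ i hi => h ⟨i, hi⟩, by simp⟩
  choose first h1 h2 using hfirst
  refine ⟨fun b => (D.lev b, first b, fun i m r => e m r (nodeType m D.ch r (D.par^[i] b))), ?_⟩
  intro b b' h
  simp only [Prod.mk.injEq] at h
  obtain ⟨hl, hf, ht⟩ := h
  have key : ∀ i, D.Named g (D.par^[i] b) ∨ D.Named g (D.par^[i] b') →
      D.par^[i] b = D.par^[i] b' := by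
    intro i hi
    cases hfb : first b with
    | none => exact absurd hi (not_or_intro (h1 b hfb i) (h1 b' (hf ▸ hfb) i))
    | some x =>
      obtain ⟨t, s, n⟩ := x
      obtain ⟨ht1, ht2⟩ := h2 b t s n hfb
      obtain ⟨ht1', ht2'⟩ := h2 b' t s n (hf ▸ hfb)
      rcases lt_or_ge i t with hit | hit
      · exact absurd hi (not_or_intro (ht2 i hit) (ht2' i hit))
      · obtain ⟨l, rfl⟩ := Nat.exists_eq_add_of_le hit
        rw [Nat.add_comm, Function.iterate_add_apply, Function.iterate_add_apply, ht1, ht1']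
  exact ⟨hl, fun i m r => he m r (congrFun (congrFun (congrFun ht i) m) r),
    fun i hi => key i (Or.inl hi), fun i hi => key i (Or.inr hi)⟩

variable {code : FinIndex × ℕ → ℕ}

/-- Similar elements can be matched over any finite set of parameters. -/
theorem Forest.Similar.exists_position (hcode : code.Injective) (d : ℕ) {M A : Type} {D : Forest M}
    {ι : A → M} {b b' : M} (h : D.Similar (Sum.elim ι D.pt) b b') {V : Set A} (hV : V.Finite) :
    ∃ E : Finset (M × M), (∀ a ∈ V, (ι a, ι a) ∈ E) ∧ (b, b') ∈ E ∧
      ∀ m, Position code d m D D E := by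
  classical
  let g : A ⊕ Const → M := Sum.elim ι D.pt
  let V' : Set (A ⊕ Const) := Sum.inl '' V ∪ Sum.inr '' {c : Const | code (c.i, c.j) < d}
  have hV' : V'.Finite := (hV.image _).union ((finite_const hcode d).image _)
  -- The position is the identity on the branches of the relevant parameters and constants, and
  -- pairs the branch of `b` with that of `b'`. Both parts are closed under predecessors.
  let S₁ : Set (M × M) := (fun x => (x, x)) '' ⋃ s ∈ V', Set.range fun i : ℕ => D.par^[i] (g s)
  let S₂ : Set (M × M) := Set.range fun i : ℕ => (D.par^[i] b, D.par^[i] b')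
  have hS₁ : S₁.Finite := (hV'.biUnion fun s _ => D.finite_range_iterate _).image _
  have hS₂ : S₂.Finite := by
    refine ((D.finite_range_iterate b).prod (D.finite_range_iterate b')).subset ?_
    rintro _ ⟨i, rfl⟩
    exact ⟨⟨i, rfl⟩, ⟨i, rfl⟩⟩
  have mem₁ {s} (hs : s ∈ V') (n : ℕ) : (D.par^[n] (g s), D.par^[n] (g s)) ∈ S₁ :=
    ⟨_, Set.mem_biUnion hs ⟨n, rfl⟩, rfl⟩
  have mem_iff {x y : M} : (x, y) ∈ (hS₁.union hS₂).toFinset ↔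
      (∃ s ∈ V', ∃ n, x = D.par^[n] (g s) ∧ y = x) ∨ ∃ i, x = D.par^[i] b ∧ y = D.par^[i] b' := by
    rw [Set.Finite.mem_toFinset]
    constructor
    · rintro (⟨z, hz, e⟩ | ⟨i, e⟩)
      · cases e
        obtain ⟨s, hs, n, rfl⟩ := Set.mem_iUnion₂.1 hz
        exact Or.inl ⟨s, hs, n, rfl, rfl⟩
      · cases e
        exact Or.inr ⟨i, rfl, rfl⟩
    · rintro (⟨s, hs, n, rfl, rfl⟩ | ⟨i, rfl, rfl⟩)
      · exact Or.inl (mem₁ hs n)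
      · exact Or.inr ⟨i, rfl⟩
  -- The conditions on numbers of roots and junk elements are trivial, since both forests are `D`.
  refine ⟨(hS₁.union hS₂).toFinset, ?_, ?_, fun m => ⟨⟨?_, ?_, ?_, ?_⟩, ?_, fun _ _ _ => rfl, rfl⟩⟩
  · intro a ha
    exact mem_iff.2 (Or.inl ⟨Sum.inl a, Or.inl ⟨a, ha, rfl⟩, 0, rfl, rfl⟩)
  · exact mem_iff.2 (Or.inr ⟨0, rfl, rfl⟩)
  · intro x y x' y' h1 h2
    rcases mem_iff.1 h1 with ⟨s, _, n, hx, rfl⟩ | ⟨i, rfl, rfl⟩ <;>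
      rcases mem_iff.1 h2 with ⟨s', _, n', hx', rfl⟩ | ⟨i', rfl, rfl⟩
    · rfl
    -- A point of the identity part that meets the branch of `b` or of `b'` is named, and similarity
    -- forces the two branches to coincide there.
    · constructor
      · intro e
        rw [e]
        exact h.named i' ⟨s, n, e ▸ hx⟩
      · intro e
        rw [e]
        exact (h.named' i' ⟨s, n, e ▸ hx⟩).symm
    · constructor
      · intro e
        rw [← e]
        exact (h.named i ⟨s', n', e ▸ hx'⟩).symm
      · intro e
        rw [← e]
        exact h.named' i ⟨s', n', e ▸ hx'⟩
    · exact ⟨D.iterate_eq_iff h.lev i i', D.iterate_eq_iff h.lev.symm i i'⟩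
  · intro x y h1 k _
    rcases mem_iff.1 h1 with ⟨s, _, n, hx, rfl⟩ | ⟨i, rfl, rfl⟩
    · rfl
    · rw [D.lev_iterate_congr h.lev]
  · intro x y h1 k _ _
    rcases mem_iff.1 h1 with ⟨s, hs, n, hx, rfl⟩ | ⟨i, rfl, rfl⟩
    · exact mem_iff.2 (Or.inl ⟨s, hs, n + 1, by rw [hx, Function.iterate_succ_apply'], rfl⟩)
    · exact mem_iff.2 (Or.inr ⟨i + 1, (Function.iterate_succ_apply' _ _ _).symm,
        (Function.iterate_succ_apply' _ _ _).symm⟩)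
  · intro c hc
    exact mem_iff.2 (Or.inl ⟨Sum.inr c, Or.inr ⟨c, hc, rfl⟩, 0, rfl, rfl⟩)
  · intro x y h1 k r _ _
    rcases mem_iff.1 h1 with ⟨s, _, n, hx, rfl⟩ | ⟨i, rfl, rfl⟩
    · rfl
    · exact h.typ i m r

variable {L : FirstOrder.Language.{0, 0}} {T : L.Theory}

theorem Presentation.realize_of_similar (hcode : code.Injective) (P : Presentation code L T)
    {M A : Type} {s : L.Structure M} {D : Forest M} (hs : P.Rep s D) {ι : A → M} {b b' : M}
    (h : D.Similar (Sum.elim ι D.pt) b b') (φ : L.Formula (A ⊕ Fin 1))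
    (hφ : φ.Realize (Sum.elim ι fun _ => b)) : φ.Realize (Sum.elim ι fun _ => b') := by
  classical
  -- Only the finitely many parameters that occur in `φ` matter, so `φ` is rewritten as a formula in
  -- its own free variables, to which a finite position applies.
  have key (c : M) : BoundedFormula.Realize (BoundedFormula.restrictFreeVar φ id)
      (fun a => Sum.elim ι (fun _ => c) a.1) default ↔
        φ.Realize (Sum.elim ι fun _ => c) :=
    BoundedFormula.realize_restrictFreeVar _ fun _ => rfl
  rw [← key] at hφ ⊢
  obtain ⟨q, hq⟩ := P.realize_iff (BoundedFormula.restrictFreeVar φ id)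
  obtain ⟨d, hd⟩ := hq.exists
  obtain ⟨E, hE1, hE2, hE3⟩ := h.exists_position hcode d
    (V := Sum.inl ⁻¹' (BoundedFormula.freeVarFinset φ : Set (A ⊕ Fin 1)))
    ((Finset.finite_toSet _).preimage Sum.inl_injective.injOn)
  refine (hd hs hs (hE3 (E.card + q * (d + 1))) le_rfl _ _ _ _ ?_ (fun i => i.elim0)).1 hφ
  rintro ⟨a | i, ha⟩
  · exact hE1 a ha
  · exact hE2

theorem countable_const (hcode : code.Injective) : Countable Const := by
  refine Function.Injective.countable (f := fun c : Const => (code (c.i, c.j), c.a.val)) ?_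
  rintro ⟨i, j, a⟩ ⟨i', j', a'⟩ h
  simp only [Prod.mk.injEq] at h
  obtain ⟨h1, h2⟩ := h
  have h3 := hcode h1
  simp only [Prod.mk.injEq] at h3
  obtain ⟨rfl, rfl⟩ := h3
  rw [Fin.ext h2]

/-- The invariant has at most `ℵ₀` levels, `#A + ℵ₀` parameters and constants to name the first
common predecessor, and `𝔠` families of node types. The last factor is the reason for the threshold
`𝔠`. -/
theorem Presentation.superstable (hcode : code.Injective) (P : Presentation code L T) :
    FOComplexity.Superstable T := by
  refine ⟨𝔠, fun κ hκ M A hA => FOComplexity.card_completeType_le M A fun N s hN ι => ?_⟩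
  obtain ⟨D, hD⟩ := P.exists_forest N hN
  obtain ⟨inv, hinv⟩ := D.exists_invariant (Sum.elim ι D.pt)
  refine ⟨_, inv, ?_, fun b b' h φ hφ => P.realize_of_similar hcode hD (hinv b b' h) φ hφ⟩
  have := countable_const hcode
  have hκ₀ : ℵ₀ ≤ κ := aleph0_le_continuum.trans hκ
  have hc (X : Type) [Countable X] : #X ≤ κ := mk_le_aleph0.trans hκ₀
  have hmul {a b : Cardinal.{0}} (ha : a ≤ κ) (hb : b ≤ κ) : a * b ≤ κ :=
    (mul_le_mul' ha hb).trans (mul_eq_self hκ₀).le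
  have hadd {a b : Cardinal.{0}} (ha : a ≤ κ) (hb : b ≤ κ) : a + b ≤ κ :=
    (add_le_add ha hb).trans (add_eq_self hκ₀).le
  have h1 : #(ℕ → ℕ → ℕ → ℕ) ≤ κ := by
    refine le_trans ?_ hκ
    simp
  have h2 : #(Option (ℕ × (A ⊕ Const) × ℕ)) ≤ κ := by
    rw [mk_option]
    refine hadd ?_ (one_le_aleph0.trans hκ₀)
    rw [← mul_def, ← mul_def, ← add_def]
    exact hmul (hc ℕ) (hmul (hadd hA (hc Const)) (hc ℕ))
  rw [← mul_def, ← mul_def]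
  exact hmul (hc _) (hmul h2 h1)

end TreeTheory

/-! ## A large model -/

namespace FOComplexity

/-- The system is carried over to the language with constants for the variables by keeping only
those relations that relate `v a` to `w a` for all `a`; this is preserved because `back` only
enlarges relations. -/
theorem ForallSystem.realize_equivSentence_symm {L : FirstOrder.Language.{0, 0}} {M N α : Type}
    [L.Structure M] [L.Structure N] {K : ℕ → (M → N → Prop) → Prop} {K' : ℕ → (N → M → Prop) → Prop}
    (h : ForallSystem L K K') (h' : ForallSystem L K' K) {n : ℕ} {E : M → N → Prop} (hE : K n E)
    {v : α → M} {w : α → N} (hvw : ∀ a, E (v a) (w a)) {φ : L[[α]].Sentence}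
    (hφ : IsForall n 0 φ) (hv : (Formula.equivSentence.symm φ).Realize v) :
    (Formula.equivSentence.symm φ).Realize w := by
  let _ : (constantsOn α).Structure M := constantsOn.structure v
  let _ : (constantsOn α).Structure N := constantsOn.structure w
  rw [Formula.realize_equivSentence_symm] at hv ⊢
  have key {M N : Type} [L.Structure M] [L.Structure N] {K : ℕ → (M → N → Prop) → Prop}
      {K' : ℕ → (N → M → Prop) → Prop} (h : ForallSystem L K K') (v : α → M) (w : α → N) :
      letI : (constantsOn α).Structure M := constantsOn.structure v
      letI : (constantsOn α).Structure N := constantsOn.structure w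
      ForallSystem L[[α]] (fun n E => K n E ∧ ∀ a, E (v a) (w a))
        (fun n E => K' n E ∧ ∀ a, E (w a) (v a)) := by
    let _ : (constantsOn α).Structure M := constantsOn.structure v
    let _ : (constantsOn α).Structure N := constantsOn.structure w
    refine ⟨fun {E} hE => ⟨(h.atomic hE.1).inj, ?_, ?_⟩, fun hE => ⟨h.flip hE.1, hE.2⟩, ?_⟩
    · rintro n (f | f) xs ys hxy
      · exact (h.atomic hE.1).func f xs ys hxy
      · match n, f with
        | 0, a => exact hE.2 a
        | n + 1, a => exact PEmpty.elim a
    · rintro n (R | R) xs ys hxy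
      · exact (h.atomic hE.1).rel R xs ys hxy
      · exact isEmptyElim R
    · rintro n E hE y
      obtain ⟨E', h1, h2, h3⟩ := h.back hE.1 y
      exact ⟨E', ⟨h1, fun a => h2 _ _ (hE.2 a)⟩, h2, h3⟩
  exact ((key h v w).realize_imp n (key h' w v) 0 φ ⟨hE, hvw⟩ (fun a => a.elim)
    (fun i => i.elim0)).1 hφ hv

/-- A theory is not `ω`-stable if in some model the points of a Cantor set can be distinguished
bit by bit. -/
theorem not_stableIn_aleph0 {L : FirstOrder.Language.{0, 0}} {T : L.Theory}
    (M : ModelType.{0, 0, 0} T) (v : (ℕ → Bool) → M)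
    (h : ∀ n, ∃ θ : L.Formula (Fin 1), ∀ f, θ.Realize (fun _ => v f) ↔ f n = true) :
    ¬ StableIn T ℵ₀ := by
  intro hT
  have hA := hT M ∅ (by rw [mk_eq_zero]; exact zero_le)
  let F : (ℕ → Bool) → (L[[(∅ : Set M)]].completeTheory M).CompleteType (Fin 1) := fun f =>
    Theory.typeOf _ (fun _ => v f)
  have hF : F.Injective := by
    intro f f' hff
    funext n
    obtain ⟨θ, hθ⟩ := h n
    have key (f) : Formula.equivSentence ((L.lhomWithConstants (∅ : Set M)).onFormula θ) ∈ F f ↔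
        f n = true := by
      rw [CompleteType.formula_mem_typeOf, LHom.realize_onFormula]
      exact hθ f
    exact Bool.eq_iff_iff.2 (by rw [← key f, ← key f', hff])
  have h1 := (mk_le_of_injective hF).trans hA
  have h2 : #(ℕ → Bool) = 𝔠 := by simp
  rw [h2] at h1
  exact absurd h1 (not_le.2 aleph0_lt_continuum)

end FOComplexity

-- The large model and its first-order distinguishable roots

namespace TreeTheory

/-- Disjointness makes the level a partial function, and existence and uniqueness of predecessors
make the parent a function. The parent is set to the element itself where there is no predecessor.
-/
theorem exists_tree {W : Type} {lv : ℕ → W → Prop} {bl : ℕ → W → W → Prop}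
    (h1 : ∀ i j, i ≠ j → ∀ x, ¬ (lv i x ∧ lv j x))
    (h2 : ∀ i x y, bl i x y → lv i x ∧ lv (i + 1) y)
    (h3 : ∀ i x, lv (i + 1) x → ∃ y, lv i y ∧ bl i y x)
    (h4 : ∀ i x y z, bl i x z → bl i y z → x = y) :
    ∃ (lev : W → Option ℕ) (par : W → W),
      (∀ k x, lev x = some k ↔ lv k x) ∧
      (∀ k x y, bl k x y ↔ lev y = some (k + 1) ∧ par y = x) ∧
      (∀ k x, lev x = some (k + 1) → lev (par x) = some k) ∧
      (∀ x, (∀ k, lev x ≠ some (k + 1)) → par x = x) := by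
  have hlev : ∀ x : W, ∃ o : Option ℕ, ∀ k, o = some k ↔ lv k x := by
    intro x
    by_cases hx : ∃ k, lv k x
    · obtain ⟨k, hk⟩ := hx
      refine ⟨some k, fun l => ⟨?_, fun hl => ?_⟩⟩
      · rintro ⟨⟩
        exact hk
      · by_contra hne
        exact h1 k l (fun e => hne (congrArg _ e)) x ⟨hk, hl⟩
    · exact ⟨none, fun k => iff_of_false (by simp) (fun hk => hx ⟨k, hk⟩)⟩
  choose lev hlev using hlev
  have hpar : ∀ x : W, ∃ y, (∀ k, lev x = some (k + 1) → bl k y x) ∧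
      ((∀ k, lev x ≠ some (k + 1)) → y = x) := by
    intro x
    by_cases hx : ∃ k, lev x = some (k + 1)
    · obtain ⟨k, hk⟩ := hx
      obtain ⟨y, -, hy⟩ := h3 k x ((hlev x _).1 hk)
      refine ⟨y, fun l hl => ?_, fun hne => absurd hk (hne k)⟩
      rw [hk] at hl
      obtain rfl : k = l := by simpa using hl
      exact hy
    · push Not at hx
      exact ⟨x, fun k hk => absurd hk (hx k), fun _ => rfl⟩
  choose par hpar hpar' using hpar
  refine ⟨lev, par, fun k x => hlev x k, fun k x y => ⟨fun hxy => ?_, ?_⟩, fun k x hx => ?_, hpar'⟩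
  · have hy := (hlev y _).2 (h2 k x y hxy).2
    exact ⟨hy, h4 k _ _ y (hpar y k hy) hxy⟩
  · rintro ⟨hy, rfl⟩
    exact hpar y k hy
  · exact (hlev _ _).2 (h2 k _ _ (hpar x k hx)).1

theorem FinModel.exists_tree (A : FinModel) :
    ∃ (lev : Fin A.card → Option ℕ) (par : Fin A.card → Fin A.card),
      (∀ k x, lev x = some k ↔ Structure.RelMap (levelSym k) ![x]) ∧
      (∀ k x y, Structure.RelMap (belowSym k) ![x, y] ↔ lev y = some (k + 1) ∧ par y = x) ∧
      (∀ k x, lev x = some (k + 1) → lev (par x) = some k) ∧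
      (∀ x, (∀ k, lev x ≠ some (k + 1)) → par x = x) := by
  obtain ⟨h1, h2, h3, h4⟩ := model_baseTheory_iff.1 A.isModel
  exact TreeTheory.exists_tree h1 h2 h3 h4

/-- The kinds of nodes of the large model. -/
inductive NodeKind : Type
  | root (f : ℕ → Bool) : NodeKind
  | mixed (n : ℕ) : NodeKind
  | pure (n : ℕ) : NodeKind

/-- The kinds of children of nodes of each kind; every kind of child is to occur infinitely
often. -/
def NodeKind.step : NodeKind → ℕ → Option NodeKind
  | root f, i => some (if f i then mixed i else pure i)
  | mixed 0, _ => none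
  | mixed (n + 1), i => some (if i = 0 then mixed n else pure n)
  -- For `n = 0` truncated subtraction gives `mixed 0`: a node of kind `pure 0` has leaves as
  -- children, whereas one of kind `mixed 0` is a leaf.
  | pure n, _ => some (mixed (n - 1))

/-- The kind of the node reached by a path in the tree given by `f`, if there is one. -/
def kindAt (f : ℕ → Bool) : List (ℕ × ℕ) → Option NodeKind
  | [] => some (.root f)
  -- The head of the list is the last step of the path, so that the parent is the tail. The second
  -- component of a step only numbers the copies of a child.
  | p :: l => (kindAt f l).bind fun s => s.step p.1

/-- Paths in the trees of the large model. -/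
abbrev TreePath : Type := (ℕ → Bool) × ℕ × List (ℕ × ℕ)

/-- The kind of the last node of a path. -/
def TreePath.kind (u : TreePath) : Option NodeKind := kindAt u.1 u.2.2

/-- The path without its last node. -/
def TreePath.tail (u : TreePath) : TreePath := (u.1, u.2.1, u.2.2.tail)

theorem kindAt_tail {f : ℕ → Bool} {l : List (ℕ × ℕ)} (h : (kindAt f l).isSome) :
    (kindAt f l.tail).isSome := by
  cases l with
  | nil => exact h
  | cons p l =>
    rw [kindAt] at h
    cases hl : kindAt f l with
    | none => simp [hl] at h
    | some s => simp [hl]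

/-- The carrier of the large model: the constants together with all paths. -/
abbrev BigModel : Type := Const ⊕ TreePath

/-- The constants carry the structure of the finite models. Sequences of steps that lead to no node
stay in the carrier as isolated elements of no level, which the axioms permit. -/
theorem exists_bigForest : ∃ D : Forest BigModel, (∀ c, D.pt c = .inl c) ∧
    (∀ u : TreePath, D.lev (.inr u) = if u.kind.isSome then some u.2.2.length else none) ∧
    (∀ u : TreePath, D.par (.inr u) = if u.kind.isSome then .inr u.tail else .inr u) ∧
    (∀ c, ∃ c', D.par (.inl c) = .inl c') := by
  choose lev par h1 h2 h3 h4 using fun i : FinIndex => (finModel i).exists_tree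
  refine ⟨{
    lev := Sum.elim (fun c => lev c.i c.a)
      (fun u => if u.kind.isSome then some u.2.2.length else none)
    par := Sum.elim (fun c => .inl ⟨c.i, c.j, par c.i c.a⟩)
      (fun u => if u.kind.isSome then .inr u.tail else .inr u)
    pt := .inl
    lev_par := ?_
    par_of_ne := ?_
    pt_inj := Sum.inl_injective
    lev_pt := fun c k => h1 c.i k c.a
    below_pt := ?_
    closed := ?_ }, fun _ => rfl, fun _ => rfl, fun _ => rfl, fun c => ⟨_, rfl⟩⟩
  · rintro k (c | ⟨f, j, l⟩) hx
    · exact h3 c.i k c.a hx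
    · simp only [Sum.elim_inr] at hx ⊢
      split_ifs at hx ⊢ with hk
      · cases l with
        | nil => simp at hx
        | cons p l =>
          have : TreePath.kind (TreePath.tail (f, j, p :: l)) = kindAt f l := rfl
          simp only [Sum.elim_inr, this, show (kindAt f l).isSome from kindAt_tail (l := p :: l) hk,
            if_true]
          change some l.length = some k
          simpa using hx
  · rintro (c | ⟨f, j, l⟩) hx
    · simp only [Sum.elim_inl] at hx ⊢
      rw [h4 c.i c.a hx]
    · simp only [Sum.elim_inr] at hx ⊢
      split_ifs at hx ⊢ with hk
      · cases l with
        | nil => rfl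
        | cons p l => exact absurd rfl (hx l.length)
      · rfl
  · intro k i j a b
    have := h2 i k a b
    simpa [ModelBelow] using this.symm
  · rintro i j a k (⟨i', j', b⟩ | u) _ hx
    · simp only [Sum.elim_inl, Sum.inl.injEq, Const.mk.injEq] at hx
      obtain ⟨rfl, rfl, -⟩ := hx
      exact ⟨b, rfl⟩
    · simp only [Sum.elim_inr] at hx
      split_ifs at hx

/-- The forest structure of the large model. -/
noncomputable def bigForest : Forest BigModel := exists_bigForest.choose

theorem bigForest_pt (c : Const) : bigForest.pt c = .inl c := exists_bigForest.choose_spec.1 c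

theorem bigForest_lev (u : TreePath) :
    bigForest.lev (.inr u) = if u.kind.isSome then some u.2.2.length else none :=
  exists_bigForest.choose_spec.2.1 u

theorem bigForest_par (u : TreePath) :
    bigForest.par (.inr u) = if u.kind.isSome then .inr u.tail else .inr u :=
  exists_bigForest.choose_spec.2.2.1 u

theorem bigForest_par_inl (c : Const) : ∃ c', bigForest.par (.inl c) = .inl c' :=
  exists_bigForest.choose_spec.2.2.2 c

/-- The parent of a constant is a constant, and paths without a kind have no level. So the children
of a path are its one-step extensions that have a kind. The property `Q` is included for rewriting
inside `Forest.IsMixed`. -/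
theorem exists_child_iff {f : ℕ → Bool} {j : ℕ} {l : List (ℕ × ℕ)} {s : NodeKind}
    (hs : kindAt f l = some s) (Q : BigModel → Prop) :
    (∃ y, bigForest.ch (.inr (f, j, l)) y ∧ Q y) ↔
      ∃ p : ℕ × ℕ, (s.step p.1).isSome ∧ Q (.inr (f, j, p :: l)) := by
  constructor
  · rintro ⟨c | ⟨f', j', l'⟩, ⟨⟨k, hk⟩, h⟩, hQ⟩
    · obtain ⟨c', hc'⟩ := bigForest_par_inl c
      rw [hc'] at h
      cases h
    · rw [bigForest_lev] at hk
      rw [bigForest_par] at h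
      split_ifs at hk h with hk'
      cases l' with
      | nil => simp at hk
      | cons p l' =>
        have e : ((f', j', l') : TreePath) = (f, j, l) := Sum.inr.inj h
        simp only [Prod.mk.injEq] at e
        obtain ⟨rfl, rfl, rfl⟩ := e
        refine ⟨p, ?_, hQ⟩
        simpa [TreePath.kind, kindAt, hs] using hk'
  · rintro ⟨p, hp, hQ⟩
    have hk : (TreePath.kind (f, j, p :: l)).isSome := by
      simpa [TreePath.kind, kindAt, hs] using hp
    refine ⟨_, ⟨⟨l.length, ?_⟩, ?_⟩, hQ⟩
    · rw [bigForest_lev, if_pos hk]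
      rfl
    · rw [bigForest_par, if_pos hk]
      rfl

/-- The property that distinguishes the nodes of kind `mixed n`. -/
def Forest.IsMixed {M : Type} (D : Forest M) : ℕ → M → Prop
  -- The conjunct `True` gives the shape to which `exists_child_iff` and
  -- `Presentation.exists_child_formula` apply.
  | 0, x => ¬ ∃ y, D.ch x y ∧ True
  | n + 1, x => (∃ y, D.ch x y ∧ D.IsMixed n y) ∧ ∃ y, D.ch x y ∧ ¬ D.IsMixed n y

/-- By induction, a node of kind `mixed (n + 1)` has children on which `IsMixed n` holds and others
on which it fails. On the children of any other node that is not a root this property is constant,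
or there are no children. -/
theorem isMixed_iff : ∀ (n : ℕ) {f : ℕ → Bool} (j : ℕ) {l : List (ℕ × ℕ)} {s : NodeKind},
    kindAt f l = some s → (∀ g, s ≠ .root g) →
    (bigForest.IsMixed n (.inr (f, j, l)) ↔ s = .mixed n) := by
  intro n
  induction n with
  | zero =>
    intro f j l s hs hroot
    rw [Forest.IsMixed, exists_child_iff hs]
    rcases s with g | ⟨_ | k⟩ | k
    · exact absurd rfl (hroot g)
    · simp [NodeKind.step]
    · simp [NodeKind.step]
    · simp [NodeKind.step]
  | succ n ih =>
    intro f j l s hs hroot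
    rw [Forest.IsMixed, exists_child_iff hs, exists_child_iff hs]
    have kind_cons {p : ℕ × ℕ} {t} (ht : s.step p.1 = some t) : kindAt f (p :: l) = some t := by
      simp [kindAt, hs, ht]
    rcases s with g | ⟨_ | k⟩ | k
    · exact absurd rfl (hroot g)
    · simp [NodeKind.step]
    · have hm (p : ℕ × ℕ) : bigForest.IsMixed n (.inr (f, j, p :: l)) ↔ p.1 = 0 ∧ k = n := by
        by_cases hp : p.1 = 0
        · rw [ih j (kind_cons (t := .mixed k) (by simp [NodeKind.step, hp])) (by simp)]
          simp [hp]
        · rw [ih j (kind_cons (t := .pure k) (by simp [NodeKind.step, hp])) (by simp)]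
          simp [hp]
      simp only [hm]
      constructor
      · rintro ⟨⟨p, -, -, rfl⟩, -⟩
        rfl
      · intro h
        cases h
        exact ⟨⟨(0, 0), by simp [NodeKind.step]⟩, ⟨(1, 0), by simp [NodeKind.step]⟩⟩
    · have hm (p : ℕ × ℕ) : bigForest.IsMixed n (.inr (f, j, p :: l)) ↔ k - 1 = n := by
        rw [ih j (kind_cons (t := .mixed (k - 1)) (by simp [NodeKind.step])) (by simp)]
        simp
      simp only [hm]
      constructor
      · rintro ⟨⟨_, _, h1⟩, ⟨_, _, h2⟩⟩
        exact absurd h1 h2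
      · intro h
        cases h

/-- The root of the first tree given by `f`. -/
def rootOf (f : ℕ → Bool) : BigModel := .inr (f, 0, [])

theorem exists_isMixed_iff (f : ℕ → Bool) (n : ℕ) :
    (∃ y, bigForest.ch (rootOf f) y ∧ bigForest.IsMixed n y) ↔ f n = true := by
  rw [rootOf, exists_child_iff (s := .root f) rfl]
  have hk (p : ℕ × ℕ) : kindAt f [p] = some (if f p.1 then .mixed p.1 else .pure p.1) := by
    simp [kindAt, NodeKind.step]
  have hm (p : ℕ × ℕ) : bigForest.IsMixed n (.inr (f, 0, [p])) ↔ f p.1 = true ∧ p.1 = n := by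
    rw [isMixed_iff n 0 (hk p) (by intro g; split_ifs <;> simp)]
    split_ifs with h <;> simp [h]
  simp only [hm]
  constructor
  · rintro ⟨p, -, h, rfl⟩
    exact h
  · intro h
    exact ⟨(n, 0), by simp [NodeKind.step], h, rfl⟩

variable {code : FinIndex × ℕ → ℕ} {L : FirstOrder.Language.{0, 0}} {T : L.Theory}

/-- The level `k` must be known in advance: the child relation is spread over infinitely many
symbols, and on level `k` only `<ₖ` is needed. -/
theorem Presentation.exists_child_formula (P : Presentation code L T) (k : ℕ) (ψ : L.Formula (Fin 1)) :
    ∃ θ : L.Formula (Fin 1), ∀ {M : Type} {s : L.Structure M} {D : Forest M}, P.Rep s D →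
      ∀ x, D.lev x = some k →
        (θ.Realize (fun _ => x) ↔ ∃ y, D.ch x y ∧ ψ.Realize (fun _ => y)) := by
  obtain ⟨β, hβ⟩ := P.child k
  refine ⟨(BoundedFormula.relabel (n := 1) ![Sum.inl (0 : Fin 1), Sum.inr 0] β ⊓
    BoundedFormula.relabel (n := 1) (fun _ : Fin 1 => (Sum.inr 0 : Fin 1 ⊕ Fin 1)) ψ).ex, ?_⟩
  intro M s D hs x hx
  rw [Formula.Realize, BoundedFormula.realize_ex]
  refine exists_congr fun y => ?_
  rw [BoundedFormula.realize_inf, BoundedFormula.realize_relabel, BoundedFormula.realize_relabel]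
  have h1 : (D.lev y = some (k + 1) ∧ D.par y = x) ↔ D.ch x y :=
    ⟨fun h => ⟨⟨k, h.1⟩, h.2⟩, fun h => ⟨D.ch_lev h hx, h.2⟩⟩
  rw [← h1]
  refine and_congr (Iff.trans ?_ (hβ hs ![x, y])) ?_
  · refine iff_of_eq (congrArg₂ _ ?_ (Subsingleton.elim _ _))
    funext i
    fin_cases i <;> simp [Fin.snoc]
  · refine iff_of_eq (congrArg₂ _ ?_ (Subsingleton.elim _ _))
    funext i
    simp [Fin.snoc]

theorem Presentation.exists_isMixed_formula (P : Presentation code L T) : ∀ n k : ℕ,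
    ∃ θ : L.Formula (Fin 1), ∀ {M : Type} {s : L.Structure M} {D : Forest M}, P.Rep s D →
      ∀ x, D.lev x = some k → (θ.Realize (fun _ => x) ↔ D.IsMixed n x) := by
  intro n
  induction n with
  | zero =>
    intro k
    obtain ⟨θ, hθ⟩ := P.exists_child_formula k ⊤
    refine ⟨∼θ, fun hs x hx => ?_⟩
    rw [Formula.realize_not, hθ hs x hx]
    simp [Forest.IsMixed]
  | succ n ih =>
    intro k
    obtain ⟨ψ, hψ⟩ := ih (k + 1)
    obtain ⟨θ, hθ⟩ := P.exists_child_formula k ψ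
    obtain ⟨θ', hθ'⟩ := P.exists_child_formula k (∼ψ)
    refine ⟨θ ⊓ θ', fun {M s D} hs x hx => ?_⟩
    rw [Formula.realize_inf, hθ hs x hx, hθ' hs x hx, Forest.IsMixed]
    have key {y} (hy : D.ch x y) := hψ hs y (D.ch_lev hy hx)
    refine and_congr (exists_congr fun y => and_congr_right fun hy => key hy)
      (exists_congr fun y => and_congr_right fun hy => ?_)
    rw [Formula.realize_not, key hy]

/-- A formula that recovers `f n` from the root of the tree given by `f`. -/
theorem Presentation.exists_rootOf_formula (P : Presentation code L T) (n : ℕ) :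
    ∃ θ : L.Formula (Fin 1), ∀ {s : L.Structure BigModel}, P.Rep s bigForest →
      ∀ f, θ.Realize (fun _ => rootOf f) ↔ f n = true := by
  obtain ⟨ψ, hψ⟩ := P.exists_isMixed_formula n 1
  obtain ⟨θ, hθ⟩ := P.exists_child_formula 0 ψ
  refine ⟨θ, fun {s} hs f => ?_⟩
  have hlev : bigForest.lev (rootOf f) = some 0 := by
    rw [rootOf, bigForest_lev]
    rfl
  rw [hθ hs _ hlev, ← exists_isMixed_iff]
  exact exists_congr fun y => and_congr_right fun hy => hψ hs y (bigForest.ch_lev hy hlev)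

instance : Nonempty BigModel := ⟨rootOf fun _ => true⟩

theorem Presentation.not_stableIn (P : Presentation code L T) : ¬ FOComplexity.StableIn T ℵ₀ := by
  obtain ⟨s, hs⟩ := P.exists_structure bigForest
  have hM : BigModel ⊨ T := P.models hs
  refine FOComplexity.not_stableIn_aleph0 (ModelType.of T BigModel) rootOf fun n => ?_
  obtain ⟨θ, hθ⟩ := P.exists_rootOf_formula n
  exact ⟨θ, hθ hs⟩

-- The `∀ₙ`-game on the large model and unbounded types

/-- The tree of kind `s` satisfies at most the `∀ₙ`-formulas that the tree of kind `t` satisfies. -/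
inductive NodeKind.Le (n : ℕ) : NodeKind → NodeKind → Prop
  | mixed (k : ℕ) : Le n (.mixed k) (.mixed k)
  | pure (k : ℕ) : Le n (.pure k) (.pure k)
  -- The bounds differ by one because a child of `pure k` has an exact counterpart in `mixed k`,
  -- while a child `pure (k - 1)` of `mixed k` can only be answered in `pure k` by `mixed (k - 1)`.
  -- This returns to the present case with `k - 1` in place of `k`.
  | mixed_pure {k : ℕ} (h : n ≤ k) : Le n (.mixed k) (.pure k)
  | pure_mixed {k : ℕ} (h : n + 1 ≤ k) : Le n (.pure k) (.mixed k)
  | root {f g : ℕ → Bool} (h : ∀ i, f i = g i ∨ (f i = true ∧ n ≤ i) ∨ (g i = true ∧ n + 1 ≤ i)) :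
      Le n (.root f) (.root g)

theorem NodeKind.Le.refl (n : ℕ) : ∀ s : NodeKind, NodeKind.Le n s s
  | .root _ => .root fun _ => Or.inl rfl
  | .mixed k => .mixed k
  | .pure k => .pure k

theorem NodeKind.Le.flip {n : ℕ} {s t : NodeKind} (h : NodeKind.Le (n + 1) s t) :
    NodeKind.Le n t s := by
  cases h with
  | mixed k => exact .mixed k
  | pure k => exact .pure k
  | mixed_pure h => exact .pure_mixed h
  | pure_mixed h => exact .mixed_pure (by omega)
  | root h =>
    refine .root fun i => ?_
    rcases h i with h | h | h
    · exact Or.inl h.symm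
    · exact Or.inr (Or.inr h)
    · exact Or.inr (Or.inl ⟨h.1, by omega⟩)

/-- A child chosen on the right is answered on the left with the same index, since the position
inside a quantifier block is not spent. The inequalities `n + 1 ≤ k` and `n + 2 ≤ k` leave enough
height for the answer `mixed (k - 1)`. -/
theorem NodeKind.Le.step {n : ℕ} {s t : NodeKind} (h : NodeKind.Le (n + 1) s t) {i : ℕ}
    {t' : NodeKind} (ht : t.step i = some t') :
    ∃ i' s', s.step i' = some s' ∧ NodeKind.Le (n + 1) s' t' := by
  cases h with
  | mixed k => exact ⟨i, t', ht, .refl _ _⟩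
  | pure k => exact ⟨i, t', ht, .refl _ _⟩
  | @mixed_pure k h =>
    obtain ⟨k, rfl⟩ : ∃ l, k = l + 1 := ⟨k - 1, by omega⟩
    simp only [NodeKind.step, Option.some.injEq] at ht
    subst ht
    exact ⟨0, .mixed k, by simp [NodeKind.step], .mixed k⟩
  | @pure_mixed k h =>
    obtain ⟨k, rfl⟩ : ∃ l, k = l + 1 := ⟨k - 1, by omega⟩
    simp only [NodeKind.step, Option.some.injEq] at ht
    subst ht
    refine ⟨0, .mixed k, by simp [NodeKind.step], ?_⟩
    split_ifs
    · exact .mixed k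
    · exact .mixed_pure (by omega)
  | @root f g h =>
    simp only [NodeKind.step, Option.some.injEq] at ht
    subst ht
    refine ⟨i, _, rfl, ?_⟩
    rcases h i with h | h | h
    · rw [h]
      exact .refl _ _
    · rw [if_pos h.1]
      split_ifs
      · exact .mixed i
      · exact .mixed_pure h.2
    · rw [if_pos h.1]
      split_ifs
      · exact .mixed i
      · exact .pure_mixed h.2

/-- Finite partial isomorphisms between trees of the large model that respect `NodeKind.Le`. -/
structure Matching (n : ℕ) (G : Finset (TreePath × TreePath)) : Prop where
  inj : ∀ p ∈ G, ∀ q ∈ G, p.1 = q.1 ↔ p.2 = q.2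
  kind : ∀ p ∈ G, ∃ s t, p.1.kind = some s ∧ p.2.kind = some t ∧ NodeKind.Le n s t
  length : ∀ p ∈ G, p.1.2.2.length = p.2.2.2.length
  tail : ∀ p ∈ G, (p.1.tail, p.2.tail) ∈ G

theorem Matching.flip {n : ℕ} {G : Finset (TreePath × TreePath)} (h : Matching (n + 1) G) :
    Matching n (Converse G) where
  inj := by
    rintro ⟨a, b⟩ hp ⟨c, d⟩ hq
    exact (h.inj _ (mem_converse.1 hp) _ (mem_converse.1 hq)).symm
  kind := by
    rintro ⟨a, b⟩ hp
    obtain ⟨s, t, h1, h2, h3⟩ := h.kind _ (mem_converse.1 hp)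
    exact ⟨t, s, h2, h1, h3.flip⟩
  length := by
    rintro ⟨a, b⟩ hp
    exact (h.length _ (mem_converse.1 hp)).symm
  tail := by
    rintro ⟨a, b⟩ hp
    exact mem_converse.2 (h.tail _ (mem_converse.1 hp))

theorem Matching.insert_pair [DecidableEq (TreePath × TreePath)] {n : ℕ}
    {G : Finset (TreePath × TreePath)} (h : Matching n G)
    {u w : TreePath} (hu : ∀ p ∈ G, p.1 ≠ u) (hw : ∀ p ∈ G, p.2 ≠ w) {s t : NodeKind}
    (hs : u.kind = some s) (ht : w.kind = some t) (hst : NodeKind.Le n s t)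
    (hlen : u.2.2.length = w.2.2.length) (htail : (u.tail, w.tail) ∈ insert (u, w) G) :
    Matching n (insert (u, w) G) where
  inj := by
    intro p hp q hq
    rcases Finset.mem_insert.1 hp with rfl | hp' <;> rcases Finset.mem_insert.1 hq with rfl | hq'
    · simp
    · exact iff_of_false (fun e => hu _ hq' e.symm) (fun e => hw _ hq' e.symm)
    · exact iff_of_false (fun e => hu _ hp' e) (fun e => hw _ hp' e)
    · exact h.inj p hp' q hq'
  kind := by
    intro p hp
    rcases Finset.mem_insert.1 hp with rfl | hp'
    · exact ⟨s, t, hs, ht, hst⟩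
    · exact h.kind p hp'
  length := by
    intro p hp
    rcases Finset.mem_insert.1 hp with rfl | hp'
    · exact hlen
    · exact h.length p hp'
  tail := by
    intro p hp
    rcases Finset.mem_insert.1 hp with rfl | hp'
    · exact htail
    · exact Finset.mem_insert_of_mem (h.tail p hp')

theorem exists_fresh_path (G : Finset (TreePath × TreePath)) {F : ℕ → TreePath}
    (hF : F.Injective) : ∃ j, ∀ p ∈ G, p.1 ≠ F j := by
  classical
  obtain ⟨x, ⟨j, rfl⟩, hx⟩ := (Set.infinite_range_of_injective hF).exists_notMem_finset
    (G.image Prod.fst)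
  exact ⟨j, fun p hp e => hx (Finset.mem_image.2 ⟨p, hp, e⟩)⟩

/-- The initial part of the path is matched first, by induction. `NodeKind.Le.step` then gives the
kind of the answer, and since each kind of child occurs infinitely often, some copy of it is not yet
used by the finite matching. -/
theorem Matching.back {n : ℕ} {G : Finset (TreePath × TreePath)} (h : Matching (n + 1) G)
    (f : ℕ → Bool) (j : ℕ) : ∀ l : List (ℕ × ℕ), (kindAt f l).isSome →
    ∃ G', G ⊆ G' ∧ Matching (n + 1) G' ∧ ∃ u, (u, ((f, j, l) : TreePath)) ∈ G' := by
  classical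
  intro l
  induction l with
  | nil =>
    intro _
    by_cases hm : ∃ u, (u, ((f, j, []) : TreePath)) ∈ G
    · exact ⟨G, subset_rfl, h, hm⟩
    push Not at hm
    obtain ⟨i, hi⟩ := exists_fresh_path G (F := fun i => (f, i, [])) (by
      intro i i' e
      simpa using e)
    exact ⟨insert ((f, i, []), (f, j, [])) G, Finset.subset_insert _ _,
      h.insert_pair hi (by rintro ⟨a, b⟩ hp rfl; exact hm a hp) rfl rfl (.refl _ _) rfl
        (Finset.mem_insert_self _ _), _, Finset.mem_insert_self _ _⟩
  | cons p l ih =>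
    intro hl
    obtain ⟨G₁, hsub, h₁, ⟨g, i, l'⟩, hu⟩ := ih (kindAt_tail hl)
    by_cases hm : ∃ u, (u, ((f, j, p :: l) : TreePath)) ∈ G₁
    · exact ⟨G₁, hsub, h₁, hm⟩
    push Not at hm
    obtain ⟨s, t, hs, ht, hst⟩ := h₁.kind _ hu
    change kindAt g l' = some s at hs
    change kindAt f l = some t at ht
    obtain ⟨t', ht'⟩ := Option.isSome_iff_exists.1 hl
    have ht'' : t.step p.1 = some t' := by simpa [kindAt, ht] using ht'
    obtain ⟨a, s', hs', hst'⟩ := hst.step ht''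
    obtain ⟨b, hb⟩ := exists_fresh_path G₁ (F := fun b => (g, i, (a, b) :: l')) (by
      intro b b' e
      simpa using e)
    refine ⟨insert ((g, i, (a, b) :: l'), (f, j, p :: l)) G₁,
      hsub.trans (Finset.subset_insert _ _),
      h₁.insert_pair hb (by rintro ⟨a, b⟩ hp rfl; exact hm a hp) (s := s') (t := t') ?_ ht' hst' ?_
        (Finset.mem_insert_of_mem hu), _, Finset.mem_insert_self _ _⟩
    · simp [TreePath.kind, kindAt, hs, hs']
    · simpa using h₁.length _ hu

/-- The elements of the large model outside of its trees. -/
def OffTree (x : BigModel) : Prop := ∀ u : TreePath, x = .inr u → u.kind = none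

/-- The relation on the large model given by a matching of trees. -/
def matchRel (G : Finset (TreePath × TreePath)) (x y : BigModel) : Prop :=
  (x = y ∧ OffTree x) ∨ ∃ p ∈ G, x = .inr p.1 ∧ y = .inr p.2

theorem OffTree.par {x : BigModel} (h : OffTree x) : OffTree (bigForest.par x) := by
  rcases x with c | u
  · obtain ⟨c', hc'⟩ := bigForest_par_inl c
    rw [hc']
    rintro u ⟨⟩
  · rw [bigForest_par, h u rfl]
    exact h

/-- Levels are lengths of paths and predecessors are tails, both of which a matching respects, and
the kinds are invisible to atomic formulas. All constants lie off the trees, where the relation is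
the identity, so there is no restriction on `d`. -/
theorem Matching.partialIso {n : ℕ} {G : Finset (TreePath × TreePath)} (h : Matching n G) (d : ℕ) :
    PartialIso code d bigForest bigForest (matchRel G) where
  inj := by
    rintro x y x' y' (⟨rfl, h1⟩ | ⟨p, hp, rfl, rfl⟩) (⟨rfl, h2⟩ | ⟨q, hq, rfl, rfl⟩)
    · rfl
    · obtain ⟨s, t, hs, ht, -⟩ := h.kind q hq
      constructor
      · rintro rfl
        exact absurd (h1 _ rfl) (by simp [hs])
      · rintro rfl
        exact absurd (h1 _ rfl) (by simp [ht])
    · obtain ⟨s, t, hs, ht, -⟩ := h.kind p hp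
      constructor
      · rintro rfl
        exact absurd (h2 _ rfl) (by simp [hs])
      · rintro rfl
        exact absurd (h2 _ rfl) (by simp [ht])
    · rw [Sum.inr.injEq, Sum.inr.injEq]
      exact h.inj p hp q hq
  lev := by
    rintro x y (⟨rfl, h1⟩ | ⟨p, hp, rfl, rfl⟩) k _
    · rfl
    · obtain ⟨s, t, hs, ht, -⟩ := h.kind p hp
      rw [bigForest_lev, bigForest_lev, hs, ht, h.length p hp]
      rfl
  par := by
    rintro x y (⟨rfl, h1⟩ | ⟨p, hp, rfl, rfl⟩) k _ _
    · exact Or.inl ⟨rfl, h1.par⟩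
    · obtain ⟨s, t, hs, ht, -⟩ := h.kind p hp
      rw [bigForest_par, bigForest_par, hs, ht]
      exact Or.inr ⟨_, h.tail p hp, rfl, rfl⟩
  pt c _ := by
    rw [bigForest_pt]
    exact Or.inl ⟨rfl, by rintro u ⟨⟩⟩

theorem Presentation.forallSystem (P : Presentation code L T) {s : L.Structure BigModel}
    (hs : P.Rep s bigForest) : FOComplexity.ForallSystem L
      (fun n E => ∃ G, Matching n G ∧ E = matchRel G)
      (fun n E => ∃ G, Matching n G ∧ E = matchRel G) where
  atomic := by
    rintro _ ⟨G, hG, rfl⟩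
    exact P.preservesAtomic hs hs fun d => hG.partialIso d
  flip := by
    rintro n _ ⟨G, hG, rfl⟩
    refine ⟨Converse G, hG.flip, ?_⟩
    funext y x
    refine propext (or_congr ⟨?_, ?_⟩ ⟨?_, ?_⟩)
    · rintro ⟨rfl, h⟩
      exact ⟨rfl, h⟩
    · rintro ⟨rfl, h⟩
      exact ⟨rfl, h⟩
    · rintro ⟨⟨a, b⟩, hp, rfl, rfl⟩
      exact ⟨(b, a), mem_converse.2 hp, rfl, rfl⟩
    · rintro ⟨⟨a, b⟩, hp, rfl, rfl⟩
      exact ⟨(b, a), mem_converse.1 hp, rfl, rfl⟩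
  back := by
    rintro n _ ⟨G, hG, rfl⟩ y
    by_cases hy : OffTree y
    · exact ⟨_, ⟨G, hG, rfl⟩, fun _ _ h => h, y, Or.inl ⟨rfl, hy⟩⟩
    · obtain ⟨⟨f, j, l⟩, rfl, hk⟩ : ∃ u : TreePath, y = .inr u ∧ u.kind ≠ none := by
        simpa [OffTree] using hy
      obtain ⟨G', hsub, hG', u, hu⟩ := hG.back f j l (Option.isSome_iff_ne_none.2 hk)
      refine ⟨_, ⟨G', hG', rfl⟩, ?_, .inr u, Or.inr ⟨_, hu, rfl, rfl⟩⟩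
      rintro a b (h | ⟨p, hp, h⟩)
      · exact Or.inl h
      · exact Or.inr ⟨p, hsub hp, h⟩

theorem Presentation.hasUnboundedTypes (P : Presentation code L T) :
    FOComplexity.HasUnboundedTypes T := by
  obtain ⟨s, hs⟩ := P.exists_structure bigForest
  have hM : BigModel ⊨ T := P.models hs
  refine ⟨1, T.typeOf (fun _ => rootOf fun _ => true), ?_⟩
  rintro ⟨n, S, hS, hST⟩
  obtain ⟨θ, hθ⟩ := P.exists_rootOf_formula n
  -- The roots for `true` and for `f` differ only in having children of kind `mixed n` or `pure n`,
  -- and `mixed n ≤ pure n` holds at index `n`. So the axioms `S` pass to the root of `f`, although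
  -- the formula `θ`, which belongs to the type, fails there.
  let f : ℕ → Bool := fun i => decide (i ≠ n)
  let p := T.typeOf (fun _ : Fin 1 => rootOf fun _ => true)
  have hmem (φ : L[[Fin 1]].Sentence) : φ ∈ p ↔ p.toTheory ⊨ᵇ φ := p.isMaximal.mem_iff_models φ
  have hmatch : Matching n {((fun _ => true, 0, []), (f, 0, []))} := by
    refine ⟨?_, ?_, ?_, ?_⟩
    · simp
    · intro q hq
      rw [Finset.mem_singleton.1 hq]
      refine ⟨_, _, rfl, rfl, .root fun i => ?_⟩
      by_cases hi : i = n
      · exact Or.inr (Or.inl ⟨rfl, hi.ge⟩)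
      · exact Or.inl (by simp [f, hi])
    · intro q hq
      rw [Finset.mem_singleton.1 hq]
    · intro q hq
      rw [Finset.mem_singleton.1 hq]
      simp [TreePath.tail]
  let _ : (constantsOn (Fin 1)).Structure BigModel := constantsOn.structure fun _ => rootOf f
  have hmodel : BigModel ⊨ S := by
    refine Theory.model_iff _ |>.2 fun φ hφ => ?_
    have h1 : φ ∈ p := by
      rw [hmem, ← hST]
      exact models_sentence_of_mem hφ
    refine (Formula.realize_equivSentence_symm BigModel φ fun _ => rootOf f).1 ?_
    exact (P.forallSystem hs).realize_equivSentence_symm (P.forallSystem hs) ⟨_, hmatch, rfl⟩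
      (fun _ => Or.inr ⟨_, Finset.mem_singleton_self _, rfl, rfl⟩) (hS φ hφ)
      (CompleteType.mem_typeOf.1 h1)
  have h1 : Formula.equivSentence θ ∈ p := CompleteType.formula_mem_typeOf.2 ((hθ hs _).2 rfl)
  rw [hmem, ← hST] at h1
  have h2 : BigModel ⊨ Formula.equivSentence θ := h1.realize_sentence BigModel
  have h3 := (Formula.realize_equivSentence_symm BigModel _ fun _ : Fin 1 => rootOf f).2 h2
  rw [Equiv.symm_apply_apply, hθ hs] at h3
  simp [f] at h3

end TreeTheory

/-! ## The three presentations -/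

namespace TreeTheory

/-- The common content of the axioms of the three theories, in terms of levels, `<ₖ` and
constants. -/
structure MarkedTree {M : Type} (lv : ℕ → M → Prop) (bl : ℕ → M → M → Prop) (pt : Const → M) :
    Prop where
  disj : ∀ i j, i ≠ j → ∀ x, ¬ (lv i x ∧ lv j x)
  bl_lv : ∀ i x y, bl i x y → lv i x ∧ lv (i + 1) y
  ex : ∀ i x, lv (i + 1) x → ∃ y, lv i y ∧ bl i y x
  uniq : ∀ i x y z, bl i x z → bl i y z → x = y
  ne : ∀ c d, c ≠ d → pt c ≠ pt d
  lv_pt : ∀ k i j a, ModelLevel k i a → lv k (pt ⟨i, j, a⟩)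
  not_lv_pt : ∀ k i j a, ¬ ModelLevel k i a → ¬ lv k (pt ⟨i, j, a⟩)
  bl_pt : ∀ k i j a b, ModelBelow k i a b → bl k (pt ⟨i, j, a⟩) (pt ⟨i, j, b⟩)
  not_bl_pt : ∀ k i j a b, ¬ ModelBelow k i a b → ¬ bl k (pt ⟨i, j, a⟩) (pt ⟨i, j, b⟩)
  closed : ∀ k i j a x, bl k (pt ⟨i, j, a⟩) x ∨ bl k x (pt ⟨i, j, a⟩) → ∃ b, x = pt ⟨i, j, b⟩

theorem MarkedTree.exists_forest {M : Type} {lv : ℕ → M → Prop} {bl : ℕ → M → M → Prop}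
    {pt : Const → M} (h : MarkedTree lv bl pt) : ∃ D : Forest M,
      (∀ k x, lv k x ↔ D.lev x = some k) ∧
      (∀ k x y, bl k x y ↔ D.lev y = some (k + 1) ∧ D.par y = x) ∧ ∀ c, pt c = D.pt c := by
  obtain ⟨lev, par, h1, h2, h3, h4⟩ := exists_tree h.disj h.bl_lv h.ex h.uniq
  refine ⟨⟨lev, par, pt, h3 _ _, h4 _, ?_, ?_, ?_, ?_⟩, fun k x => (h1 k x).symm, h2,
    fun _ => rfl⟩
  · intro c d hcd
    by_contra hne
    exact h.ne c d hne hcd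
  · intro c k
    rw [h1]
    exact ⟨fun hc => by_contra fun hn => h.not_lv_pt k _ _ _ hn hc, h.lv_pt k _ _ _⟩
  · intro k i j a b
    rw [← h2]
    exact ⟨fun hc => by_contra fun hn => h.not_bl_pt k _ _ _ _ hn hc, h.bl_pt k _ _ _ _⟩
  · intro i j a k x hx hx'
    exact h.closed k i j a x (Or.inl ((h2 _ _ _).2 ⟨hx, hx'⟩))

theorem Forest.markedTree {M : Type} (D : Forest M) {lv : ℕ → M → Prop} {bl : ℕ → M → M → Prop}
    {pt : Const → M} (h1 : ∀ k x, lv k x ↔ D.lev x = some k)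
    (h2 : ∀ k x y, bl k x y ↔ D.lev y = some (k + 1) ∧ D.par y = x) (h3 : ∀ c, pt c = D.pt c) :
    MarkedTree lv bl pt := by
  obtain rfl : pt = D.pt := funext h3
  simp only [← h1] at h2
  constructor
  · intro i j hij x hx
    rw [h1, h1] at hx
    exact hij (Option.some.inj (hx.1.symm.trans hx.2))
  · intro i x y hxy
    rw [h2] at hxy
    refine ⟨?_, hxy.1⟩
    rw [h1, ← hxy.2]
    exact D.lev_par ((h1 _ _).1 hxy.1)
  · intro i x hx
    exact ⟨D.par x, (h1 _ _).2 (D.lev_par ((h1 _ _).1 hx)), (h2 _ _ _).2 ⟨hx, rfl⟩⟩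
  · intro i x y z hx hy
    exact ((h2 _ _ _).1 hx).2.symm.trans ((h2 _ _ _).1 hy).2
  · intro c d hcd h
    exact hcd (D.pt_inj h)
  · intro k i j a h
    exact (h1 _ _).2 ((D.lev_pt _ _).2 h)
  · intro k i j a h h'
    exact h ((D.lev_pt _ _).1 ((h1 _ _).1 h'))
  · intro k i j a b h
    rw [h2, h1]
    exact (D.below_pt k i j a b).2 h
  · intro k i j a b h h'
    rw [h2, h1] at h'
    exact h ((D.below_pt k i j a b).1 h')
  · rintro k i j a x (h | h)
    · rw [h2, h1] at h
      exact D.closed i j a k x h.1 h.2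
    -- A forest only records that children of constants are constants. For predecessors it follows
    -- from uniqueness, as `𝓜ᵢ` already contains one.
    · rw [h2, h1] at h
      obtain ⟨b, -, hb⟩ := D.par_pt h.1
      exact ⟨b, h.2.symm.trans hb⟩

/-- The relation of level `k` in a structure with constants. -/
def lvC {M : Type} [constLang.Structure M] (k : ℕ) (x : M) : Prop :=
  Structure.RelMap ((treeLang.lhomWithConstants Const).onRelation (levelSym k)) ![x]

/-- The relation `<ₖ` in a structure with constants. -/
def blC {M : Type} [constLang.Structure M] (k : ℕ) (x y : M) : Prop :=
  Structure.RelMap ((treeLang.lhomWithConstants Const).onRelation (belowSym k)) ![x, y]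

/-- The interpretation of the constant `c`. -/
def ptC (M : Type) [constLang.Structure M] (c : Const) : M := (treeLang.con c : M)

/-- The relation of level `k` in a structure with predecessor functions. -/
def lvF {M : Type} [predLang.Structure M] (k : ℕ) (x : M) : Prop :=
  Structure.RelMap ((predBase.lhomWithConstants Const).onRelation (levelSymF k)) ![x]

/-- The function `Predₖ`. -/
def prF {M : Type} [predLang.Structure M] (k : ℕ) (x : M) : M :=
  Structure.funMap ((predBase.lhomWithConstants Const).onFunction (predSym k)) ![x]

/-- The interpretation of the constant `c`. -/
def ptF (M : Type) [predLang.Structure M] (c : Const) : M := (predBase.con c : M)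

/-- The relation of level `k` in a structure with marks. -/
def lvR {M : Type} [markLang.Structure M] (k : ℕ) (x : M) : Prop :=
  Structure.RelMap ((LHom.sumInl : treeLang →ᴸ markLang).onRelation (levelSym k)) ![x]

/-- The relation `<ₖ` in a structure with marks. -/
def blR {M : Type} [markLang.Structure M] (k : ℕ) (x y : M) : Prop :=
  Structure.RelMap ((LHom.sumInl : treeLang →ᴸ markLang).onRelation (belowSym k)) ![x, y]

/-- The predicate `U_c`. -/
def mkR {M : Type} [markLang.Structure M] (c : Const) (x : M) : Prop :=
  Structure.RelMap ((LHom.sumInr : markBase →ᴸ markLang).onRelation (markSym c)) ![x]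

section Realize

variable {M α : Type} {n : ℕ} {v : α → M} {xs : Fin n → M}

theorem realize_inLevelC [constLang.Structure M] {k : ℕ} {t : constLang.Term (α ⊕ Fin n)} :
    (inLevelC k t).Realize v xs ↔ lvC k (t.realize (Sum.elim v xs)) :=
  BoundedFormula.realize_rel₁

theorem realize_isBelowC [constLang.Structure M] {k : ℕ} {s t : constLang.Term (α ⊕ Fin n)} :
    (isBelowC k s t).Realize v xs ↔
      blC k (s.realize (Sum.elim v xs)) (t.realize (Sum.elim v xs)) :=
  BoundedFormula.realize_rel₂

theorem realize_cst [constLang.Structure M] {c : Const} {w : α ⊕ Fin n → M} :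
    (cst c).realize w = ptC M c :=
  Term.realize_constants

theorem realize_inLevelF [predLang.Structure M] {k : ℕ} {t : predLang.Term (α ⊕ Fin n)} :
    (inLevelF k t).Realize v xs ↔ lvF k (t.realize (Sum.elim v xs)) :=
  BoundedFormula.realize_rel₁

theorem realize_predF [predLang.Structure M] {k : ℕ} {t : predLang.Term (α ⊕ Fin n)}
    {w : α ⊕ Fin n → M} : (predF k t).realize w = prF k (t.realize w) :=
  Term.realize_functions_apply₁

theorem realize_cstF [predLang.Structure M] {c : Const} {w : α ⊕ Fin n → M} :
    (cstF c).realize w = ptF M c :=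
  Term.realize_constants

theorem realize_isBelowF [predLang.Structure M] {k : ℕ} {s t : predLang.Term (α ⊕ Fin n)} :
    (isBelowF k s t).Realize v xs ↔ lvF (k + 1) (t.realize (Sum.elim v xs)) ∧
      prF k (t.realize (Sum.elim v xs)) = s.realize (Sum.elim v xs) := by
  rw [isBelowF, BoundedFormula.realize_inf, realize_inLevelF, BoundedFormula.realize_bdEqual,
    realize_predF]

theorem realize_inLevelR [markLang.Structure M] {k : ℕ} {t : markLang.Term (α ⊕ Fin n)} :
    (inLevelR k t).Realize v xs ↔ lvR k (t.realize (Sum.elim v xs)) :=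
  BoundedFormula.realize_rel₁

theorem realize_isBelowR [markLang.Structure M] {k : ℕ} {s t : markLang.Term (α ⊕ Fin n)} :
    (isBelowR k s t).Realize v xs ↔
      blR k (s.realize (Sum.elim v xs)) (t.realize (Sum.elim v xs)) :=
  BoundedFormula.realize_rel₂

theorem realize_isMark [markLang.Structure M] {c : Const} {t : markLang.Term (α ⊕ Fin n)} :
    (isMark c t).Realize v xs ↔ mkR c (t.realize (Sum.elim v xs)) :=
  BoundedFormula.realize_rel₁

end Realize

/-- Together with `forall_of_and_iff` this lets `simp` turn a set of axioms indexed by parameters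
into a statement quantified over the parameters. -/
theorem forall_of_exists_iff {α β : Type*} {Q : α → β → Prop} {R : β → Prop} :
    (∀ b, (∃ a, Q a b) → R b) ↔ ∀ a, ∀ b, Q a b → R b :=
  ⟨fun h a b hab => h b ⟨a, hab⟩, fun h b ⟨a, hab⟩ => h a b hab⟩

theorem forall_of_and_iff {β : Type*} {P : Prop} {Q R : β → Prop} :
    (∀ b, (P ∧ Q b) → R b) ↔ (P → ∀ b, Q b → R b) :=
  ⟨fun h p b hb => h b ⟨p, hb⟩, fun h b ⟨p, hb⟩ => h p b hb⟩

theorem snoc_one {M : Type} (x : M) :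
    (Fin.snoc (default : Fin 0 → M) x : Fin 1 → M) 0 = x := rfl

theorem snoc_two_zero {M : Type} (x y : M) :
    (Fin.snoc (Fin.snoc (default : Fin 0 → M) x : Fin 1 → M) y : Fin 2 → M) 0 = x := rfl

theorem snoc_two_one {M : Type} (x y : M) :
    (Fin.snoc (Fin.snoc (default : Fin 0 → M) x : Fin 1 → M) y : Fin 2 → M) 1 = y := rfl

theorem model_constTheory_iff {M : Type} [constLang.Structure M] :
    M ⊨ constTheory ↔ MarkedTree (M := M) lvC blC (ptC M) := by
  let _ := (treeLang.lhomWithConstants Const).reduct M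
  have := LHom.isExpansionOn_reduct (treeLang.lhomWithConstants Const) M
  rw [constTheory]
  simp only [Theory.model_union_iff, LHom.onTheory_model, model_baseTheory_iff]
  simp only [Theory.model_iff, Set.mem_ofPred_eq, forall_of_exists_iff, forall_of_and_iff,
    forall_eq]
  simp only [Sentence.Realize, Formula.Realize, BoundedFormula.realize_all,
    BoundedFormula.realize_imp, BoundedFormula.realize_not, BoundedFormula.realize_sup,
    BoundedFormula.realize_bdEqual, BoundedFormula.realize_iSup, realize_cst, realize_inLevelC,
    realize_isBelowC, Function.comp_apply, Term.realize_var, Sum.elim_inr, snoc_one]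
  constructor
  · rintro ⟨⟨⟨⟨⟨⟨⟨h1, h2, h3, h4⟩, h5⟩, h6⟩, h7⟩, h8⟩, h9⟩, h10⟩
    exact ⟨h1, h2, h3, h4, h5, h6, h7, h8, h9, h10⟩
  · rintro ⟨h1, h2, h3, h4, h5, h6, h7, h8, h9, h10⟩
    exact ⟨⟨⟨⟨⟨⟨⟨h1, h2, h3, h4⟩, h5⟩, h6⟩, h7⟩, h8⟩, h9⟩, h10⟩

/-- Uniqueness of predecessors is automatic for a function. The extra clause fixes the values of
`Predₖ` off level `k + 1`, which the forest does not see. -/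
theorem model_predTheory_iff {M : Type} [predLang.Structure M] :
    M ⊨ predTheory ↔
      MarkedTree (M := M) lvF (fun k x y => lvF (k + 1) y ∧ prF k y = x) (ptF M) ∧
        ∀ k (x : M), ¬ lvF (k + 1) x → prF k x = x := by
  rw [predTheory]
  simp only [Theory.model_union_iff]
  simp only [Theory.model_iff, Set.mem_ofPred_eq, forall_of_exists_iff, forall_of_and_iff,
    forall_eq]
  simp only [Sentence.Realize, Formula.Realize, BoundedFormula.realize_all,
    BoundedFormula.realize_imp, BoundedFormula.realize_not, BoundedFormula.realize_sup,
    BoundedFormula.realize_inf, BoundedFormula.realize_bdEqual, BoundedFormula.realize_iSup,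
    realize_cstF, realize_inLevelF, realize_predF,
    realize_isBelowF, Function.comp_apply, Term.realize_var, Sum.elim_inr, snoc_one]
  constructor
  · rintro ⟨⟨⟨⟨⟨⟨⟨⟨h1, h2⟩, h3⟩, h4⟩, h5⟩, h6⟩, h7⟩, h8⟩, h9⟩
    refine ⟨⟨h1, ?_, ?_, ?_, h4, h5, h6, h7, h8, h9⟩, h3⟩
    · rintro i x y ⟨hy, rfl⟩
      exact ⟨h2 i y hy, hy⟩
    · intro i x hx
      exact ⟨_, h2 i x hx, hx, rfl⟩
    · rintro i x y z ⟨_, rfl⟩ ⟨_, rfl⟩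
      rfl
  · rintro ⟨⟨h1, h2, -, -, h4, h5, h6, h7, h8, h9⟩, h3⟩
    exact ⟨⟨⟨⟨⟨⟨⟨⟨h1, fun k x hx => (h2 k _ x ⟨hx, rfl⟩).1⟩, h3⟩, h4⟩, h5⟩, h6⟩, h7⟩, h8⟩, h9⟩

theorem model_markTheory_iff {M : Type} [markLang.Structure M] :
    M ⊨ markTheory ↔ ∃ pt : Const → M, (∀ c (x : M), mkR c x ↔ x = pt c) ∧
      MarkedTree (M := M) lvR blR pt := by
  let _ := (LHom.sumInl : treeLang →ᴸ markLang).reduct M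
  have := LHom.isExpansionOn_reduct (LHom.sumInl : treeLang →ᴸ markLang) M
  rw [markTheory]
  simp only [Theory.model_union_iff, LHom.onTheory_model, model_baseTheory_iff]
  simp only [Theory.model_iff, Set.mem_ofPred_eq, forall_of_exists_iff, forall_of_and_iff,
    forall_eq]
  simp only [Sentence.Realize, Formula.Realize, BoundedFormula.realize_all,
    BoundedFormula.realize_imp, BoundedFormula.realize_not, BoundedFormula.realize_sup,
    BoundedFormula.realize_inf, BoundedFormula.realize_ex,
    BoundedFormula.realize_bdEqual, BoundedFormula.realize_iSup, realize_isMark, realize_inLevelR,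
    realize_isBelowR, Function.comp_apply, Term.realize_var, Sum.elim_inr, snoc_one,
    snoc_two_zero, snoc_two_one]
  constructor
  · rintro ⟨⟨⟨⟨⟨⟨⟨⟨⟨h1, h2, h3, h4⟩, e⟩, u⟩, h5⟩, h6⟩, h7⟩, h8⟩, h9⟩, h10⟩
    choose pt hpt using e
    have hiff : ∀ c x, mkR c x ↔ x = pt c :=
      fun c x => ⟨fun h => u c x _ ⟨h, hpt c⟩, fun h => h ▸ hpt c⟩
    refine ⟨pt, hiff, h1, h2, h3, h4, ?_, fun k i j a h => h6 k i j a h _ (hpt _),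
      fun k i j a h => h7 k i j a h _ (hpt _),
      fun k i j a b h => h8 k i j a b h _ _ ⟨hpt _, hpt _⟩,
      fun k i j a b h => h9 k i j a b h _ _ ⟨hpt _, hpt _⟩, ?_⟩
    · intro c d hcd h
      exact h5 c d hcd (pt c) ⟨hpt c, h ▸ hpt d⟩
    · intro k i j a x hx
      obtain ⟨b, hb⟩ := h10 k i j a _ x ⟨hpt _, hx⟩
      exact ⟨b, (hiff _ _).1 hb⟩
  · rintro ⟨pt, hiff, h1, h2, h3, h4, h5, h6, h7, h8, h9, h10⟩
    simp only [hiff]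
    refine ⟨⟨⟨⟨⟨⟨⟨⟨⟨h1, h2, h3, h4⟩, fun c => ⟨_, rfl⟩⟩, ?_⟩, ?_⟩, ?_⟩, ?_⟩, ?_⟩, ?_⟩, ?_⟩
    · rintro c x y ⟨rfl, rfl⟩
      rfl
    · rintro c d hcd x ⟨h, h'⟩
      exact h5 c d hcd (h.symm.trans h')
    · rintro k i j a h x rfl
      exact h6 k i j a h
    · rintro k i j a h x rfl
      exact h7 k i j a h
    · rintro k i j a b h x y ⟨rfl, rfl⟩
      exact h8 k i j a b h
    · rintro k i j a b h x y ⟨rfl, rfl⟩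
      exact h9 k i j a b h
    · rintro k i j a x y ⟨rfl, h⟩
      exact h10 k i j a y h

end TreeTheory

/-! ## Axiomatizability, countability and interpretations -/

namespace FOComplexity

variable {L L' : FirstOrder.Language.{0, 0}}

/-- All blocks may be empty. The two classes are treated together because each is defined from the
other. -/
theorem isForall_and_isExists_of_isQF {α : Type} {m : ℕ} {φ : L.BoundedFormula α m} (h : φ.IsQF) :
    ∀ n, IsForall n m φ ∧ IsExists n m φ
  | 0 => by
    rw [IsForall, IsExists]
    exact ⟨h, h⟩
  | n + 1 => by
    rw [IsForall, IsExists]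
    exact ⟨.base (isForall_and_isExists_of_isQF h n).2, .base (isForall_and_isExists_of_isQF h n).1⟩

theorem isForall_of_isQF {α : Type} {m : ℕ} {φ : L.BoundedFormula α m} (h : φ.IsQF) (n : ℕ) :
    IsForall n m φ := (isForall_and_isExists_of_isQF h n).1

theorem IsForall.all {α : Type} {n m : ℕ} {φ : L.BoundedFormula α (m + 1)}
    (h : IsForall (n + 1) (m + 1) φ) : IsForall (n + 1) m φ.all := by
  rw [IsForall] at h ⊢
  exact .all h

theorem isForall_ex {α : Type} {n m : ℕ} {φ : L.BoundedFormula α (m + 1)}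
    (h : φ.IsQF) : IsForall (n + 2) m φ.ex := by
  rw [IsForall]
  refine .base ?_
  rw [IsExists]
  exact .ex (.base (isForall_of_isQF h n))

theorem isQF_iSup {α β : Type} [Finite β] {n : ℕ} {f : β → L.BoundedFormula α n}
    (h : ∀ b, (f b).IsQF) : (BoundedFormula.iSup f).IsQF := by
  let _ := Fintype.ofFinite β
  change (List.foldr (· ⊔ ·) ⊥ (List.map f Finset.univ.toList)).IsQF
  induction (Finset.univ : Finset β).toList with
  | nil => exact BoundedFormula.isQF_bot
  | cons b l ih => exact (h b).sup ih

theorem isQF_onBoundedFormula (g : L →ᴸ L') {α : Type} {n : ℕ} {φ : L.BoundedFormula α n}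
    (h : φ.IsQF) : (g.onBoundedFormula φ).IsQF := by
  induction h with
  | falsum => exact .falsum
  | of_isAtomic h =>
    cases h with
    | equal t₁ t₂ => exact (BoundedFormula.IsAtomic.equal _ _).isQF
    | rel R ts => exact (BoundedFormula.IsAtomic.rel _ _).isQF
  | imp _ _ ih₁ ih₂ => exact ih₁.imp ih₂

theorem isForall_onBoundedFormula (g : L →ᴸ L') {α : Type} (n : ℕ) :
    ∀ {m : ℕ} {φ : L.BoundedFormula α m}, (IsForall n m φ → IsForall n m (g.onBoundedFormula φ)) ∧
      (IsExists n m φ → IsExists n m (g.onBoundedFormula φ)) := by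
  induction n with
  | zero =>
    intro m φ
    rw [IsForall, IsForall, IsExists, IsExists]
    exact ⟨isQF_onBoundedFormula g, isQF_onBoundedFormula g⟩
  | succ n ih =>
    intro m φ
    rw [IsForall, IsForall, IsExists, IsExists]
    constructor
    · intro h
      induction h with
      | base h => exact .base (ih.2 h)
      | all _ ih' => exact .all ih'
    · intro h
      induction h with
      | base h => exact .base (ih.1 h)
      | @ex m φ _ ih' =>
        have e : g.onBoundedFormula φ.ex = (g.onBoundedFormula φ).ex := rfl
        rw [e]
        exact .ex ih'

/-- The sentence `φ` is equivalent to a `∀ₙ`-sentence. -/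
def IsForallUpToEquiv (n : ℕ) (φ : L.Sentence) : Prop :=
  ∃ ψ : L.Sentence, IsForall n 0 ψ ∧ ∀ (M : Type) [L.Structure M], M ⊨ φ ↔ M ⊨ ψ

theorem IsForall.isForallUpToEquiv {n : ℕ} {φ : L.Sentence} (h : IsForall n 0 φ) :
    IsForallUpToEquiv n φ := ⟨φ, h, fun _ _ => Iff.rfl⟩

theorem IsForallUpToEquiv.onSentence {n : ℕ} {φ : L.Sentence} (h : IsForallUpToEquiv n φ)
    (g : L →ᴸ L') : IsForallUpToEquiv n (g.onSentence φ) := by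
  obtain ⟨ψ, h1, h2⟩ := h
  refine ⟨g.onSentence ψ, (isForall_onBoundedFormula g n).1 h1, fun M _ => ?_⟩
  let _ := g.reduct M
  have := LHom.isExpansionOn_reduct g M
  rw [LHom.realize_onSentence, LHom.realize_onSentence]
  exact h2 M

/-- The set of all `∀ₙ`-consequences of `T` serves as the axioms, so the equivalent sentences need
not be chosen. -/
theorem forallAxiomatizable_of {n : ℕ} {T : L.Theory} (h : ∀ φ ∈ T, IsForallUpToEquiv n φ) :
    ForallAxiomatizable n T := by
  refine ⟨{ψ | IsForall n 0 ψ ∧ T ⊨ᵇ ψ}, fun φ hφ => hφ.1, fun φ => ?_⟩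
  constructor
  · intro hS
    rw [models_sentence_iff] at hS ⊢
    intro M
    have : M ⊨ {ψ : L.Sentence | IsForall n 0 ψ ∧ T ⊨ᵇ ψ} :=
      (Theory.model_iff _).2 fun ψ hψ => hψ.2.realize_sentence M
    exact hS (ModelType.of _ M)
  · intro hT
    rw [models_sentence_iff] at hT ⊢
    intro M
    have : M ⊨ T := by
      refine (Theory.model_iff _).2 fun ψ hψ => ?_
      obtain ⟨χ, h1, h2⟩ := h ψ hψ
      rw [h2 M]
      refine M.is_model.realize_of_mem χ ⟨h1, ?_⟩
      rw [models_sentence_iff]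
      intro N
      rw [← h2 N]
      exact N.is_model.realize_of_mem ψ hψ
    exact hT (ModelType.of _ M)

/-- Precomposing the coordinate map of an interpretation with an isomorphism. -/
theorem Interp.Interprets.comp_equiv {Γ : Interp L L'} {M M' N : Type} [L.Structure M]
    [L.Structure M'] [L'.Structure N] {f : (Fin Γ.dim → M') → N} (h : Γ.Interprets M' N f)
    (F : M ≃[L] M') : Γ.Interprets M N fun a => f (F ∘ a) := by
  have key {β : Type} (φ : L.Formula β) (v : β → M) : φ.Realize (F ∘ v) ↔ φ.Realize v :=
    StrongHomClass.realize_formula F φ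
  constructor
  · intro b
    obtain ⟨a, ha, rfl⟩ := h.surj b
    have e : F ∘ (F.symm ∘ a) = a := funext fun i => F.apply_symm_apply (a i)
    exact ⟨F.symm ∘ a, (key _ _).1 (e.symm ▸ ha), by rw [e]⟩
  · intro a a' ha ha'
    rw [h.eq_iff _ _ ((key _ _).2 ha) ((key _ _).2 ha'), ← Sum.comp_elim, key]
  · intro k R a ha
    rw [h.rel_iff k R _ fun i => (key _ _).2 (ha i)]
    exact key (Γ.rel k R) fun q => a q.1 q.2
  · intro k G a b ha hb
    rw [h.func_iff k G _ _ (fun i => (key _ _).2 (ha i)) ((key _ _).2 hb),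
      ← key (Γ.func k G), Sum.comp_elim]
    rfl

/-- The one-dimensional interpretation on the same domain given by formulas for the symbols. -/
def idInterp (r : ∀ n, L'.Relations n → L.Formula (Fin n))
    (f : ∀ n, L'.Functions n → L.Formula (Fin n ⊕ Fin 1)) : Interp L L' where
  dim := 1
  dom := ⊤
  eq := Term.equal (Term.var (Sum.inl 0)) (Term.var (Sum.inr 0))
  rel k R := (r k R).relabel fun i => (i, 0)
  func k G := (f k G).relabel (Sum.map (fun i => (i, 0)) id)

/-- The formulas `r` and `f` define the `L'`-structure of `M` in the `L`-structure of `M`. -/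
structure Describes (r : ∀ n, L'.Relations n → L.Formula (Fin n))
    (f : ∀ n, L'.Functions n → L.Formula (Fin n ⊕ Fin 1)) {M : Type} (s : L.Structure M)
    (s' : L'.Structure M) : Prop where
  rel : ∀ n (R : L'.Relations n) (xs : Fin n → M), Structure.RelMap R xs ↔ (r n R).Realize xs
  func : ∀ n (F : L'.Functions n) (xs : Fin n → M) (y : Fin 1 → M),
    Structure.funMap F xs = y 0 ↔ (f n F).Realize (Sum.elim xs y)

section IdInterp

variable {r : ∀ n, L'.Relations n → L.Formula (Fin n)}
  {f : ∀ n, L'.Functions n → L.Formula (Fin n ⊕ Fin 1)}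

theorem Describes.interprets {M : Type} {s : L.Structure M} {s' : L'.Structure M}
    (h : Describes r f s s') : (idInterp r f).Interprets M M fun a : Fin 1 → M => a 0 where
  surj b := ⟨fun _ => b, Formula.realize_top.2 trivial, rfl⟩
  eq_iff a a' _ _ := Iff.symm Formula.realize_equal
  rel_iff k R a _ := by
    refine (h.rel k R _).trans (Iff.symm (Formula.realize_relabel.trans ?_))
    rfl
  func_iff k F a b _ _ := by
    refine (h.func k F _ (b : Fin 1 → M)).trans (Iff.symm (Formula.realize_relabel.trans ?_))
    refine iff_of_eq (congrArg _ ?_)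
    funext x
    rcases x with x | x <;> rfl

/-- With trivial domain and genuine equality, every coordinate map of the interpretation is a
bijection, and the formulas force it to be an isomorphism. This handles the arbitrary models and
coordinate maps in `DefinesReturnIso`. -/
theorem Describes.exists_equiv {M N : Type} {s : L.Structure M} {s' : L'.Structure M}
    (h : Describes r f s s') [L'.Structure N] {g : (Fin 1 → M) → N}
    (hg : (idInterp r f).Interprets M N g) : ∃ F : M ≃[L'] N, ∀ x, F x = g fun _ => x := by
  have top (a : Fin 1 → M) : (idInterp r f).dom.Realize a := Formula.realize_top.2 trivial
  have const (a : Fin 1 → M) : a = fun _ => a 0 := funext fun i => by rw [Subsingleton.elim i 0]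
  have bij : Function.Bijective fun x : M => g fun _ => x := by
    constructor
    · intro x y hxy
      have := (hg.eq_iff (fun _ => x) (fun _ => y) (top _) (top _)).1 hxy
      exact Formula.realize_equal.1 this
    · intro b
      obtain ⟨a, -, rfl⟩ := hg.surj b
      exact ⟨a (0 : Fin 1), congrArg g (const a).symm⟩
  refine ⟨⟨Equiv.ofBijective _ bij, fun {n} F xs => ?_, fun {n} R xs => ?_⟩, fun x => rfl⟩
  · have h1 := hg.func_iff n F (fun i _ => xs i) (fun _ => Structure.funMap F xs)
      (fun i => top _) (top _)
    refine (h1.2 ?_).symm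
    refine Formula.realize_relabel.2 ?_
    have h2 := (h.func n F xs fun _ => Structure.funMap F xs).1 rfl
    refine (iff_of_eq (congrArg _ ?_)).1 h2
    funext x
    rcases x with x | x <;> rfl
  · refine (hg.rel_iff n R (fun i _ => xs i) fun i => top _).trans ?_
    exact Formula.realize_relabel.trans (h.rel n R xs).symm

/-- The given `N` is isomorphic to the structure described on `M` itself. Pulling the second
interpretation back along this isomorphism gives one of `M'` in `M` whose described structure is the
original one. So the return map is the identity on elements and is defined by equality. -/
theorem definesReturnIso {T : L.Theory} {T' : L'.Theory}
    {r' : ∀ n, L.Relations n → L'.Formula (Fin n)}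
    {f' : ∀ n, L.Functions n → L'.Formula (Fin n ⊕ Fin 1)}
    (h : ∀ (M : Type) (s : L.Structure M), M ⊨ T → ∃ s' : L'.Structure M,
      Describes r f s s' ∧ Describes r' f' s' s) :
    ∃ χ, DefinesReturnIso T T' (idInterp r f) (idInterp r' f') χ := by
  refine ⟨Term.equal (Term.var (Sum.inl ((0 : Fin 1), (0 : Fin 1)))) (Term.var (Sum.inr 0)), ?_⟩
  intro M N g M' g' hg hg'
  obtain ⟨s', h1, h2⟩ := h M M.struc M.is_model
  obtain ⟨F, hF⟩ := h1.exists_equiv hg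
  obtain ⟨G, hG⟩ := h2.exists_equiv (hg'.comp_equiv F)
  refine ⟨G.symm, fun a b _ _ => ?_⟩
  have e : (fun i => g (a i)) = F ∘ fun _ : Fin 1 => a (0 : Fin 1) (0 : Fin 1) := by
    funext (i : Fin 1)
    rw [Function.comp_apply, hF, Subsingleton.elim i 0]
    congr 1
    funext (j : Fin 1)
    rw [Subsingleton.elim j 0]
  have e' : g' (fun i => g (a i)) = G (a (0 : Fin 1) (0 : Fin 1)) := by
    rw [e, hG]
    rfl
  rw [e', G.symm_apply_apply]
  refine Iff.symm (Formula.realize_equal.trans ?_)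
  rfl

end IdInterp

end FOComplexity

-- Bi-interpretability from uniform definability over forests

namespace TreeTheory

open FOComplexity

variable {code : FinIndex × ℕ → ℕ} {L L' : FirstOrder.Language.{0, 0}} {T : L.Theory}
  {T' : L'.Theory}

/-- The symbols of the second language are definable in the first language, uniformly over all
forests with marked points. -/
structure Presentation.Defines (P : Presentation code L T) (P' : Presentation code L' T') : Prop where
  rel : ∀ n (R : L'.Relations n), ∃ φ : L.Formula (Fin n), ∀ {M : Type} {s : L.Structure M}
    {s' : L'.Structure M} {D : Forest M}, P.Rep s D → P'.Rep s' D →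
    ∀ xs : Fin n → M, Structure.RelMap R xs ↔ φ.Realize xs
  func : ∀ n (F : L'.Functions n), ∃ φ : L.Formula (Fin n ⊕ Fin 1), ∀ {M : Type}
    {s : L.Structure M} {s' : L'.Structure M} {D : Forest M}, P.Rep s D → P'.Rep s' D →
    ∀ (xs : Fin n → M) (y : Fin 1 → M),
      Structure.funMap F xs = y 0 ↔ φ.Realize (Sum.elim xs y)

/-- A model of one theory represents a forest, and that forest is represented by a model of the
other theory on the same carrier; the defining formulas relate the two structures in both
directions. -/
theorem Presentation.biInterpretable {P : Presentation code L T} {P' : Presentation code L' T'}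
    (h : P.Defines P') (h' : P'.Defines P) : BiInterpretable T T' := by
  choose r hr using h.rel
  choose f hf using h.func
  choose r' hr' using h'.rel
  choose f' hf' using h'.func
  have key {M : Type} {s : L.Structure M} {s' : L'.Structure M} {D : Forest M} (hs : P.Rep s D)
      (hs' : P'.Rep s' D) : Describes r f s s' ∧ Describes r' f' s' s :=
    ⟨⟨fun n R => hr n R hs hs', fun n F => hf n F hs hs'⟩,
      ⟨fun n R => hr' n R hs' hs, fun n F => hf' n F hs' hs⟩⟩
  have h1 (M : Type) (s : L.Structure M) (hM : M ⊨ T) :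
      ∃ s' : L'.Structure M, M ⊨ T' ∧ Describes r f s s' ∧ Describes r' f' s' s := by
    obtain ⟨D, hD⟩ := P.exists_forest M hM
    obtain ⟨s', hs'⟩ := P'.exists_structure D
    exact ⟨s', P'.models hs', key hD hs'⟩
  have h2 (M : Type) (s' : L'.Structure M) (hM : M ⊨ T') :
      ∃ s : L.Structure M, M ⊨ T ∧ Describes r' f' s' s ∧ Describes r f s s' := by
    obtain ⟨D, hD⟩ := P'.exists_forest M hM
    obtain ⟨s, hs⟩ := P.exists_structure D
    exact ⟨s, P.models hs, (key hs hD).symm⟩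
  refine ⟨idInterp r f, idInterp r' f', fun M => ?_, fun M => ?_, definesReturnIso fun M s hM => ?_,
    definesReturnIso fun M s hM => ?_⟩
  · obtain ⟨s', hM, hd, -⟩ := h1 M M.struc M.is_model
    exact ⟨ModelType.of T' M, _, hd.interprets⟩
  · obtain ⟨s', hM, hd, -⟩ := h2 M M.struc M.is_model
    exact ⟨ModelType.of T M, _, hd.interprets⟩
  · obtain ⟨s', -, hd⟩ := h1 M s hM
    exact ⟨s', hd⟩
  · obtain ⟨s', -, hd⟩ := h2 M s hM
    exact ⟨s', hd⟩

end TreeTheory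

-- The concrete presentations of the three theories

namespace TreeTheory

open FOComplexity Filter

/-- The data of the predecessor functions of a forest. -/
def Forest.pred {M : Type} (D : Forest M) (k : ℕ) (x : M) : M :=
  open Classical in if D.lev x = some (k + 1) then D.par x else x

theorem Forest.pred_of_lev {M : Type} (D : Forest M) {k : ℕ} {x : M}
    (h : D.lev x = some (k + 1)) : D.pred k x = D.par x := if_pos h

theorem vec_one {M : Type} (xs : Fin 1 → M) : xs = ![xs 0] :=
  funext fun i => by rw [Subsingleton.elim i 0]; rfl

theorem vec_two {M : Type} (xs : Fin 2 → M) : xs = ![xs 0, xs 1] := by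
  funext i
  fin_cases i <;> rfl

/-- `s` represents `D`. -/
structure RepC {M : Type} (s : constLang.Structure M) (D : Forest M) : Prop where
  lv : ∀ k x, lvC k x ↔ D.lev x = some k
  bl : ∀ k x y, blC k x y ↔ D.lev y = some (k + 1) ∧ D.par y = x
  pt : ∀ c, ptC M c = D.pt c

/-- `s` represents `D`. -/
structure RepF {M : Type} (s : predLang.Structure M) (D : Forest M) : Prop where
  lv : ∀ k x, lvF k x ↔ D.lev x = some k
  pr : ∀ k x, prF k x = D.pred k x
  pt : ∀ c, ptF M c = D.pt c

/-- `s` represents `D`. -/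
structure RepR {M : Type} (s : markLang.Structure M) (D : Forest M) : Prop where
  lv : ∀ k x, lvR k x ↔ D.lev x = some k
  bl : ∀ k x y, blR k x y ↔ D.lev y = some (k + 1) ∧ D.par y = x
  mark : ∀ c x, mkR c x ↔ x = D.pt c

/-- Case analysis on relation symbols of the language with constants. -/
@[elab_as_elim]
theorem constLang_rel_cases {p : ∀ n, constLang.Relations n → Prop}
    (h1 : ∀ k, p 1 ((treeLang.lhomWithConstants Const).onRelation (levelSym k)))
    (h2 : ∀ k, p 2 ((treeLang.lhomWithConstants Const).onRelation (belowSym k))) :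
    ∀ n R, p n R := by
  rintro n (R | R)
  · cases R with
    | level k => exact h1 k
    | below k => exact h2 k
  · exact isEmptyElim R

@[elab_as_elim]
theorem constLang_func_cases {p : ∀ n, constLang.Functions n → Prop}
    (h : ∀ c, p 0 (treeLang.con c)) : ∀ n F, p n F := by
  rintro n (F | F)
  · exact F.elim
  · match n, F with
    | 0, c => exact h c
    | n + 1, F => exact PEmpty.elim F

@[elab_as_elim]
theorem predLang_rel_cases {p : ∀ n, predLang.Relations n → Prop}
    (h1 : ∀ k, p 1 ((predBase.lhomWithConstants Const).onRelation (levelSymF k))) :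
    ∀ n R, p n R := by
  rintro n (R | R)
  · cases R with
    | level k => exact h1 k
  · exact isEmptyElim R

@[elab_as_elim]
theorem predLang_func_cases {p : ∀ n, predLang.Functions n → Prop}
    (h1 : ∀ k, p 1 ((predBase.lhomWithConstants Const).onFunction (predSym k)))
    (h : ∀ c, p 0 (predBase.con c)) : ∀ n F, p n F := by
  rintro n (F | F)
  · cases F with
    | pred k => exact h1 k
  · match n, F with
    | 0, c => exact h c
    | n + 1, F => exact PEmpty.elim F

@[elab_as_elim]
theorem markLang_rel_cases {p : ∀ n, markLang.Relations n → Prop}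
    (h1 : ∀ k, p 1 ((LHom.sumInl : treeLang →ᴸ markLang).onRelation (levelSym k)))
    (h2 : ∀ k, p 2 ((LHom.sumInl : treeLang →ᴸ markLang).onRelation (belowSym k)))
    (h3 : ∀ c, p 1 ((LHom.sumInr : markBase →ᴸ markLang).onRelation (markSym c))) :
    ∀ n R, p n R := by
  rintro n (R | R)
  · cases R with
    | level k => exact h1 k
    | below k => exact h2 k
  · cases R with
    | mark c => exact h3 c

theorem markLang_isRelational : markLang.IsRelational := by
  intro n
  refine ⟨?_⟩
  rintro (F | F)
  · exact F.elim
  · exact F.elim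

section Preservation

variable {code : FinIndex × ℕ → ℕ} {d : ℕ} {M N : Type} {D : Forest M} {D' : Forest N}
  {E : M → N → Prop}

theorem PartialIso.below_iff (h : PartialIso code d D D' E) {k : ℕ} (hk : k + 1 < d) {x x' : M}
    {y y' : N} (hxy : E x y) (hxy' : E x' y') :
    (D.lev x' = some (k + 1) ∧ D.par x' = x) ↔ (D'.lev y' = some (k + 1) ∧ D'.par y' = y) := by
  rw [h.lev hxy' _ hk]
  refine and_congr_right fun hl => ?_
  exact h.inj (h.par hxy' k hk ((h.lev hxy' _ hk).2 hl)) hxy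

theorem PartialIso.pred (h : PartialIso code d D D' E) {k : ℕ} (hk : k + 1 < d) {x : M} {y : N}
    (hxy : E x y) : E (D.pred k x) (D'.pred k y) := by
  unfold Forest.pred
  have := h.lev hxy _ hk
  split_ifs with h1 h2 h2
  · exact h.par hxy k hk h1
  · exact absurd (this.1 h1) h2
  · exact absurd (this.2 h2) h1
  · exact hxy

end Preservation

variable (code : FinIndex × ℕ → ℕ)

/-- The presentation of `constTheory`. -/
noncomputable def constPresentation : Presentation code constLang constTheory where
  Rep := RepC
  exists_forest M s hM := by
    obtain ⟨D, h1, h2, h3⟩ := (model_constTheory_iff.1 hM).exists_forest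
    exact ⟨D, h1, h2, h3⟩
  exists_structure {M} D := by
    let _ : treeLang.Structure M := treeStructure D.lev D.par
    let _ : (constantsOn Const).Structure M := constantsOn.structure D.pt
    exact ⟨inferInstance, fun _ _ => Iff.rfl, fun _ _ _ => Iff.rfl, fun _ => rfl⟩
  models {M s D} h := model_constTheory_iff.2 (D.markedTree h.lv h.bl h.pt)
  func {n} F := by
    refine constLang_func_cases (fun c => ?_) n F
    filter_upwards [eventually_gt_atTop (code (c.i, c.j))] with d hd
    intro M N s s' D D' h h' E hE xs ys _
    have := hE.pt c hd
    rw [← h.pt, ← h'.pt] at this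
    rwa [Subsingleton.elim xs default, Subsingleton.elim ys default]
  rel {n} R := by
    refine constLang_rel_cases (fun k => ?_) (fun k => ?_) n R
    · filter_upwards [eventually_gt_atTop k] with d hd
      intro M N s s' D D' h h' E hE xs ys hxy
      rw [vec_one xs, vec_one ys]
      exact (h.lv k _).trans ((hE.lev (hxy 0) k hd).trans (h'.lv k _).symm)
    -- The relation `<ₖ` reaches up to level `k + 1`, so this level has to be visible.
    · filter_upwards [eventually_gt_atTop (k + 1)] with d hd
      intro M N s s' D D' h h' E hE xs ys hxy
      rw [vec_two xs, vec_two ys]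
      exact (h.bl k _ _).trans ((hE.below_iff hd (hxy 0) (hxy 1)).trans (h'.bl k _ _).symm)
  child k := ⟨isBelowC k (Term.var (Sum.inl 0)) (Term.var (Sum.inl 1)), fun h v =>
    realize_isBelowC.trans (h.bl k _ _)⟩

/-- The presentation of `predTheory`. -/
noncomputable def predPresentation : Presentation code predLang predTheory where
  Rep := RepF
  exists_forest M s hM := by
    obtain ⟨h, hfix⟩ := model_predTheory_iff.1 hM
    obtain ⟨D, h1, h2, h3⟩ := h.exists_forest
    refine ⟨D, h1, fun k x => ?_, h3⟩
    unfold Forest.pred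
    split_ifs with hx
    · exact ((h2 k (D.par x) x).2 ⟨hx, rfl⟩).2
    · exact hfix k x fun hl => hx ((h1 _ _).1 hl)
  exists_structure {M} D := by
    let _ : predBase.Structure M :=
      { funMap := fun F v => match F with
          | PredFunc.pred k => D.pred k (v 0)
        RelMap := fun R v => match R with
          | LevelRel.level k => D.lev (v 0) = some k }
    let _ : (constantsOn Const).Structure M := constantsOn.structure D.pt
    exact ⟨inferInstance, fun _ _ => Iff.rfl, fun _ _ => rfl, fun _ => rfl⟩
  models {M s D} h := by
    refine model_predTheory_iff.2 ⟨D.markedTree h.lv (fun k x y => ?_) h.pt, fun k x hx => ?_⟩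
    · rw [h.lv, h.pr]
      refine and_congr_right fun hy => ?_
      exact Eq.congr_left (D.pred_of_lev hy)
    · rw [h.lv] at hx
      rw [h.pr, Forest.pred, if_neg hx]
  func {n} F := by
    refine predLang_func_cases (fun k => ?_) (fun c => ?_) n F
    · filter_upwards [eventually_gt_atTop (k + 1)] with d hd
      intro M N s s' D D' h h' E hE xs ys hxy
      have := hE.pred hd (hxy 0)
      rw [← h.pr, ← h'.pr] at this
      rwa [vec_one xs, vec_one ys]
    · filter_upwards [eventually_gt_atTop (code (c.i, c.j))] with d hd
      intro M N s s' D D' h h' E hE xs ys _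
      have := hE.pt c hd
      rw [← h.pt, ← h'.pt] at this
      rwa [Subsingleton.elim xs default, Subsingleton.elim ys default]
  rel {n} R := by
    refine predLang_rel_cases (fun k => ?_) n R
    filter_upwards [eventually_gt_atTop k] with d hd
    intro M N s s' D D' h h' E hE xs ys hxy
    rw [vec_one xs, vec_one ys]
    exact (h.lv k _).trans ((hE.lev (hxy 0) k hd).trans (h'.lv k _).symm)
  child k := by
    refine ⟨isBelowF k (Term.var (Sum.inl 0)) (Term.var (Sum.inl 1)), fun {M s D} h v =>
      realize_isBelowF.trans ?_⟩
    rw [h.lv, h.pr]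
    refine and_congr_right fun hy => ?_
    exact Eq.congr_left (D.pred_of_lev hy)

/-- The presentation of `markTheory`. -/
noncomputable def markPresentation : Presentation code markLang markTheory where
  Rep := RepR
  exists_forest M s hM := by
    obtain ⟨pt, hpt, h⟩ := model_markTheory_iff.1 hM
    obtain ⟨D, h1, h2, h3⟩ := h.exists_forest
    exact ⟨D, h1, h2, fun c x => by rw [hpt, h3]⟩
  exists_structure {M} D := by
    let _ : treeLang.Structure M := treeStructure D.lev D.par
    let _ : markBase.Structure M :=
      { funMap := fun F _ => F.elim
        RelMap := fun R v => match R with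
          | MarkRel.mark c => v 0 = D.pt c }
    exact ⟨inferInstance, fun _ _ => Iff.rfl, fun _ _ _ => Iff.rfl, fun _ _ => Iff.rfl⟩
  models {M s D} h := model_markTheory_iff.2 ⟨D.pt, h.mark, D.markedTree h.lv h.bl fun _ => rfl⟩
  func {n} F := (markLang_isRelational n).elim F
  rel {n} R := by
    refine markLang_rel_cases (fun k => ?_) (fun k => ?_) (fun c => ?_) n R
    · filter_upwards [eventually_gt_atTop k] with d hd
      intro M N s s' D D' h h' E hE xs ys hxy
      rw [vec_one xs, vec_one ys]
      exact (h.lv k _).trans ((hE.lev (hxy 0) k hd).trans (h'.lv k _).symm)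
    · filter_upwards [eventually_gt_atTop (k + 1)] with d hd
      intro M N s s' D D' h h' E hE xs ys hxy
      rw [vec_two xs, vec_two ys]
      exact (h.bl k _ _).trans ((hE.below_iff hd (hxy 0) (hxy 1)).trans (h'.bl k _ _).symm)
    -- The two points named `c` are related to each other, and injectivity then gives that `U_c` is
    -- preserved.
    · filter_upwards [eventually_gt_atTop (code (c.i, c.j))] with d hd
      intro M N s s' D D' h h' E hE xs ys hxy
      rw [vec_one xs, vec_one ys]
      exact (h.mark c _).trans ((hE.inj (hxy 0) (hE.pt c hd)).trans (h'.mark c _).symm)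
  child k := ⟨isBelowR k (Term.var (Sum.inl 0)) (Term.var (Sum.inl 1)), fun h v =>
    realize_isBelowR.trans (h.bl k _ _)⟩

theorem predPresentation_defines_const :
    (predPresentation code).Defines (constPresentation code) where
  rel n R := by
    refine constLang_rel_cases (fun k => ?_) (fun k => ?_) n R
    · refine ⟨inLevelF k (Term.var (Sum.inl 0)), fun {M s s' D} h h' xs => ?_⟩
      refine Iff.trans ?_ realize_inLevelF.symm
      rw [vec_one xs]
      exact (h'.lv k _).trans (h.lv k _).symm
    · refine ⟨isBelowF k (Term.var (Sum.inl 0)) (Term.var (Sum.inl 1)),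
        fun {M s s' D} h h' xs => ?_⟩
      refine Iff.trans ?_ realize_isBelowF.symm
      rw [vec_two xs]
      refine (h'.bl k _ _).trans ?_
      rw [h.lv, h.pr]
      refine and_congr_right fun hy => ?_
      exact (Eq.congr_left (D.pred_of_lev hy)).symm
  func n F := by
    refine constLang_func_cases (fun c => ?_) n F
    refine ⟨(cstF c).bdEqual (Term.var (Sum.inl (Sum.inr 0))), fun {M s s' D} h h' xs y => ?_⟩
    refine Iff.trans ?_ (BoundedFormula.realize_bdEqual _ _).symm
    rw [realize_cstF, h.pt, ← h'.pt, Subsingleton.elim xs default]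
    rfl

theorem constPresentation_defines_pred :
    (constPresentation code).Defines (predPresentation code) where
  rel n R := by
    refine predLang_rel_cases (fun k => ?_) n R
    refine ⟨inLevelC k (Term.var (Sum.inl 0)), fun {M s s' D} h h' xs => ?_⟩
    refine Iff.trans ?_ realize_inLevelC.symm
    rw [vec_one xs]
    exact (h'.lv k _).trans (h.lv k _).symm
  func n F := by
    refine predLang_func_cases (fun k => ?_) (fun c => ?_) n F
    · refine ⟨isBelowC k (Term.var (Sum.inl (Sum.inr 0))) (Term.var (Sum.inl (Sum.inl 0))) ⊔
        (∼(inLevelC (k + 1) (Term.var (Sum.inl (Sum.inl 0)))) ⊓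
          (Term.var (Sum.inl (Sum.inl 0))).bdEqual (Term.var (Sum.inl (Sum.inr 0)))),
        fun {M s s' D} h h' xs y => ?_⟩
      rw [Formula.Realize, BoundedFormula.realize_sup, BoundedFormula.realize_inf,
        BoundedFormula.realize_not, BoundedFormula.realize_bdEqual, realize_isBelowC,
        realize_inLevelC, h.bl, h.lv]
      have : Structure.funMap ((predBase.lhomWithConstants Const).onFunction (predSym k)) xs =
          D.pred k (xs 0) := by
        rw [vec_one xs]
        exact h'.pr k (xs 0)
      rw [this]
      simp only [Term.realize_var, Sum.elim_inl, Sum.elim_inr, Forest.pred]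
      split_ifs with hx <;> simp [hx]
    · refine ⟨(cst c).bdEqual (Term.var (Sum.inl (Sum.inr 0))), fun {M s s' D} h h' xs y => ?_⟩
      refine Iff.trans ?_ (BoundedFormula.realize_bdEqual _ _).symm
      rw [realize_cst, h.pt, ← h'.pt, Subsingleton.elim xs default]
      rfl

theorem markPresentation_defines_const :
    (markPresentation code).Defines (constPresentation code) where
  rel n R := by
    refine constLang_rel_cases (fun k => ?_) (fun k => ?_) n R
    · refine ⟨inLevelR k (Term.var (Sum.inl 0)), fun {M s s' D} h h' xs => ?_⟩
      refine Iff.trans ?_ realize_inLevelR.symm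
      rw [vec_one xs]
      exact (h'.lv k _).trans (h.lv k _).symm
    · refine ⟨isBelowR k (Term.var (Sum.inl 0)) (Term.var (Sum.inl 1)),
        fun {M s s' D} h h' xs => ?_⟩
      refine Iff.trans ?_ realize_isBelowR.symm
      rw [vec_two xs]
      exact (h'.bl k _ _).trans (h.bl k _ _).symm
  func n F := by
    refine constLang_func_cases (fun c => ?_) n F
    refine ⟨isMark c (Term.var (Sum.inl (Sum.inr 0))), fun {M s s' D} h h' xs y => ?_⟩
    refine Iff.trans ?_ realize_isMark.symm
    rw [h.mark, ← h'.pt, Subsingleton.elim xs default]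
    exact eq_comm

theorem constPresentation_defines_mark :
    (constPresentation code).Defines (markPresentation code) where
  rel n R := by
    refine markLang_rel_cases (fun k => ?_) (fun k => ?_) (fun c => ?_) n R
    · refine ⟨inLevelC k (Term.var (Sum.inl 0)), fun {M s s' D} h h' xs => ?_⟩
      refine Iff.trans ?_ realize_inLevelC.symm
      rw [vec_one xs]
      exact (h'.lv k _).trans (h.lv k _).symm
    · refine ⟨isBelowC k (Term.var (Sum.inl 0)) (Term.var (Sum.inl 1)),
        fun {M s s' D} h h' xs => ?_⟩
      refine Iff.trans ?_ realize_isBelowC.symm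
      rw [vec_two xs]
      exact (h'.bl k _ _).trans (h.bl k _ _).symm
    · refine ⟨(Term.var (Sum.inl 0)).bdEqual (cst c), fun {M s s' D} h h' xs => ?_⟩
      refine Iff.trans ?_ (BoundedFormula.realize_bdEqual _ _).symm
      rw [realize_cst, h.pt, vec_one xs]
      exact h'.mark c _
  func n F := (markLang_isRelational n).elim F

end TreeTheory

namespace TreeTheory

open FOComplexity

/-! ### Countability of the languages -/

theorem FinModel.equivalent_of_card_eq {A B : FinModel} (h : A.card = B.card)
    {lev : Fin A.card → Option ℕ} {par : Fin A.card → Fin A.card}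
    (h1 : ∀ k x, lev x = some k ↔ Structure.RelMap (levelSym k) ![x])
    (h2 : ∀ k x y, Structure.RelMap (belowSym k) ![x, y] ↔ lev y = some (k + 1) ∧ par y = x)
    (h3 : ∀ k x, lev x = some k ↔ Structure.RelMap (levelSym k) ![x.cast h])
    (h4 : ∀ k x y, Structure.RelMap (belowSym k) ![Fin.cast h x, Fin.cast h y] ↔
      lev y = some (k + 1) ∧ par y = x) : A ≈ B := by
  refine ⟨⟨finCongr h, fun {n} F => Empty.elim F, fun {n} R xs => ?_⟩⟩
  cases R with
  | level k =>
    have e : (finCongr h : _ → _) ∘ xs = ![Fin.cast h (xs 0)] := vec_one _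
    rw [Equiv.toFun_as_coe, e, vec_one xs]
    exact (h3 k _).symm.trans (h1 k _)
  | below k =>
    have e : (finCongr h : _ → _) ∘ xs = ![Fin.cast h (xs 0), Fin.cast h (xs 1)] := vec_two _
    rw [Equiv.toFun_as_coe, e, vec_two xs]
    exact (h4 k _ _).trans (h2 k _ _).symm

/-- A finite model is determined up to isomorphism by its cardinality, level function and parent
function. These range over a countable set, even though there are infinitely many symbols. -/
instance : Countable FinIndex := by
  choose lev par h1 h2 _ _ using FinModel.exists_tree
  have key (n : ℕ) (A B : FinModel) (hA : A.card = n) (hB : B.card = n)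
      (hl : ∀ x : Fin n, lev A (x.cast hA.symm) = lev B (x.cast hB.symm))
      (hp : ∀ x : Fin n, (par A (x.cast hA.symm)).cast hA = (par B (x.cast hB.symm)).cast hB) :
      A ≈ B := by
    subst hA
    have hp' (x y) : par B (Fin.cast hB.symm y) = Fin.cast hB.symm x ↔ par A y = x := by
      have := congrArg Fin.val (hp y)
      simp only [Fin.val_cast, Fin.cast_eq_self] at this
      simp only [Fin.ext_iff, Fin.val_cast, this]
    refine FinModel.equivalent_of_card_eq hB.symm (h1 A) (h2 A) (fun k x => ?_) fun k x y => ?_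
    · rw [← h1, ← hl]
      rfl
    · rw [h2, ← hl, hp']
      rfl
  let g (i : FinIndex) : Σ n : ℕ, (Fin n → Option ℕ) × (Fin n → Fin n) :=
    ⟨(finModel i).card, lev _, par _⟩
  refine Function.Injective.countable (f := g) fun i i' h => ?_
  have : finModel i ≈ finModel i' := by
    rw [Sigma.mk.injEq] at h
    obtain ⟨hc, hd⟩ := h
    have hd' : ∀ {n m : ℕ} (_ : n = m) (p : (Fin n → Option ℕ) × (Fin n → Fin n))
        (q : (Fin m → Option ℕ) × (Fin m → Fin m)) (_ : n = m), HEq p q → ∀ x : Fin m,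
        p.1 (x.cast ‹n = m›.symm) = q.1 x ∧ (p.2 (x.cast ‹n = m›.symm)).cast ‹n = m› = q.2 x := by
      rintro n m rfl p q _ h x
      rw [eq_of_heq h]
      exact ⟨rfl, rfl⟩
    exact key _ _ _ hc rfl (fun x => (hd' hc _ _ hc hd x).1) fun x => (hd' hc _ _ hc hd x).2
  rw [← Quotient.out_eq i, ← Quotient.out_eq i']
  exact Quotient.sound this

theorem exists_code : ∃ code : FinIndex × ℕ → ℕ, code.Injective := Countable.exists_injective_nat _

instance : Countable Const := countable_const exists_code.choose_spec

instance (n : ℕ) : Countable (TreeRel n) := by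
  refine Function.Injective.countable (f := fun R : TreeRel n => match R with
    | .level k => (0, k)
    | .below k => (1, k)) fun R R' h => ?_
  cases R <;> cases R' <;> simp_all

instance (n : ℕ) : Countable (PredFunc n) := by
  refine Function.Injective.countable (f := fun R : PredFunc n => match R with
    | .pred k => k) fun R R' h => ?_
  cases R; cases R'; simp_all

instance (n : ℕ) : Countable (LevelRel n) := by
  refine Function.Injective.countable (f := fun R : LevelRel n => match R with
    | .level k => k) fun R R' h => ?_
  cases R; cases R'; simp_all

instance (n : ℕ) : Countable (MarkRel n) := by
  refine Function.Injective.countable (f := fun R : MarkRel n => match R with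
    | .mark c => c) fun R R' h => ?_
  cases R; cases R'; simp_all

theorem countable_symbols {L : FirstOrder.Language.{0, 0}} (h : ∀ n, Countable (L.Functions n))
    (h' : ∀ n, Countable (L.Relations n)) : Countable L.Symbols :=
  inferInstanceAs (Countable ((Σ n, L.Functions n) ⊕ Σ n, L.Relations n))

instance : ∀ n, Countable ((constantsOn Const).Functions n)
  | 0 => inferInstanceAs (Countable Const)
  | _ + 1 => inferInstanceAs (Countable PEmpty)

theorem countable_constLang : Countable constLang.Symbols :=
  countable_symbols (fun n => inferInstanceAs (Countable (Empty ⊕ (constantsOn Const).Functions n)))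
    fun n => inferInstanceAs (Countable (TreeRel n ⊕ Empty))

theorem countable_predLang : Countable predLang.Symbols :=
  countable_symbols
    (fun n => inferInstanceAs (Countable (PredFunc n ⊕ (constantsOn Const).Functions n)))
    fun n => inferInstanceAs (Countable (LevelRel n ⊕ Empty))

theorem countable_markLang : Countable markLang.Symbols :=
  countable_symbols (fun _ => inferInstanceAs (Countable (Empty ⊕ Empty)))
    fun n => inferInstanceAs (Countable (TreeRel n ⊕ MarkRel n))

/-! ### Axiomatizability -/

section QF

variable {α : Type} {n : ℕ}

theorem isQF_inLevel (k : ℕ) (t : treeLang.Term (α ⊕ Fin n)) : (inLevel k t).IsQF :=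
  (BoundedFormula.IsAtomic.rel _ _).isQF

theorem isQF_isBelow (k : ℕ) (s t : treeLang.Term (α ⊕ Fin n)) : (isBelow k s t).IsQF :=
  (BoundedFormula.IsAtomic.rel _ _).isQF

theorem isQF_inLevelC (k : ℕ) (t : constLang.Term (α ⊕ Fin n)) : (inLevelC k t).IsQF :=
  (BoundedFormula.IsAtomic.rel _ _).isQF

theorem isQF_isBelowC (k : ℕ) (s t : constLang.Term (α ⊕ Fin n)) : (isBelowC k s t).IsQF :=
  (BoundedFormula.IsAtomic.rel _ _).isQF

theorem isQF_inLevelF (k : ℕ) (t : predLang.Term (α ⊕ Fin n)) : (inLevelF k t).IsQF :=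
  (BoundedFormula.IsAtomic.rel _ _).isQF

theorem isQF_bdEqual {L : FirstOrder.Language.{0, 0}} (s t : L.Term (α ⊕ Fin n)) :
    (s.bdEqual t).IsQF := (BoundedFormula.IsAtomic.equal _ _).isQF

theorem isQF_isBelowF (k : ℕ) (s t : predLang.Term (α ⊕ Fin n)) : (isBelowF k s t).IsQF :=
  (isQF_inLevelF _ _).inf (isQF_bdEqual _ _)

theorem isQF_inLevelR (k : ℕ) (t : markLang.Term (α ⊕ Fin n)) : (inLevelR k t).IsQF :=
  (BoundedFormula.IsAtomic.rel _ _).isQF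

theorem isQF_isBelowR (k : ℕ) (s t : markLang.Term (α ⊕ Fin n)) : (isBelowR k s t).IsQF :=
  (BoundedFormula.IsAtomic.rel _ _).isQF

theorem isQF_isMark (c : Const) (t : markLang.Term (α ⊕ Fin n)) : (isMark c t).IsQF :=
  (BoundedFormula.IsAtomic.rel _ _).isQF

end QF

theorem isForallUpToEquiv_of_mem_baseTheory {φ : treeLang.Sentence} (hφ : φ ∈ baseTheory) :
    IsForallUpToEquiv 2 φ := by
  rcases hφ with ((⟨i, j, _, rfl⟩ | ⟨i, rfl⟩) | ⟨i, rfl⟩) | ⟨i, rfl⟩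
  · exact (isForall_of_isQF ((isQF_inLevel _ _).inf (isQF_inLevel _ _)).not
      _).all.isForallUpToEquiv
  · exact (isForall_of_isQF ((isQF_isBelow _ _ _).imp ((isQF_inLevel _ _).inf (isQF_inLevel _ _)))
      _).all.all.isForallUpToEquiv
  -- This axiom is not prenex, since its existential quantifier stands behind an implication. When
  -- the premise fails, `x` itself serves as a witness after the quantifier is pulled out.
  · refine ⟨∀' ∃' (inLevel (i + 1) (&0) ⟹ (inLevel i (&1) ⊓ isBelow i (&1) (&0))),
      (isForall_ex ((isQF_inLevel _ _).imp
        ((isQF_inLevel _ _).inf (isQF_isBelow _ _ _)))).all, fun M _ => ?_⟩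
    simp only [Sentence.Realize, Formula.Realize, BoundedFormula.realize_all,
      BoundedFormula.realize_ex, BoundedFormula.realize_imp]
    refine forall_congr' fun x => ?_
    have e (y : M) : (inLevel (α := Empty) (n := 2) (i + 1) (&0)).Realize default
        (Fin.snoc (Fin.snoc default x) y) ↔
        (inLevel (α := Empty) (n := 1) (i + 1) (&0)).Realize default (Fin.snoc default x) := by
      simp [inLevel, BoundedFormula.realize_rel₁, Fin.snoc]
    refine ⟨fun h => ?_, fun ⟨y, hy⟩ hx => ⟨y, hy ((e y).2 hx)⟩⟩
    by_cases hx : (inLevel (α := Empty) (n := 1) (i + 1) (&0)).Realize default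
        (Fin.snoc default x)
    · obtain ⟨y, hy⟩ := h hx
      exact ⟨y, fun _ => hy⟩
    · exact ⟨x, fun hx' => absurd ((e x).1 hx') hx⟩
  · exact (isForall_of_isQF (((isQF_isBelow _ _ _).inf (isQF_isBelow _ _ _)).imp
      (isQF_bdEqual _ _)) _).all.all.all.isForallUpToEquiv

theorem forallAxiomatizable_constTheory : ForallAxiomatizable 2 constTheory := by
  refine forallAxiomatizable_of fun φ hφ => ?_
  rcases hφ with (((((⟨φ, hφ, rfl⟩ | ⟨c, d, _, rfl⟩) | ⟨k, i, j, a, _, rfl⟩) |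
    ⟨k, i, j, a, _, rfl⟩) | ⟨k, i, j, a, b, _, rfl⟩) | ⟨k, i, j, a, b, _, rfl⟩) | ⟨k, i, j, a, rfl⟩
  · exact (isForallUpToEquiv_of_mem_baseTheory hφ).onSentence _
  · exact (isForall_of_isQF (isQF_bdEqual _ _).not _).isForallUpToEquiv
  · exact (isForall_of_isQF (isQF_inLevelC _ _) _).isForallUpToEquiv
  · exact (isForall_of_isQF (isQF_inLevelC _ _).not _).isForallUpToEquiv
  · exact (isForall_of_isQF (isQF_isBelowC _ _ _) _).isForallUpToEquiv
  · exact (isForall_of_isQF (isQF_isBelowC _ _ _).not _).isForallUpToEquiv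
  · exact (isForall_of_isQF (((isQF_isBelowC _ _ _).sup (isQF_isBelowC _ _ _)).imp
      (isQF_iSup fun b => isQF_bdEqual _ _)) _).all.isForallUpToEquiv

theorem forallAxiomatizable_predTheory : ForallAxiomatizable 1 predTheory := by
  refine forallAxiomatizable_of fun φ hφ => ?_
  rcases hφ with (((((((⟨i, j, _, rfl⟩ | ⟨k, rfl⟩) | ⟨k, rfl⟩) | ⟨c, d, _, rfl⟩) |
    ⟨k, i, j, a, _, rfl⟩) | ⟨k, i, j, a, _, rfl⟩) | ⟨k, i, j, a, b, _, rfl⟩) |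
    ⟨k, i, j, a, b, _, rfl⟩) | ⟨k, i, j, a, rfl⟩
  · exact (isForall_of_isQF ((isQF_inLevelF _ _).inf (isQF_inLevelF _ _)).not
      _).all.isForallUpToEquiv
  · exact (isForall_of_isQF ((isQF_inLevelF _ _).imp (isQF_inLevelF _ _)) _).all.isForallUpToEquiv
  · exact (isForall_of_isQF ((isQF_inLevelF _ _).not.imp (isQF_bdEqual _ _))
      _).all.isForallUpToEquiv
  · exact (isForall_of_isQF (isQF_bdEqual _ _).not _).isForallUpToEquiv
  · exact (isForall_of_isQF (isQF_inLevelF _ _) _).isForallUpToEquiv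
  · exact (isForall_of_isQF (isQF_inLevelF _ _).not _).isForallUpToEquiv
  · exact (isForall_of_isQF (isQF_isBelowF _ _ _) _).isForallUpToEquiv
  · exact (isForall_of_isQF (isQF_isBelowF _ _ _).not _).isForallUpToEquiv
  · exact (isForall_of_isQF (((isQF_isBelowF _ _ _).sup (isQF_isBelowF _ _ _)).imp
      (isQF_iSup fun b => isQF_bdEqual _ _)) _).all.isForallUpToEquiv

theorem forallAxiomatizable_markTheory : ForallAxiomatizable 2 markTheory := by
  refine forallAxiomatizable_of fun φ hφ => ?_
  rcases hφ with (((((((⟨φ, hφ, rfl⟩ | ⟨c, rfl⟩) | ⟨c, rfl⟩) | ⟨c, d, _, rfl⟩) |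
    ⟨k, i, j, a, _, rfl⟩) | ⟨k, i, j, a, _, rfl⟩) | ⟨k, i, j, a, b, _, rfl⟩) |
    ⟨k, i, j, a, b, _, rfl⟩) | ⟨k, i, j, a, rfl⟩
  · exact (isForallUpToEquiv_of_mem_baseTheory hφ).onSentence _
  · exact (isForall_ex (isQF_isMark _ _)).isForallUpToEquiv
  · exact (isForall_of_isQF (((isQF_isMark _ _).inf (isQF_isMark _ _)).imp (isQF_bdEqual _ _))
      _).all.all.isForallUpToEquiv
  · exact (isForall_of_isQF ((isQF_isMark _ _).inf (isQF_isMark _ _)).not _).all.isForallUpToEquiv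
  · exact (isForall_of_isQF ((isQF_isMark _ _).imp (isQF_inLevelR _ _)) _).all.isForallUpToEquiv
  · exact (isForall_of_isQF ((isQF_isMark _ _).imp (isQF_inLevelR _ _).not)
      _).all.isForallUpToEquiv
  · exact (isForall_of_isQF (((isQF_isMark _ _).inf (isQF_isMark _ _)).imp (isQF_isBelowR _ _ _))
      _).all.all.isForallUpToEquiv
  · exact (isForall_of_isQF (((isQF_isMark _ _).inf (isQF_isMark _ _)).imp
      (isQF_isBelowR _ _ _).not) _).all.all.isForallUpToEquiv
  · exact (isForall_of_isQF (((isQF_isMark _ _).inf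
      ((isQF_isBelowR _ _ _).sup (isQF_isBelowR _ _ _))).imp
      (isQF_iSup fun b => isQF_isMark _ _)) _).all.all.isForallUpToEquiv

end TreeTheory

-- The main theorem

theorem mainTheorem2 :
    (Countable TreeTheory.constLang.Symbols ∧
      TreeTheory.constTheory.IsComplete ∧
      FOComplexity.ForallAxiomatizable 2 TreeTheory.constTheory ∧
      FOComplexity.HasUnboundedTypes TreeTheory.constTheory ∧
      FOComplexity.StrictlySuperstable TreeTheory.constTheory) ∧
    (Countable TreeTheory.predLang.Symbols ∧
      TreeTheory.predTheory.IsComplete ∧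
      FOComplexity.ForallAxiomatizable 1 TreeTheory.predTheory ∧
      FOComplexity.HasUnboundedTypes TreeTheory.predTheory ∧
      FOComplexity.StrictlySuperstable TreeTheory.predTheory ∧
      FOComplexity.BiInterpretable TreeTheory.predTheory TreeTheory.constTheory) ∧
    (Countable TreeTheory.markLang.Symbols ∧
      TreeTheory.markLang.IsRelational ∧
      TreeTheory.markTheory.IsComplete ∧
      FOComplexity.ForallAxiomatizable 2 TreeTheory.markTheory ∧
      FOComplexity.HasUnboundedTypes TreeTheory.markTheory ∧
      FOComplexity.StrictlySuperstable TreeTheory.markTheory ∧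
      FOComplexity.BiInterpretable TreeTheory.markTheory TreeTheory.constTheory) := by
  obtain ⟨code, hcode⟩ := TreeTheory.exists_code
  let C := TreeTheory.constPresentation code
  let F := TreeTheory.predPresentation code
  let R := TreeTheory.markPresentation code
  exact ⟨⟨TreeTheory.countable_constLang, C.isComplete hcode TreeTheory.bigForest,
      TreeTheory.forallAxiomatizable_constTheory, C.hasUnboundedTypes,
      C.superstable hcode, C.not_stableIn⟩,
    ⟨TreeTheory.countable_predLang, F.isComplete hcode TreeTheory.bigForest,
      TreeTheory.forallAxiomatizable_predTheory, F.hasUnboundedTypes,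
      ⟨F.superstable hcode, F.not_stableIn⟩,
      TreeTheory.Presentation.biInterpretable
        (TreeTheory.predPresentation_defines_const code)
        (TreeTheory.constPresentation_defines_pred code)⟩,
    ⟨TreeTheory.countable_markLang, TreeTheory.markLang_isRelational,
      R.isComplete hcode TreeTheory.bigForest,
      TreeTheory.forallAxiomatizable_markTheory, R.hasUnboundedTypes,
      ⟨R.superstable hcode, R.not_stableIn⟩,
      TreeTheory.Presentation.biInterpretable
        (TreeTheory.markPresentation_defines_const code)
        (TreeTheory.constPresentation_defines_mark code)⟩⟩
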